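/- All graphs are finite and simple. For a graph $G$ let $\chi(G)$ be its chromatic number and let $h(G)$ be its Hadwiger number, the largest $t$ such that the complete graph $K^{t}$ on $t$ vertices is a minor of $G$. A graph is called solid if it is one of the following. (1) A pyramid: a cycle $C$ together with one further vertex that has at least three neighbours on $C$. (2) A trihedron: the union of three internally disjoint paths of length at least $2$ between two distinct vertices. (3) A stamp: the union of a triangle and three paths of length at least $1$ that start at the three different vertices of the triangle, end at a common vertex $x$, and are disjoint apart from $x$. (4) A prism: the union of two vertex-disjoint triangles $x_1x_2x_3$ and $y_1y_2y_3$ and three pairwise vertex-disjoint paths, the $i$-th from $x_i$ to $y_i$. Let $C(G)$ be the set of induced cycles of $G$ (of length at least $3$), and let $S(G)$ be the set of induced subgraphs of $G$ that are isomorphic to a solid graph. Put $$\beth^{1}(G)=|E(G)|-|V(G)|,\qquad \beth^{2}(G)=|C(G)|-|E(G)|+|V(G)|,$$ $$\beth^{3}(G)=|S(G)|-|C(G)|+|E(G)|-|V(G)|.$$ Theorem. Let $G$ be a finite connected simple graph. If $\beth^{i}(K^{h(G)})=\beth^{i}(G)$ for some $i\in\{1,2,3\}$, then $\chi(G)\le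 h(G)$, that is, $G$ satisfies Hadwiger's conjecture. -/

import Mathlib

universe u v

namespace SimpleGraph

/-- `H` is a minor of `G`, given by branch sets: pairwise disjoint connected (in particular
nonempty) vertex sets of `G`, one for each vertex of `H`, such that adjacent vertices of `H` have
branch sets joined by an edge of `G`. Contracting the branch sets inside a subgraph of `G`
yields `H`. -/
def IsGraphMinor {W : Type u} {V : Type v} (H : SimpleGraph W) (G : SimpleGraph V) : Prop :=
  ∃ B : W → Set V,
    (∀ a, (G.induce (B a)).Connected) ∧
    (∀ a b, a ≠ b → Disjoint (B a) (B b)) ∧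
    (∀ a b, H.Adj a b → ∃ x ∈ B a, ∃ y ∈ B b, G.Adj x y)

/-- The Hadwiger number: the largest `t` such that the complete graph on `t` vertices is a minor
of `G`. For a finite graph the set is bounded by the number of vertices and contains `0`. -/
noncomputable def hadwigerNumber {V : Type u} (G : SimpleGraph V) : ℕ :=
  sSup {t : ℕ | IsGraphMinor (completeGraph (Fin t)) G}

/-- `G` is a cycle (of length at least three). -/
def IsCycleGraph {V : Type u} (G : SimpleGraph V) : Prop :=
  ∃ n : ℕ, 3 ≤ n ∧ Nonempty (G ≃g cycleGraph n)

/-- A pyramid: a cycle together with one further vertex `w`, the apex, which has at least three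
neighbours on the cycle. -/
def IsPyramid {V : Type u} (G : SimpleGraph V) : Prop :=
  ∃ w : V, (G.induce {w}ᶜ).IsCycleGraph ∧ 3 ≤ (G.neighborSet w).ncard

/-- A trihedron: the union of three internally disjoint paths, each of length at least two,
between two distinct vertices. -/
def IsTrihedron {V : Type u} (G : SimpleGraph V) : Prop :=
  ∃ (x y : V) (p : Fin 3 → G.Walk x y),
    x ≠ y ∧
    (∀ i, (p i).IsPath ∧ 2 ≤ (p i).length) ∧
    (∀ i j, i ≠ j → ∀ z ∈ (p i).support, z ∈ (p j).support → z = x ∨ z = y) ∧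
    (⨆ i, (p i).toSubgraph) = ⊤

/-- A stamp: the union of a triangle with vertices `a 0, a 1, a 2` and three paths of length at
least one from these vertices to a common vertex `x`, which are disjoint apart from `x`. -/
def IsStamp {V : Type u} (G : SimpleGraph V) : Prop :=
  ∃ (a : Fin 3 → V) (x : V) (p : ∀ i, G.Walk (a i) x),
    (∀ i j, i ≠ j → G.Adj (a i) (a j)) ∧
    (∀ i, (p i).IsPath ∧ 1 ≤ (p i).length) ∧
    (∀ i j, i ≠ j → ∀ z ∈ (p i).support, z ∈ (p j).support → z = x) ∧
    (⊤ : G.Subgraph).induce (Set.range a) ⊔ (⨆ i, (p i).toSubgraph) = ⊤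

/-- A prism: the union of two disjoint triangles `a 0, a 1, a 2` and `b 0, b 1, b 2` and three
disjoint paths from `a i` to `b i`. -/
def IsPrism {V : Type u} (G : SimpleGraph V) : Prop :=
  ∃ (a b : Fin 3 → V) (p : ∀ i, G.Walk (a i) (b i)),
    (∀ i j, i ≠ j → G.Adj (a i) (a j)) ∧
    (∀ i j, i ≠ j → G.Adj (b i) (b j)) ∧
    (∀ i j, a i ≠ b j) ∧
    (∀ i, (p i).IsPath) ∧
    (∀ i j, i ≠ j → ∀ z ∈ (p i).support, z ∉ (p j).support) ∧
    (⊤ : G.Subgraph).induce (Set.range a) ⊔ (⊤ : G.Subgraph).induce (Set.range b) ⊔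
      (⨆ i, (p i).toSubgraph) = ⊤

/-- The solid graphs. -/
def IsSolidGraph {V : Type u} (G : SimpleGraph V) : Prop :=
  G.IsPyramid ∨ G.IsTrihedron ∨ G.IsStamp ∨ G.IsPrism

/-- The induced cycles of `G`, each given by its vertex set (an induced subgraph is determined by
its vertex set). -/
def inducedCycles {V : Type u} (G : SimpleGraph V) : Set (Set V) :=
  {s | (G.induce s).IsCycleGraph}

/-- The solids in `G`, i.e. the induced subgraphs of `G` that are solid graphs, each given by its
vertex set. -/
def solids {V : Type u} (G : SimpleGraph V) : Set (Set V) :=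
  {s | (G.induce s).IsSolidGraph}

/-- The first graph characteristic `|E| - |V|` of a finite graph. -/
noncomputable def beth1 {V : Type u} (G : SimpleGraph V) : ℤ :=
  (G.edgeSet.ncard : ℤ) - (Nat.card V : ℤ)

/-- The second graph characteristic `|C| - |E| + |V|` of a finite graph. -/
noncomputable def beth2 {V : Type u} (G : SimpleGraph V) : ℤ :=
  (G.inducedCycles.ncard : ℤ) - (G.edgeSet.ncard : ℤ) + (Nat.card V : ℤ)

/-- The third graph characteristic `|S| - |C| + |E| - |V|` of a finite graph. -/
noncomputable def beth3 {V : Type u} (G : SimpleGraph V) : ℤ :=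
  (G.solids.ncard : ℤ) - (G.inducedCycles.ncard : ℤ) + (G.edgeSet.ncard : ℤ) - (Nat.card V : ℤ)

end SimpleGraph

/-! Write `h` for the Hadwiger number. For `h ≤ 3` Hadwiger's conjecture is proved outright
(`colorableOn_of_hadwigerNumber_le_three`). For `h ≥ 4` minors play no role: a connected graph that
is not `h`-colourable has each characteristic strictly larger than that of the complete graph on `h`
vertices.

Normalise each characteristic by `±1` so that it vanishes on a single vertex. For `r = 1, 2, 3` the
normalised `r`-th characteristic of a complete graph on `h` vertices is at most `(h - 1).choose (r +
1)`, whereas a connected graph that is not `k`-colourable has at least `k.choose (r + 1)`. The lower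
bound is an induction that deletes one vertex `x` of degree `d` at a time and shows that the
deletion costs at least `(d - 1).choose r`. If `d < k`, the rest is still not `k`-colourable;
otherwise it is not `(k - 1)`-colourable and Pascal's rule closes the gap
(`choose_le_of_avoidable`).

The vertex `x` is chosen avoidable: any two neighbours are joined by a connected set that otherwise
misses the closed neighbourhood of `x`. Such a vertex always exists (`exists_avoidable`), and
deleting it keeps the graph connected. Every pair of neighbours of `x` then lies on an induced cycle
through `x` with no further neighbour of `x`, which gives the cost for `r = 2`. For `r = 3`, solids
and cycles through `x` are sorted by their trace on the neighbourhood of `x`. Each triple is the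
trace of some solid (`exists_solid_of_triple`). For each pair, the cycles with that trace outnumber
the solids by at most one (`ncard_pathSet_le`): the cycles are induced paths between the two
neighbours, elementary swaps make these paths the vertices of a connected graph, and different swaps
produce different solids.

Both facts on solids rest on `solid_of_minimal`: an induced cycle together with a minimal connected
set attached to two of its nonadjacent vertices is a solid. -/

namespace SimpleGraph

variable {V : Type*} {G : SimpleGraph V}

/-! ### Connected vertex sets. -/

/-- `s` induces a connected subgraph, phrased through cuts. -/
def ConnSet (G : SimpleGraph V) (s : Set V) : Prop :=
  s.Nonempty ∧ ∀ U ⊆ s, U.Nonempty → (∀ u ∈ U, ∀ v ∈ s, G.Adj u v → v ∈ U) → s ⊆ U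

theorem ConnSet.subset_of_closed {s : Set V} (hs : G.ConnSet s) (U : Set V) {u : V} (hus : u ∈ s)
    (hu : u ∈ U) (h : ∀ x ∈ U, x ∈ s → ∀ y ∈ s, G.Adj x y → y ∈ U) : s ⊆ U := by
  have := hs.2 (U ∩ s) Set.inter_subset_right ⟨u, hu, hus⟩
    (fun x hx y hy hxy => ⟨h x hx.1 hx.2 y hy hxy, hy⟩)
  exact fun v hv => (this hv).1

/-- Testing only closed sets through one base vertex suffices: adjacency is symmetric, so if a
closed `U` misses the base vertex, its complement is closed and contains it. -/
theorem connSet_of_base {s : Set V} {u : V} (hu : u ∈ s)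
    (h : ∀ U : Set V, u ∈ U → (∀ x ∈ U, x ∈ s → ∀ y ∈ s, G.Adj x y → y ∈ U) → s ⊆ U) :
    G.ConnSet s := by
  refine ⟨⟨u, hu⟩, fun U hU hne hcl => ?_⟩
  by_cases huU : u ∈ U
  · exact h U huU fun x hx _ y hy hxy => hcl x hx y hy hxy
  · obtain ⟨w, hw⟩ := hne
    have := h Uᶜ huU (fun x hx hxs y hy hxy hyU => hx (hcl y hyU x hxs hxy.symm))
    exact absurd hw (this (hU hw))

theorem connSet_iff_connected {s : Set V} : G.ConnSet s ↔ (G.induce s).Connected := by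
  constructor
  · rintro hs
    have : Nonempty s := hs.1.to_subtype
    refine ⟨fun u v => ?_⟩
    have := hs.subset_of_closed {w | ∃ hw : w ∈ s, (G.induce s).Reachable u ⟨w, hw⟩} u.2
      ⟨u.2, Reachable.refl _⟩ (by
        rintro x ⟨hx, hr⟩ _ y hy hxy
        refine ⟨hy, hr.trans (Adj.reachable ?_)⟩
        simpa using hxy)
    exact (this v.2).2
  · intro h
    obtain ⟨u⟩ := h.nonempty
    refine connSet_of_base u.2 fun U hu hcl v hv => ?_
    obtain ⟨w⟩ := h.preconnected u ⟨v, hv⟩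
    have key : ∀ (a b : s), (G.induce s).Walk a b → (a : V) ∈ U → (b : V) ∈ U := by
      intro a b w
      induction w with
      | nil => exact id
      | @cons a c b hac _ ih => exact fun ha => ih (hcl a ha a.2 c c.2 (by simpa using hac))
    exact key _ _ w hu

theorem connSet_singleton (u : V) : G.ConnSet {u} :=
  connSet_of_base rfl fun U hu _ v hv => by rw [Set.mem_singleton_iff.1 hv]; exact hu

theorem ConnSet.union_of_mem {s t : Set V} (hs : G.ConnSet s) (ht : G.ConnSet t) {u : V}
    (hus : u ∈ s) (hut : u ∈ t) : G.ConnSet (s ∪ t) := by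
  refine connSet_of_base (Or.inl hus) fun U hu hcl => Set.union_subset ?_ ?_
  · exact hs.subset_of_closed U hus hu fun x hx hxs y hy => hcl x hx (Or.inl hxs) y (Or.inl hy)
  · exact ht.subset_of_closed U hut hu fun x hx hxs y hy => hcl x hx (Or.inr hxs) y (Or.inr hy)

theorem ConnSet.insert_adj {s : Set V} (hs : G.ConnSet s) {u v : V} (hu : u ∈ s)
    (h : G.Adj u v) : G.ConnSet (insert v s) := by
  refine connSet_of_base (Or.inr hu) fun U hU hcl => Set.insert_subset ?_ ?_
  · exact hcl u hU (Or.inr hu) v (Or.inl rfl) h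
  · exact hs.subset_of_closed U hu hU fun x hx hxs y hy => hcl x hx (Or.inr hxs) y (Or.inr hy)

theorem ConnSet.union_of_adj {s t : Set V} (hs : G.ConnSet s) (ht : G.ConnSet t) {u v : V}
    (hu : u ∈ s) (hv : v ∈ t) (h : G.Adj u v) : G.ConnSet (s ∪ t) := by
  have := (hs.insert_adj hu h).union_of_mem ht (Or.inl rfl) hv
  rwa [Set.insert_union, Set.insert_eq_of_mem (Set.mem_union_right s hv)] at this

theorem connSet_image_Icc (p : ℕ → V) {l r : ℕ} (hlr : l ≤ r)
    (h : ∀ i, l ≤ i → i < r → G.Adj (p i) (p (i + 1))) : G.ConnSet (p '' Set.Icc l r) := by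
  induction r, hlr using Nat.le_induction with
  | base => simpa using connSet_singleton (p l)
  | succ r hr ih =>
    have h1 := ih fun i hi hir => h i hi (by omega)
    have h2 := h1.insert_adj ⟨r, ⟨hr, le_rfl⟩, rfl⟩ (h r hr (by omega))
    convert h2 using 1
    rw [← Set.image_insert_eq]
    congr 1
    ext i
    simp only [Set.mem_Icc, Set.mem_insert_iff]
    omega

theorem exists_component (G : SimpleGraph V) {s : Set V} {u : V} (hu : u ∈ s) :
    ∃ K ⊆ s, u ∈ K ∧ G.ConnSet K ∧ ∀ k ∈ K, ∀ v ∈ s, G.Adj k v → v ∈ K := by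
  refine ⟨{v | ∃ C ⊆ s, G.ConnSet C ∧ u ∈ C ∧ v ∈ C}, ?_, ?_, ?_, ?_⟩
  · rintro v ⟨C, hC, -, -, hv⟩
    exact hC hv
  · exact ⟨{u}, by simpa using hu, connSet_singleton u, rfl, rfl⟩
  · refine connSet_of_base ⟨{u}, by simpa using hu, connSet_singleton u, rfl, rfl⟩ ?_
    rintro U hU hcl v ⟨C, hCs, hC, huC, hvC⟩
    refine hC.subset_of_closed U huC hU (fun x hx hxC y hy hxy => ?_) hvC
    exact hcl x hx ⟨C, hCs, hC, huC, hxC⟩ y ⟨C, hCs, hC, huC, hy⟩ hxy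
  · rintro k ⟨C, hCs, hC, huC, hkC⟩ v hv hkv
    exact ⟨insert v C, Set.insert_subset hv hCs, hC.insert_adj hkC hkv, Or.inr huC, Or.inl rfl⟩

/-! ### Induced paths, as minimal connected sets and as sequences. -/

/-- A minimal connected set containing `a` and `b`: the vertex set of an induced path. -/
def PathSet (G : SimpleGraph V) (a b : V) (P : Set V) : Prop :=
  Minimal (fun P => a ∈ P ∧ b ∈ P ∧ G.ConnSet P) P

theorem PathSet.left_mem {a b : V} {P : Set V} (h : G.PathSet a b P) : a ∈ P := h.1.1
theorem PathSet.right_mem {a b : V} {P : Set V} (h : G.PathSet a b P) : b ∈ P := h.1.2.1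
theorem PathSet.connSet {a b : V} {P : Set V} (h : G.PathSet a b P) : G.ConnSet P := h.1.2.2

theorem PathSet.eq_of_subset {a b : V} {P Q : Set V} (h : G.PathSet a b P) (ha : a ∈ Q)
    (hb : b ∈ Q) (hQ : G.ConnSet Q) (hQP : Q ⊆ P) : Q = P :=
  hQP.antisymm (h.2 ⟨ha, hb, hQ⟩ hQP)

theorem PathSet.symm {a b : V} {P : Set V} (h : G.PathSet a b P) : G.PathSet b a P :=
  ⟨⟨h.right_mem, h.left_mem, h.connSet⟩, fun _ hQ hQP => h.2 ⟨hQ.2.1, hQ.1, hQ.2.2⟩ hQP⟩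

theorem ConnSet.exists_pathSet [Finite V] {C : Set V} (hC : G.ConnSet C) {a b : V} (ha : a ∈ C)
    (hb : b ∈ C) : ∃ P ⊆ C, G.PathSet a b P :=
  Finite.exists_le_minimal (p := fun P => a ∈ P ∧ b ∈ P ∧ G.ConnSet P) ⟨ha, hb, hC⟩

/-- `p 0, …, p n` are distinct and are adjacent exactly if they are consecutive. -/
structure IsIndPath (G : SimpleGraph V) (n : ℕ) (p : ℕ → V) : Prop where
  inj : ∀ i ≤ n, ∀ j ≤ n, p i = p j → i = j
  adj : ∀ i ≤ n, ∀ j ≤ n, (G.Adj (p i) (p j) ↔ j = i + 1 ∨ i = j + 1)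

theorem IsIndPath.reverse {n : ℕ} {p : ℕ → V} (h : G.IsIndPath n p) :
    G.IsIndPath n (fun i => p (n - i)) where
  inj i hi j hj hij := by
    have := h.inj _ (Nat.sub_le n i) _ (Nat.sub_le n j) hij
    omega
  adj i hi j hj := by
    rw [h.adj _ (Nat.sub_le n i) _ (Nat.sub_le n j)]
    omega

theorem image_Iic_reverse (n : ℕ) (p : ℕ → V) :
    (fun i => p (n - i)) '' Set.Iic n = p '' Set.Iic n := by
  ext v
  constructor
  · rintro ⟨i, hi, rfl⟩
    exact ⟨n - i, Nat.sub_le n i, rfl⟩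
  · rintro ⟨i, hi, rfl⟩
    refine ⟨n - i, Nat.sub_le n i, ?_⟩
    simp only [Set.mem_Iic] at hi
    simp only
    congr 1
    omega

theorem IsIndPath.connSet_Icc {n : ℕ} {p : ℕ → V} (h : G.IsIndPath n p) {l r : ℕ} (hlr : l ≤ r)
    (hr : r ≤ n) : G.ConnSet (p '' Set.Icc l r) :=
  connSet_image_Icc p hlr fun i _ hir => (h.adj i (by omega) (i + 1) (by omega)).2 (Or.inl rfl)

theorem ConnSet.exists_seq {C : Set V} (hC : G.ConnSet C) {a b : V} (ha : a ∈ C) (hb : b ∈ C) :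
    ∃ (n : ℕ) (p : ℕ → V), p 0 = a ∧ p n = b ∧ (∀ i ≤ n, p i ∈ C) ∧
      ∀ i < n, G.Adj (p i) (p (i + 1)) := by
  refine hC.subset_of_closed {b | ∃ (n : ℕ) (p : ℕ → V), p 0 = a ∧ p n = b ∧ (∀ i ≤ n, p i ∈ C) ∧
      ∀ i < n, G.Adj (p i) (p (i + 1))} ha ⟨0, fun _ => a, rfl, rfl, by simpa using ha, by simp⟩
      ?_ hb
  rintro x ⟨n, p, h0, hn, hmem, hadj⟩ - y hy hxy
  refine ⟨n + 1, fun i => if i ≤ n then p i else y, by simp [h0], by simp, ?_, ?_⟩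
  · intro i hi
    by_cases h : i ≤ n <;> simp [h, hmem, hy]
  · intro i hi
    by_cases h : i < n
    · simp [h.le, Nat.succ_le_of_lt h, hadj i h]
    · obtain rfl : i = n := by omega
      simpa [hn] using hxy

/-- A shortest sequence works: a repeated vertex or a chord would allow a part of it to be cut out.
-/
theorem ConnSet.exists_isIndPath {C : Set V} (hC : G.ConnSet C) {a b : V} (ha : a ∈ C)
    (hb : b ∈ C) : ∃ (n : ℕ) (p : ℕ → V), p 0 = a ∧ p n = b ∧ (∀ i ≤ n, p i ∈ C) ∧
      G.IsIndPath n p := by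
  classical
  have hex := hC.exists_seq ha hb
  obtain ⟨p, h0, hn, hmem, hadj⟩ := Nat.find_spec hex
  have hmin : ∀ m < Nat.find hex, _ := fun m hm => Nat.find_min hex hm
  set n := Nat.find hex
  have hinj : ∀ i j, i < j → j ≤ n → p i ≠ p j := by
    intro i j hij hj heq
    -- Since `p i = p j`, the positions `i + 1, …, j` can be skipped. For a chord below, only `i +
    -- 1, …, j - 1` are skipped.
    refine hmin (n - (j - i)) (by omega) ⟨fun k => if k ≤ i then p k else p (k + (j - i)),
      by simp [h0], ?_, ?_, ?_⟩
    · dsimp only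
      split_ifs with h
      · obtain rfl : j = n := by omega
        rw [← hn, ← heq]; congr 1; omega
      · rw [← hn]; congr 1; omega
    · intro k hk
      dsimp only
      split_ifs with h
      · exact hmem _ (by omega)
      · exact hmem _ (by omega)
    · intro k hk
      dsimp only
      split_ifs with h1 h2 h2
      · exact hadj _ (by omega)
      · obtain rfl : k = i := by omega
        rw [heq, show k + 1 + (j - k) = j + 1 by omega]
        exact hadj _ (by omega)
      · omega
      · rw [show k + 1 + (j - i) = k + (j - i) + 1 by omega]
        exact hadj _ (by omega)
  have hchord : ∀ i j, i + 1 < j → j ≤ n → ¬ G.Adj (p i) (p j) := by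
    intro i j hij hj heq
    refine hmin (n - (j - i - 1)) (by omega) ⟨fun k => if k ≤ i then p k else p (k + (j - i - 1)),
      by simp [h0], ?_, ?_, ?_⟩
    · dsimp only
      split_ifs with h
      · omega
      · rw [← hn]; congr 1; omega
    · intro k hk
      dsimp only
      split_ifs with h
      · exact hmem _ (by omega)
      · exact hmem _ (by omega)
    · intro k hk
      dsimp only
      split_ifs with h1 h2 h2
      · exact hadj _ (by omega)
      · obtain rfl : k = i := by omega
        rwa [show k + 1 + (j - k - 1) = j by omega]
      · omega
      · rw [show k + 1 + (j - i - 1) = k + (j - i - 1) + 1 by omega]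
        exact hadj _ (by omega)
  refine ⟨n, p, h0, hn, hmem, ⟨fun i hi j hj hij => ?_, fun i hi j hj => ⟨fun h => ?_, ?_⟩⟩⟩
  · rcases lt_trichotomy i j with h | h | h
    · exact absurd hij (hinj i j h hj)
    · exact h
    · exact absurd hij.symm (hinj j i h hi)
  · rcases lt_trichotomy i j with h' | h' | h'
    · by_contra hc
      exact hchord i j (by omega) hj h
    · subst h'
      exact absurd h (G.loopless.irrefl _)
    · by_contra hc
      exact hchord j i (by omega) hi h.symm
  · rintro (rfl | rfl)
    · exact hadj _ (by omega)
    · exact (hadj _ (by omega)).symm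

/-- A connected subset that misses `p l` cannot pass from the vertices before `l` to those after it.
-/
theorem IsIndPath.pathSet {n : ℕ} {p : ℕ → V} (h : G.IsIndPath n p) :
    G.PathSet (p 0) (p n) (p '' Set.Iic n) := by
  refine ⟨⟨⟨0, Nat.zero_le n, rfl⟩, ⟨n, Set.mem_Iic.2 le_rfl, rfl⟩, ?_⟩, ?_⟩
  · have := h.connSet_Icc (Nat.zero_le n) le_rfl
    rwa [show Set.Icc 0 n = Set.Iic n from Set.Icc_bot] at this
  · rintro Q ⟨h0, hn, hQ⟩ hQP
    rintro _ ⟨l, hl, rfl⟩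
    by_contra hlQ
    have := hQ.subset_of_closed (p '' Set.Iio l) h0
      ⟨0, Nat.pos_of_ne_zero fun h => hlQ (h ▸ h0), rfl⟩ (by
        rintro _ ⟨i, hi, rfl⟩ - y hy hiy
        obtain ⟨j, hj, rfl⟩ := hQP hy
        simp only [Set.mem_Iio, Set.mem_Iic] at hi hj hl
        have := (h.adj i (by omega) j hj).1 hiy
        refine ⟨j, ?_, rfl⟩
        have : j ≠ l := fun h => hlQ (h ▸ hy)
        simp only [Set.mem_Iio]
        omega) hn
    obtain ⟨i, hi, hin⟩ := this
    simp only [Set.mem_Iio, Set.mem_Iic] at hi hl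
    have := h.inj i (by omega) n le_rfl hin
    omega

theorem PathSet.exists_isIndPath {a b : V} {P : Set V} (h : G.PathSet a b P) :
    ∃ (n : ℕ) (p : ℕ → V), p 0 = a ∧ p n = b ∧ P = p '' Set.Iic n ∧ G.IsIndPath n p := by
  obtain ⟨n, p, h0, hn, hmem, hp⟩ := h.connSet.exists_isIndPath h.left_mem h.right_mem
  refine ⟨n, p, h0, hn, ?_, hp⟩
  have := hp.pathSet
  refine (h.eq_of_subset (h0 ▸ this.left_mem) (hn ▸ this.right_mem) this.connSet ?_).symm
  rintro _ ⟨i, hi, rfl⟩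
  exact hmem i hi

/-! ### Induced cycles as cyclic sequences. -/

/-- `f 0, …, f (n - 1)` is an induced cycle in this cyclic order. -/
structure IsIndCycle (G : SimpleGraph V) (n : ℕ) (f : ℕ → V) : Prop where
  three_le : 3 ≤ n
  inj : ∀ i < n, ∀ j < n, f i = f j → i = j
  adj : ∀ i < n, ∀ j < n, (G.Adj (f i) (f j) ↔
    j = i + 1 ∨ i = j + 1 ∨ (i = 0 ∧ j + 1 = n) ∨ (j = 0 ∧ i + 1 = n))

/-- Unrolls the arithmetic modulo `n` into linear conditions on natural numbers, so that all later
adjacency questions on cycles fall to `omega`. -/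
theorem cycleGraph_adj_iff_val {n : ℕ} (hn : 3 ≤ n) (i j : Fin n) : (cycleGraph n).Adj i j ↔
    (j : ℕ) = i + 1 ∨ (i : ℕ) = j + 1 ∨ ((i : ℕ) = 0 ∧ j + 1 = n) ∨ ((j : ℕ) = 0 ∧ i + 1 = n) := by
  have key : ∀ a b : Fin n, ((a - b : Fin n) : ℕ) = 1 ↔
      (a : ℕ) = b + 1 ∨ ((a : ℕ) = 0 ∧ b + 1 = n) := by
    intro a b
    have ha := a.2
    have hb := b.2
    rw [Fin.sub_def]
    simp only
    by_cases h : (b : ℕ) ≤ a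
    · rw [show n - (b : ℕ) + a = (a - b) + n by omega, Nat.add_mod_right,
        Nat.mod_eq_of_lt (by omega)]
      omega
    · rw [Nat.mod_eq_of_lt (by omega)]
      omega
  rw [cycleGraph_adj', key, key]
  tauto

theorem mem_inducedCycles_iff {s : Set V} :
    s ∈ G.inducedCycles ↔ ∃ (n : ℕ) (f : ℕ → V), G.IsIndCycle n f ∧ s = f '' Set.Iio n := by
  constructor
  · rintro ⟨n, hn, ⟨e⟩⟩
    refine ⟨n, fun i => if h : i < n then (e.symm ⟨i, h⟩ : V) else (e.symm ⟨0, by omega⟩ : V),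
      ⟨hn, ?_, ?_⟩, ?_⟩
    · intro i hi j hj hij
      simp only [hi, hj, dif_pos] at hij
      have := e.symm.injective (Subtype.ext hij)
      simpa using this
    · intro i hi j hj
      simp only [hi, hj, dif_pos]
      have h1 : G.Adj (e.symm ⟨i, hi⟩ : V) (e.symm ⟨j, hj⟩ : V) ↔
        (G.induce s).Adj (e.symm ⟨i, hi⟩) (e.symm ⟨j, hj⟩) := by simp
      rw [h1, e.symm.map_adj_iff, cycleGraph_adj_iff_val hn]
    · ext v
      constructor
      · intro hv
        refine ⟨e ⟨v, hv⟩, (e ⟨v, hv⟩).2, ?_⟩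
        simp
      · rintro ⟨i, hi, rfl⟩
        simp only [Set.mem_Iio] at hi
        simp [hi]
  · rintro ⟨n, f, hf, rfl⟩
    refine ⟨n, hf.three_le, ⟨(RelIso.symm ⟨Equiv.ofBijective
      (fun i : Fin n => (⟨f i, i, i.2, rfl⟩ : f '' Set.Iio n)) ⟨?_, ?_⟩, ?_⟩)⟩⟩
    · intro i j hij
      exact Fin.ext (hf.inj i i.2 j j.2 (congrArg Subtype.val hij))
    · rintro ⟨_, i, hi, rfl⟩
      exact ⟨⟨i, hi⟩, rfl⟩
    · intro i j
      rw [cycleGraph_adj_iff_val hf.three_le, ← hf.adj i i.2 j j.2]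
      rfl

theorem IsIndCycle.mem_inducedCycles {n : ℕ} {f : ℕ → V} (h : G.IsIndCycle n f) :
    f '' Set.Iio n ∈ G.inducedCycles :=
  mem_inducedCycles_iff.2 ⟨n, f, h, rfl⟩

theorem IsIndCycle.rotate {n : ℕ} {f : ℕ → V} (h : G.IsIndCycle n f) {k : ℕ} (hk : k < n) :
    G.IsIndCycle n (fun i => if i + k < n then f (i + k) else f (i + k - n)) where
  three_le := h.three_le
  inj i hi j hj hij := by
    split_ifs at hij <;> have := h.inj _ (by omega) _ (by omega) hij <;> omega
  adj i hi j hj := by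
    have := h.three_le
    split_ifs <;> rw [h.adj _ (by omega) _ (by omega)] <;> omega

theorem IsIndCycle.reflect {n : ℕ} {f : ℕ → V} (h : G.IsIndCycle n f) :
    G.IsIndCycle n (fun i => if i = 0 then f 0 else f (n - i)) where
  three_le := h.three_le
  inj i hi j hj hij := by
    have := h.three_le
    split_ifs at hij <;> have := h.inj _ (by omega) _ (by omega) hij <;> omega
  adj i hi j hj := by
    have := h.three_le
    split_ifs <;> rw [h.adj _ (by omega) _ (by omega)] <;> omega

theorem image_rotate {n k : ℕ} (f : ℕ → V) (hk : k < n) :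
    (fun i => if i + k < n then f (i + k) else f (i + k - n)) '' Set.Iio n = f '' Set.Iio n := by
  ext v
  constructor
  · rintro ⟨i, hi, rfl⟩
    simp only [Set.mem_Iio] at hi
    dsimp only
    split_ifs with h
    · exact ⟨_, h, rfl⟩
    · exact ⟨_, Set.mem_Iio.2 (by omega), rfl⟩
  · rintro ⟨i, hi, rfl⟩
    simp only [Set.mem_Iio] at hi
    by_cases h : k ≤ i
    · refine ⟨i - k, Set.mem_Iio.2 (by omega), ?_⟩
      have h' : i - k + k = i := by omega
      simp [h', hi]
    · refine ⟨i + n - k, Set.mem_Iio.2 (by omega), ?_⟩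
      have h' : i + n - k + k = i + n := by omega
      simp [h']

theorem image_reflect {n : ℕ} (f : ℕ → V) :
    (fun i => if i = 0 then f 0 else f (n - i)) '' Set.Iio n = f '' Set.Iio n := by
  ext v
  constructor
  · rintro ⟨i, hi, rfl⟩
    simp only [Set.mem_Iio] at hi
    dsimp only
    split_ifs with h
    · exact ⟨_, Set.mem_Iio.2 (by omega), rfl⟩
    · exact ⟨_, Set.mem_Iio.2 (by omega), rfl⟩
  · rintro ⟨i, hi, rfl⟩
    simp only [Set.mem_Iio] at hi
    by_cases h : i = 0
    · exact ⟨0, Set.mem_Iio.2 (by omega), by simp [h]⟩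
    · refine ⟨n - i, Set.mem_Iio.2 (by omega), ?_⟩
      have h' : n - (n - i) = i := by omega
      have h2 : n - i ≠ 0 := by omega
      simp [h', h2]

/-- An induced cycle can be traversed starting at a given vertex. -/
theorem exists_isIndCycle_start {s : Set V} (hs : s ∈ G.inducedCycles) {x : V} (hx : x ∈ s) :
    ∃ (n : ℕ) (f : ℕ → V), G.IsIndCycle n f ∧ s = f '' Set.Iio n ∧ f 0 = x := by
  obtain ⟨n, f, hf, rfl⟩ := mem_inducedCycles_iff.1 hs
  obtain ⟨k, hk, rfl⟩ := hx
  exact ⟨n, _, hf.rotate hk, (image_rotate f hk).symm, by simp [Set.mem_Iio.1 hk]⟩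

/-! ### Recognising solids from sequences of vertices. -/

/-- `g 0, …, g L` are distinct, consecutively adjacent vertices of `s`. -/
structure IsSeqPath (G : SimpleGraph V) (s : Set V) (L : ℕ) (g : ℕ → V) : Prop where
  mem : ∀ i ≤ L, g i ∈ s
  adj : ∀ i < L, G.Adj (g i) (g (i + 1))
  inj : ∀ i ≤ L, ∀ j ≤ L, g i = g j → i = j

/-- `u` and `v` are consecutive in the sequence `g 0, …, g L`. -/
def SeqEdge (L : ℕ) (g : ℕ → V) (u v : V) : Prop :=
  ∃ k < L, (u = g k ∧ v = g (k + 1)) ∨ (v = g k ∧ u = g (k + 1))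

/-- The bridge from index sequences to the walks in the definitions of solids; everything needed
about the walk is recorded in terms of indices. -/
theorem IsSeqPath.exists_walk {s : Set V} {L : ℕ} {g : ℕ → V} (h : G.IsSeqPath s L g)
    (a b : s) (ha : a = g 0) (hb : b = g L) :
    ∃ w : (G.induce s).Walk a b,
      w.IsPath ∧ w.length = L ∧ (∀ z : s, z ∈ w.support ↔ ∃ i ≤ L, g i = z) ∧
      ∀ u v : s, SeqEdge L g u v → w.toSubgraph.Adj u v := by
  induction L generalizing g a with
  | zero =>
    obtain rfl : a = b := Subtype.ext (ha.trans hb.symm)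
    refine ⟨Walk.nil, by simp, rfl, fun z => ?_, fun u v ⟨k, hk, _⟩ => absurd hk (by omega)⟩
    simp [Subtype.ext_iff, eq_comm, ha]
  | succ L ih =>
    obtain ⟨w, hw, hl, hsup, hsub⟩ := ih (g := fun i => g (i + 1))
      ⟨fun i hi => h.mem (i + 1) (by omega), fun i hi => h.adj (i + 1) (by omega),
        fun i hi j hj hij => by
          have := h.inj (i + 1) (by omega) (j + 1) (by omega) hij; omega⟩
      ⟨g 1, h.mem 1 (by omega)⟩ rfl hb
    have h01 : (G.induce s).Adj a ⟨g 1, h.mem 1 (by omega)⟩ := by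
      simpa [ha] using h.adj 0 (by omega)
    refine ⟨Walk.cons h01 w, ?_, by simp [hl], fun z => ?_, ?_⟩
    · rw [Walk.cons_isPath_iff]
      refine ⟨hw, fun hmem => ?_⟩
      obtain ⟨i, hi, hgi⟩ := (hsup _).1 hmem
      have := h.inj (i + 1) (by omega) 0 (by omega) (hgi.trans ha)
      omega
    · rw [Walk.support_cons, List.mem_cons, hsup]
      constructor
      · rintro (rfl | ⟨i, hi, h⟩)
        · exact ⟨0, by omega, ha.symm⟩
        · exact ⟨i + 1, by omega, h⟩
      · rintro ⟨i, hi, h⟩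
        rcases i with _ | i
        · exact Or.inl (Subtype.ext (h.symm.trans ha.symm))
        · exact Or.inr ⟨i, by omega, h⟩
    · rintro u v ⟨k, hk, huv⟩
      simp only [Walk.toSubgraph, Subgraph.sup_adj]
      rcases k with _ | k
      · left
        rcases huv with ⟨hu, hv⟩ | ⟨hv, hu⟩
        · obtain rfl : u = a := Subtype.ext (hu.trans ha.symm)
          obtain rfl : v = ⟨g 1, h.mem 1 (by omega)⟩ := Subtype.ext hv
          simp
        · obtain rfl : v = a := Subtype.ext (hv.trans ha.symm)
          obtain rfl : u = ⟨g 1, h.mem 1 (by omega)⟩ := Subtype.ext hu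
          simp
      · right
        exact hsub u v ⟨k, by omega, huv⟩

/-- Here and for stamps and prisms below, `hcov` and `hedge` say that the pieces exhaust the
vertices and edges of `s`, which is the condition that their union is the top subgraph. -/
theorem mem_solids_of_trihedron {s : Set V} {x y : V} (hxy : x ≠ y) {L₀ L₁ L₂ : ℕ}
    {g₀ g₁ g₂ : ℕ → V} (h₀ : G.IsSeqPath s L₀ g₀) (h₁ : G.IsSeqPath s L₁ g₁)
    (h₂ : G.IsSeqPath s L₂ g₂) (hx₀ : x = g₀ 0) (hx₁ : x = g₁ 0) (hx₂ : x = g₂ 0)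
    (hy₀ : y = g₀ L₀) (hy₁ : y = g₁ L₁) (hy₂ : y = g₂ L₂)
    (hL₀ : 2 ≤ L₀) (hL₁ : 2 ≤ L₁) (hL₂ : 2 ≤ L₂)
    (d₀₁ : ∀ i ≤ L₀, ∀ j ≤ L₁, g₀ i = g₁ j → g₀ i = x ∨ g₀ i = y)
    (d₀₂ : ∀ i ≤ L₀, ∀ j ≤ L₂, g₀ i = g₂ j → g₀ i = x ∨ g₀ i = y)
    (d₁₂ : ∀ i ≤ L₁, ∀ j ≤ L₂, g₁ i = g₂ j → g₁ i = x ∨ g₁ i = y)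
    (hcov : ∀ v ∈ s, (∃ i ≤ L₀, g₀ i = v) ∨ (∃ i ≤ L₁, g₁ i = v) ∨ (∃ i ≤ L₂, g₂ i = v))
    (hedge : ∀ u ∈ s, ∀ v ∈ s, G.Adj u v →
      SeqEdge L₀ g₀ u v ∨ SeqEdge L₁ g₁ u v ∨ SeqEdge L₂ g₂ u v) : s ∈ G.solids := by
  have hxs : x ∈ s := hx₀ ▸ h₀.mem 0 (by omega)
  have hys : y ∈ s := hy₀ ▸ h₀.mem L₀ le_rfl
  obtain ⟨w₀, p₀, l₀, s₀, e₀⟩ := h₀.exists_walk ⟨x, hxs⟩ ⟨y, hys⟩ hx₀ hy₀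
  obtain ⟨w₁, p₁, l₁, s₁, e₁⟩ := h₁.exists_walk ⟨x, hxs⟩ ⟨y, hys⟩ hx₁ hy₁
  obtain ⟨w₂, p₂, l₂, s₂, e₂⟩ := h₂.exists_walk ⟨x, hxs⟩ ⟨y, hys⟩ hx₂ hy₂
  have D : ∀ {L L' : ℕ} {g g' : ℕ → V}
      (w w' : (G.induce s).Walk ⟨x, hxs⟩ ⟨y, hys⟩) (_ : ∀ z : s, z ∈ w.support ↔ ∃ i ≤ L, g i = z)
      (_ : ∀ z : s, z ∈ w'.support ↔ ∃ i ≤ L', g' i = z)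
      (_ : ∀ i ≤ L, ∀ j ≤ L', g i = g' j → g i = x ∨ g i = y),
      ∀ z, z ∈ w.support → z ∈ w'.support → z = ⟨x, hxs⟩ ∨ z = ⟨y, hys⟩ := by
    intro L L' g g' w w' hs hs' hd z hz hz'
    obtain ⟨i, hi, hiz⟩ := (hs z).1 hz
    obtain ⟨j, hj, hjz⟩ := (hs' z).1 hz'
    simpa [Subtype.ext_iff, hiz] using hd i hi j hj (hiz.trans hjz.symm)
  refine Or.inr (Or.inl ⟨⟨x, hxs⟩, ⟨y, hys⟩, ![w₀, w₁, w₂], by simpa using hxy, ?_, ?_, ?_⟩)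
  · intro i
    fin_cases i
    exacts [⟨p₀, l₀ ▸ hL₀⟩, ⟨p₁, l₁ ▸ hL₁⟩, ⟨p₂, l₂ ▸ hL₂⟩]
  · intro i j hij z hi hj
    fin_cases i <;> fin_cases j
    · exact absurd rfl hij
    · exact D w₀ w₁ s₀ s₁ d₀₁ z hi hj
    · exact D w₀ w₂ s₀ s₂ d₀₂ z hi hj
    · exact D w₀ w₁ s₀ s₁ d₀₁ z hj hi
    · exact absurd rfl hij
    · exact D w₁ w₂ s₁ s₂ d₁₂ z hi hj
    · exact D w₀ w₂ s₀ s₂ d₀₂ z hj hi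
    · exact D w₁ w₂ s₁ s₂ d₁₂ z hj hi
    · exact absurd rfl hij
  · rw [eq_top_iff]
    constructor
    · rintro z -
      rw [Subgraph.verts_iSup, Set.mem_iUnion]
      rcases hcov z z.2 with h | h | h
      · exact ⟨0, (w₀.mem_verts_toSubgraph).2 ((s₀ z).2 h)⟩
      · exact ⟨1, (w₁.mem_verts_toSubgraph).2 ((s₁ z).2 h)⟩
      · exact ⟨2, (w₂.mem_verts_toSubgraph).2 ((s₂ z).2 h)⟩
    · intro u v huv
      rw [Subgraph.iSup_adj]
      rcases hedge u u.2 v v.2 huv with h | h | h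
      · exact ⟨0, e₀ u v h⟩
      · exact ⟨1, e₁ u v h⟩
      · exact ⟨2, e₂ u v h⟩

theorem mem_solids_of_stamp {s : Set V} {a₀ a₁ a₂ x : V} {L₀ L₁ L₂ : ℕ}
    {g₀ g₁ g₂ : ℕ → V} (h₀ : G.IsSeqPath s L₀ g₀) (h₁ : G.IsSeqPath s L₁ g₁)
    (h₂ : G.IsSeqPath s L₂ g₂) (ha₀ : a₀ = g₀ 0) (ha₁ : a₁ = g₁ 0) (ha₂ : a₂ = g₂ 0)
    (hx₀ : x = g₀ L₀) (hx₁ : x = g₁ L₁) (hx₂ : x = g₂ L₂)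
    (hL₀ : 1 ≤ L₀) (hL₁ : 1 ≤ L₁) (hL₂ : 1 ≤ L₂)
    (t₀₁ : G.Adj a₀ a₁) (t₀₂ : G.Adj a₀ a₂) (t₁₂ : G.Adj a₁ a₂)
    (d₀₁ : ∀ i ≤ L₀, ∀ j ≤ L₁, g₀ i = g₁ j → g₀ i = x)
    (d₀₂ : ∀ i ≤ L₀, ∀ j ≤ L₂, g₀ i = g₂ j → g₀ i = x)
    (d₁₂ : ∀ i ≤ L₁, ∀ j ≤ L₂, g₁ i = g₂ j → g₁ i = x)
    (hcov : ∀ v ∈ s, (∃ i ≤ L₀, g₀ i = v) ∨ (∃ i ≤ L₁, g₁ i = v) ∨ (∃ i ≤ L₂, g₂ i = v))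
    (hedge : ∀ u ∈ s, ∀ v ∈ s, G.Adj u v →
      SeqEdge L₀ g₀ u v ∨ SeqEdge L₁ g₁ u v ∨ SeqEdge L₂ g₂ u v ∨
        ((u = a₀ ∨ u = a₁ ∨ u = a₂) ∧ (v = a₀ ∨ v = a₁ ∨ v = a₂))) : s ∈ G.solids := by
  have hxs : x ∈ s := hx₀ ▸ h₀.mem L₀ le_rfl
  have m₀ : a₀ ∈ s := ha₀ ▸ h₀.mem 0 (by omega)
  have m₁ : a₁ ∈ s := ha₁ ▸ h₁.mem 0 (by omega)
  have m₂ : a₂ ∈ s := ha₂ ▸ h₂.mem 0 (by omega)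
  obtain ⟨w₀, p₀, l₀, s₀, e₀⟩ := h₀.exists_walk ⟨a₀, m₀⟩ ⟨x, hxs⟩ ha₀ hx₀
  obtain ⟨w₁, p₁, l₁, s₁, e₁⟩ := h₁.exists_walk ⟨a₁, m₁⟩ ⟨x, hxs⟩ ha₁ hx₁
  obtain ⟨w₂, p₂, l₂, s₂, e₂⟩ := h₂.exists_walk ⟨a₂, m₂⟩ ⟨x, hxs⟩ ha₂ hx₂
  have D : ∀ {L L' : ℕ} {g g' : ℕ → V} {a a' : s}
      (w : (G.induce s).Walk a ⟨x, hxs⟩) (w' : (G.induce s).Walk a' ⟨x, hxs⟩)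
      (_ : ∀ z : s, z ∈ w.support ↔ ∃ i ≤ L, g i = z)
      (_ : ∀ z : s, z ∈ w'.support ↔ ∃ i ≤ L', g' i = z)
      (_ : ∀ i ≤ L, ∀ j ≤ L', g i = g' j → g i = x),
      ∀ z, z ∈ w.support → z ∈ w'.support → z = ⟨x, hxs⟩ := by
    intro L L' g g' a a' w w' hs hs' hd z hz hz'
    obtain ⟨i, hi, hiz⟩ := (hs z).1 hz
    obtain ⟨j, hj, hjz⟩ := (hs' z).1 hz'
    simpa [Subtype.ext_iff, hiz] using hd i hi j hj (hiz.trans hjz.symm)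
  refine Or.inr (Or.inr (Or.inl ⟨![⟨a₀, m₀⟩, ⟨a₁, m₁⟩, ⟨a₂, m₂⟩], ⟨x, hxs⟩, fun i =>
    match i with
    | 0 => w₀
    | 1 => w₁
    | 2 => w₂, ?_, ?_, ?_, ?_⟩))
  · intro i j hij
    fin_cases i <;> fin_cases j
    exacts [absurd rfl hij, t₀₁, t₀₂, t₀₁.symm, absurd rfl hij, t₁₂, t₀₂.symm, t₁₂.symm,
      absurd rfl hij]
  · intro i
    fin_cases i
    exacts [⟨p₀, l₀ ▸ hL₀⟩, ⟨p₁, l₁ ▸ hL₁⟩, ⟨p₂, l₂ ▸ hL₂⟩]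
  · intro i j hij z hi hj
    fin_cases i <;> fin_cases j
    · exact absurd rfl hij
    · exact D w₀ w₁ s₀ s₁ d₀₁ z hi hj
    · exact D w₀ w₂ s₀ s₂ d₀₂ z hi hj
    · exact D w₀ w₁ s₀ s₁ d₀₁ z hj hi
    · exact absurd rfl hij
    · exact D w₁ w₂ s₁ s₂ d₁₂ z hi hj
    · exact D w₀ w₂ s₀ s₂ d₀₂ z hj hi
    · exact D w₁ w₂ s₁ s₂ d₁₂ z hj hi
    · exact absurd rfl hij
  · rw [eq_top_iff]
    constructor
    · rintro z -
      rw [Subgraph.verts_sup, Subgraph.verts_iSup]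
      right
      rw [Set.mem_iUnion]
      rcases hcov z z.2 with h | h | h
      · exact ⟨0, (w₀.mem_verts_toSubgraph).2 ((s₀ z).2 h)⟩
      · exact ⟨1, (w₁.mem_verts_toSubgraph).2 ((s₁ z).2 h)⟩
      · exact ⟨2, (w₂.mem_verts_toSubgraph).2 ((s₂ z).2 h)⟩
    · intro u v huv
      rw [Subgraph.sup_adj, Subgraph.iSup_adj]
      rcases hedge u u.2 v v.2 huv with h | h | h | ⟨hu, hv⟩
      · exact Or.inr ⟨0, e₀ u v h⟩
      · exact Or.inr ⟨1, e₁ u v h⟩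
      · exact Or.inr ⟨2, e₂ u v h⟩
      · left
        refine ⟨?_, ?_, huv⟩
        · rcases hu with hu | hu | hu
          exacts [⟨0, Subtype.ext hu.symm⟩, ⟨1, Subtype.ext hu.symm⟩, ⟨2, Subtype.ext hu.symm⟩]
        · rcases hv with hv | hv | hv
          exacts [⟨0, Subtype.ext hv.symm⟩, ⟨1, Subtype.ext hv.symm⟩, ⟨2, Subtype.ext hv.symm⟩]

theorem mem_solids_of_prism {s : Set V} {a₀ a₁ a₂ b₀ b₁ b₂ : V} {L₀ L₁ L₂ : ℕ}
    {g₀ g₁ g₂ : ℕ → V} (h₀ : G.IsSeqPath s L₀ g₀) (h₁ : G.IsSeqPath s L₁ g₁)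
    (h₂ : G.IsSeqPath s L₂ g₂) (ha₀ : a₀ = g₀ 0) (ha₁ : a₁ = g₁ 0) (ha₂ : a₂ = g₂ 0)
    (hb₀ : b₀ = g₀ L₀) (hb₁ : b₁ = g₁ L₁) (hb₂ : b₂ = g₂ L₂)
    (hL₀ : 1 ≤ L₀) (hL₁ : 1 ≤ L₁) (hL₂ : 1 ≤ L₂)
    (t₀₁ : G.Adj a₀ a₁) (t₀₂ : G.Adj a₀ a₂) (t₁₂ : G.Adj a₁ a₂)
    (r₀₁ : G.Adj b₀ b₁) (r₀₂ : G.Adj b₀ b₂) (r₁₂ : G.Adj b₁ b₂)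
    (d₀₁ : ∀ i ≤ L₀, ∀ j ≤ L₁, g₀ i ≠ g₁ j)
    (d₀₂ : ∀ i ≤ L₀, ∀ j ≤ L₂, g₀ i ≠ g₂ j)
    (d₁₂ : ∀ i ≤ L₁, ∀ j ≤ L₂, g₁ i ≠ g₂ j)
    (hcov : ∀ v ∈ s, (∃ i ≤ L₀, g₀ i = v) ∨ (∃ i ≤ L₁, g₁ i = v) ∨ (∃ i ≤ L₂, g₂ i = v))
    (hedge : ∀ u ∈ s, ∀ v ∈ s, G.Adj u v →
      SeqEdge L₀ g₀ u v ∨ SeqEdge L₁ g₁ u v ∨ SeqEdge L₂ g₂ u v ∨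
        ((u = a₀ ∨ u = a₁ ∨ u = a₂) ∧ (v = a₀ ∨ v = a₁ ∨ v = a₂)) ∨
        ((u = b₀ ∨ u = b₁ ∨ u = b₂) ∧ (v = b₀ ∨ v = b₁ ∨ v = b₂))) : s ∈ G.solids := by
  have n₀ : b₀ ∈ s := hb₀ ▸ h₀.mem L₀ le_rfl
  have n₁ : b₁ ∈ s := hb₁ ▸ h₁.mem L₁ le_rfl
  have n₂ : b₂ ∈ s := hb₂ ▸ h₂.mem L₂ le_rfl
  have m₀ : a₀ ∈ s := ha₀ ▸ h₀.mem 0 (by omega)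
  have m₁ : a₁ ∈ s := ha₁ ▸ h₁.mem 0 (by omega)
  have m₂ : a₂ ∈ s := ha₂ ▸ h₂.mem 0 (by omega)
  obtain ⟨w₀, p₀, l₀, s₀, e₀⟩ := h₀.exists_walk ⟨a₀, m₀⟩ ⟨b₀, n₀⟩ ha₀ hb₀
  obtain ⟨w₁, p₁, l₁, s₁, e₁⟩ := h₁.exists_walk ⟨a₁, m₁⟩ ⟨b₁, n₁⟩ ha₁ hb₁
  obtain ⟨w₂, p₂, l₂, s₂, e₂⟩ := h₂.exists_walk ⟨a₂, m₂⟩ ⟨b₂, n₂⟩ ha₂ hb₂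
  have D : ∀ {L L' : ℕ} {g g' : ℕ → V} {a a' b b' : s}
      (w : (G.induce s).Walk a b) (w' : (G.induce s).Walk a' b')
      (_ : ∀ z : s, z ∈ w.support ↔ ∃ i ≤ L, g i = z)
      (_ : ∀ z : s, z ∈ w'.support ↔ ∃ i ≤ L', g' i = z)
      (_ : ∀ i ≤ L, ∀ j ≤ L', g i ≠ g' j),
      ∀ z, z ∈ w.support → z ∈ w'.support → False := by
    intro L L' g g' a a' b b' w w' hs hs' hd z hz hz'
    obtain ⟨i, hi, hiz⟩ := (hs z).1 hz
    obtain ⟨j, hj, hjz⟩ := (hs' z).1 hz'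
    exact hd i hi j hj (hiz.trans hjz.symm)
  refine Or.inr (Or.inr (Or.inr ⟨![⟨a₀, m₀⟩, ⟨a₁, m₁⟩, ⟨a₂, m₂⟩], ![⟨b₀, n₀⟩, ⟨b₁, n₁⟩, ⟨b₂, n₂⟩],
    fun i =>
    match i with
    | 0 => w₀
    | 1 => w₁
    | 2 => w₂, ?_, ?_, ?_, ?_, ?_, ?_⟩))
  · intro i j hij
    fin_cases i <;> fin_cases j
    exacts [absurd rfl hij, t₀₁, t₀₂, t₀₁.symm, absurd rfl hij, t₁₂, t₀₂.symm, t₁₂.symm,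
      absurd rfl hij]
  · intro i j hij
    fin_cases i <;> fin_cases j
    exacts [absurd rfl hij, r₀₁, r₀₂, r₀₁.symm, absurd rfl hij, r₁₂, r₀₂.symm, r₁₂.symm,
      absurd rfl hij]
  · have key : ∀ {L L' : ℕ} {g g' : ℕ → V} {a b : V} (_ : a = g 0) (_ : b = g' L')
        (_ : ∀ i ≤ L, ∀ j ≤ L', g i ≠ g' j), a ≠ b := by
      intro L L' g g' a b ha hb hd hab
      exact hd 0 (Nat.zero_le _) L' le_rfl (by rw [← ha, ← hb, hab])
    have key2 : ∀ {L L' : ℕ} {g g' : ℕ → V} {a b : V} (_ : b = g L) (_ : a = g' 0)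
        (_ : ∀ i ≤ L, ∀ j ≤ L', g i ≠ g' j), a ≠ b := by
      intro L L' g g' a b hb ha hd hab
      exact hd L le_rfl 0 (Nat.zero_le _) (by rw [← ha, ← hb, hab])
    have key3 : ∀ {L : ℕ} {g : ℕ → V} {a b : V} (_ : G.IsSeqPath s L g) (_ : 1 ≤ L)
        (_ : a = g 0) (_ : b = g L), a ≠ b := by
      intro L g a b h hL ha hb hab
      have := h.inj 0 (by omega) L le_rfl (by rw [← ha, ← hb, hab])
      omega
    intro i j
    rw [ne_eq, Subtype.ext_iff]
    fin_cases i <;> fin_cases j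
    exacts [key3 h₀ hL₀ ha₀ hb₀, key ha₀ hb₁ d₀₁, key ha₀ hb₂ d₀₂, key2 hb₀ ha₁ d₀₁,
      key3 h₁ hL₁ ha₁ hb₁, key ha₁ hb₂ d₁₂, key2 hb₀ ha₂ d₀₂, key2 hb₁ ha₂ d₁₂,
      key3 h₂ hL₂ ha₂ hb₂]
  · intro i
    fin_cases i
    exacts [p₀, p₁, p₂]
  · intro i j hij z hi hj
    fin_cases i <;> fin_cases j
    · exact absurd rfl hij
    · exact D w₀ w₁ s₀ s₁ d₀₁ z hi hj
    · exact D w₀ w₂ s₀ s₂ d₀₂ z hi hj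
    · exact D w₀ w₁ s₀ s₁ d₀₁ z hj hi
    · exact absurd rfl hij
    · exact D w₁ w₂ s₁ s₂ d₁₂ z hi hj
    · exact D w₀ w₂ s₀ s₂ d₀₂ z hj hi
    · exact D w₁ w₂ s₁ s₂ d₁₂ z hj hi
    · exact absurd rfl hij
  · rw [eq_top_iff]
    constructor
    · rintro z -
      rw [Subgraph.verts_sup, Subgraph.verts_iSup]
      right
      rw [Set.mem_iUnion]
      rcases hcov z z.2 with h | h | h
      · exact ⟨0, (w₀.mem_verts_toSubgraph).2 ((s₀ z).2 h)⟩
      · exact ⟨1, (w₁.mem_verts_toSubgraph).2 ((s₁ z).2 h)⟩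
      · exact ⟨2, (w₂.mem_verts_toSubgraph).2 ((s₂ z).2 h)⟩
    · intro u v huv
      rw [Subgraph.sup_adj, Subgraph.sup_adj, Subgraph.iSup_adj]
      rcases hedge u u.2 v v.2 huv with h | h | h | ⟨hu, hv⟩ | ⟨hu, hv⟩
      · exact Or.inr ⟨0, e₀ u v h⟩
      · exact Or.inr ⟨1, e₁ u v h⟩
      · exact Or.inr ⟨2, e₂ u v h⟩
      · left; left
        refine ⟨?_, ?_, huv⟩
        · rcases hu with hu | hu | hu
          exacts [⟨0, Subtype.ext hu.symm⟩, ⟨1, Subtype.ext hu.symm⟩, ⟨2, Subtype.ext hu.symm⟩]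
        · rcases hv with hv | hv | hv
          exacts [⟨0, Subtype.ext hv.symm⟩, ⟨1, Subtype.ext hv.symm⟩, ⟨2, Subtype.ext hv.symm⟩]
      · left; right
        refine ⟨?_, ?_, huv⟩
        · rcases hu with hu | hu | hu
          exacts [⟨0, Subtype.ext hu.symm⟩, ⟨1, Subtype.ext hu.symm⟩, ⟨2, Subtype.ext hu.symm⟩]
        · rcases hv with hv | hv | hv
          exacts [⟨0, Subtype.ext hv.symm⟩, ⟨1, Subtype.ext hv.symm⟩, ⟨2, Subtype.ext hv.symm⟩]

theorem mem_solids_of_pyramid [Finite V] {D : Set V} (hD : D ∈ G.inducedCycles) {w : V}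
    (hw : w ∉ D) {a b c : V} (ha : a ∈ D) (hb : b ∈ D) (hc : c ∈ D) (hab : a ≠ b) (hac : a ≠ c)
    (hbc : b ≠ c) (hwa : G.Adj w a) (hwb : G.Adj w b) (hwc : G.Adj w c) :
    insert w D ∈ G.solids := by
  refine Or.inl ⟨⟨w, Or.inl rfl⟩, ?_, ?_⟩
  · obtain ⟨n, hn, ⟨e⟩⟩ := hD
    have h1 : ∀ v : ({⟨w, Or.inl rfl⟩}ᶜ : Set (insert w D : Set V)), v.1.1 ∈ D :=
      fun v => v.1.2.resolve_left fun h => v.2 (Subtype.ext h)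
    have h2 : ∀ v : D, (⟨v, Or.inr v.2⟩ : (insert w D : Set V)) ∈
        ({⟨w, Or.inl rfl⟩}ᶜ : Set (insert w D : Set V)) :=
      fun v h => hw (by have h' : v.1 = w := congrArg Subtype.val h
                        exact h' ▸ v.2)
    let e' : ({⟨w, Or.inl rfl⟩}ᶜ : Set (insert w D : Set V)) ≃ D :=
      ⟨fun v => ⟨v.1.1, h1 v⟩, fun v => ⟨⟨v, Or.inr v.2⟩, h2 v⟩, fun _ => rfl, fun _ => rfl⟩
    exact ⟨n, hn, ⟨RelIso.trans ⟨e', Iff.rfl⟩ e⟩⟩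
  · have hsub : ({⟨a, Or.inr ha⟩, ⟨b, Or.inr hb⟩, ⟨c, Or.inr hc⟩} : Set (insert w D : Set V)) ⊆
        (G.induce (insert w D)).neighborSet ⟨w, Or.inl rfl⟩ := by
      rintro v (rfl | rfl | rfl)
      exacts [hwa, hwb, hwc]
    refine le_trans ?_ (Set.ncard_le_ncard hsub)
    rw [Set.ncard_eq_three.2 ⟨_, _, _, ?_, ?_, ?_, rfl⟩]
    · exact fun h => hab (congrArg Subtype.val h)
    · exact fun h => hac (congrArg Subtype.val h)
    · exact fun h => hbc (congrArg Subtype.val h)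

/-! ### Solids formed by an induced cycle and an induced path attached to it. -/

/-- The vertices of `s` are listed as `c 0, …, c (N - 1)`, and the adjacency of `c i` and `c j`
for `i < j` is given by the relation `B i j`. -/
structure IsListing (G : SimpleGraph V) (s : Set V) (N : ℕ) (c : ℕ → V) (B : ℕ → ℕ → Prop) :
    Prop where
  image : s = c '' Set.Iio N
  inj : ∀ i < N, ∀ j < N, c i = c j → i = j
  adj : ∀ i < N, ∀ j < N, (G.Adj (c i) (c j) ↔ (i < j ∧ B i j) ∨ (j < i ∧ B j i))

theorem IsListing.isSeqPath {s : Set V} {N : ℕ} {c : ℕ → V} {B : ℕ → ℕ → Prop}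
    (h : G.IsListing s N c B) {L : ℕ} (idx : ℕ → ℕ) (h1 : ∀ i ≤ L, idx i < N)
    (h2 : ∀ i < L, (idx i < idx (i + 1) ∧ B (idx i) (idx (i + 1))) ∨
      (idx (i + 1) < idx i ∧ B (idx (i + 1)) (idx i)))
    (h3 : ∀ i ≤ L, ∀ j ≤ L, idx i = idx j → i = j) : G.IsSeqPath s L (fun t => c (idx t)) where
  mem i hi := by rw [h.image]; exact ⟨_, h1 i hi, rfl⟩
  adj i hi := (h.adj _ (h1 i (by omega)) _ (h1 (i + 1) (by omega))).2 (h2 i hi)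
  inj i hi j hj hij := h3 i hi j hj (h.inj _ (h1 i hi) _ (h1 j hj) hij)

theorem IsListing.seqEdge {c : ℕ → V} {L : ℕ} (idx : ℕ → ℕ) {i j : ℕ}
    (h : SeqEdge L idx i j) : SeqEdge L (fun t => c (idx t)) (c i) (c j) := by
  obtain ⟨k, hk, ⟨rfl, rfl⟩ | ⟨rfl, rfl⟩⟩ := h
  exacts [⟨k, hk, Or.inl ⟨rfl, rfl⟩⟩, ⟨k, hk, Or.inr ⟨rfl, rfl⟩⟩]

theorem SeqEdge.symm {W : Type*} {L : ℕ} {g : ℕ → W} {u v : W} (h : SeqEdge L g u v) :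
    SeqEdge L g v u := by
  obtain ⟨k, hk, h | h⟩ := h
  exacts [⟨k, hk, Or.inr h⟩, ⟨k, hk, Or.inl h⟩]

/-- The adjacency relation of an induced cycle of length `n` followed by an induced path,
with cross edges given by `X`. -/
def cyclePathRel (n : ℕ) (X : ℕ → ℕ → Prop) (i j : ℕ) : Prop :=
  (j < n ∧ (j = i + 1 ∨ (i = 0 ∧ j + 1 = n))) ∨ (n ≤ i ∧ j = i + 1) ∨
    (i < n ∧ n ≤ j ∧ X i (j - n))

theorem isListing_cycle_path {n m : ℕ} {f y : ℕ → V} (hf : G.IsIndCycle n f)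
    (hy : G.IsIndPath m y) (hd : ∀ i < n, ∀ j ≤ m, f i ≠ y j) {X : ℕ → ℕ → Prop}
    (hX : ∀ i < n, ∀ j ≤ m, (G.Adj (f i) (y j) ↔ X i j)) :
    G.IsListing (f '' Set.Iio n ∪ y '' Set.Iic m) (n + m + 1)
      -- Position `i < n` is a cycle vertex, and position `n + j` is the path vertex `y j`.
      (fun i => if i < n then f i else y (i - n)) (cyclePathRel n X) where
  image := by
    ext v
    constructor
    · rintro (⟨i, hi, rfl⟩ | ⟨i, hi, rfl⟩)
      · simp only [Set.mem_Iio] at hi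
        exact ⟨i, Set.mem_Iio.2 (by omega), by simp [hi]⟩
      · simp only [Set.mem_Iic] at hi
        exact ⟨n + i, Set.mem_Iio.2 (by omega), by simp⟩
    · rintro ⟨i, hi, rfl⟩
      simp only [Set.mem_Iio] at hi
      dsimp only
      split_ifs with h
      · exact Or.inl ⟨i, h, rfl⟩
      · exact Or.inr ⟨i - n, Set.mem_Iic.2 (by omega), rfl⟩
  inj i hi j hj hij := by
    split_ifs at hij with h1 h2 h2
    · exact hf.inj _ h1 _ h2 hij
    · exact absurd hij (hd _ h1 _ (by omega))
    · exact absurd hij.symm (hd _ h2 _ (by omega))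
    · have := hy.inj _ (by omega) _ (by omega) hij
      omega
  adj i hi j hj := by
    unfold cyclePathRel
    have h3 := hf.three_le
    split_ifs with h1 h2 h2
    · rw [hf.adj _ h1 _ h2]
      have e1 : ¬ n ≤ i := by omega
      have e2 : ¬ n ≤ j := by omega
      simp only [h1, h2, e1, e2, false_and, and_false, or_false, true_and]
      omega
    · rw [hX _ h1 _ (by omega)]
      have e1 : ¬ n ≤ i := by omega
      have e2 : n ≤ j := by omega
      have e3 : i < j := by omega
      have e4 : ¬ j < i := by omega
      simp [h1, h2, e1, e2, e3, e4]
    · rw [G.adj_comm, hX _ h2 _ (by omega)]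
      have e1 : ¬ n ≤ j := by omega
      have e2 : n ≤ i := by omega
      have e3 : j < i := by omega
      have e4 : ¬ i < j := by omega
      simp [h1, h2, e1, e2, e3, e4]
    · rw [hy.adj _ (by omega) _ (by omega)]
      have e1 : n ≤ j := by omega
      have e2 : n ≤ i := by omega
      simp only [h1, h2, e1, e2, false_and, or_false, true_and, false_or]
      omega

theorem IsListing.forall_adj {s : Set V} {N : ℕ} {c : ℕ → V} {B : ℕ → ℕ → Prop}
    (h : G.IsListing s N c B) {Q : V → V → Prop} (hQ : ∀ u v, Q u v → Q v u)
    (hB : ∀ i j, i < j → j < N → B i j → Q (c i) (c j)) :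
    ∀ u ∈ s, ∀ v ∈ s, G.Adj u v → Q u v := by
  intro u hu v hv huv
  rw [h.image] at hu hv
  obtain ⟨i, hi, rfl⟩ := hu
  obtain ⟨j, hj, rfl⟩ := hv
  rcases (h.adj i hi j hj).1 huv with ⟨h', h''⟩ | ⟨h', h''⟩
  exacts [hB i j h' hj h'', hQ _ _ (hB j i h' hi h'')]

/-- A trihedron: its three paths are the two arcs between `f 0` and `f k`, of length at least two by
`hk` and `hkn`, and the detour through `y`, of length `m + 2`. -/
theorem solid_of_cycle_path_single_single {n m : ℕ} {f y : ℕ → V}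
    (hf : G.IsIndCycle n f) (hy : G.IsIndPath m y) (hd : ∀ i < n, ∀ j ≤ m, f i ≠ y j)
    {k : ℕ} (hk : 2 ≤ k) (hkn : k + 2 ≤ n)
    (hX : ∀ i < n, ∀ j ≤ m, (G.Adj (f i) (y j) ↔ (i = 0 ∧ j = 0) ∨ (i = k ∧ j = m))) :
    f '' Set.Iio n ∪ y '' Set.Iic m ∈ G.solids := by
  have hc := isListing_cycle_path hf hy hd hX
  set s := f '' Set.Iio n ∪ y '' Set.Iic m
  set c : ℕ → V := fun i => if i < n then f i else y (i - n)
  refine mem_solids_of_trihedron (x := c 0) (y := c k) (L₀ := k) (L₁ := n - k) (L₂ := m + 2)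
    (fun h => ?_)
    (hc.isSeqPath (fun t => t) ?_ ?_ ?_)
    (hc.isSeqPath (fun t => if t = 0 then 0 else n - t) ?_ ?_ ?_)
    (hc.isSeqPath (fun t => if t = 0 then 0 else if t ≤ m + 1 then n + t - 1 else k) ?_ ?_ ?_)
    rfl rfl rfl rfl ?_ ?_ hk (by omega) (by omega) ?_ ?_ ?_ ?_ ?_
  · have := hc.inj _ (by omega) _ (by omega) h
    omega
  · grind
  · grind [cyclePathRel]
  · grind
  · grind
  · grind [cyclePathRel]
  · grind
  · grind
  · grind [cyclePathRel]
  · grind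
  · exact congrArg c (by grind)
  · exact congrArg c (by grind)
  · intro i hi j hj hij
    have := hc.inj _ (by omega) _ (by grind) hij
    rcases (show i = 0 ∨ i = k by grind) with rfl | rfl
    · exact Or.inl rfl
    · exact Or.inr rfl
  · intro i hi j hj hij
    have := hc.inj _ (by omega) _ (by grind) hij
    rcases (show i = 0 ∨ i = k by grind) with rfl | rfl
    · exact Or.inl rfl
    · exact Or.inr rfl
  · intro i hi j hj hij
    have := hc.inj _ (by grind) _ (by grind) hij
    rcases (show (if i = 0 then 0 else n - i) = 0 ∨ (if i = 0 then 0 else n - i) = k by grind)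
      with h | h <;> rw [h]
    · exact Or.inl rfl
    · exact Or.inr rfl
  · intro v hv
    rw [hc.image] at hv
    obtain ⟨i, hi, rfl⟩ := hv
    rw [Set.mem_Iio] at hi
    rcases (show i ≤ k ∨ (k < i ∧ i < n) ∨ n ≤ i by omega) with h | h | h
    · exact Or.inl ⟨i, h, rfl⟩
    · exact Or.inr (Or.inl ⟨n - i, by omega, congrArg c (by grind)⟩)
    · exact Or.inr (Or.inr ⟨i - n + 1, by omega, congrArg c (by grind)⟩)
  · refine hc.forall_adj (fun u v => Or.imp SeqEdge.symm (Or.imp SeqEdge.symm SeqEdge.symm)) ?_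
    intro i j hij hj h
    simp only [cyclePathRel] at h
    rcases (show (i + 1 ≤ k ∧ j = i + 1) ∨ (k ≤ i ∧ j = i + 1 ∧ j < n) ∨ (i = 0 ∧ j + 1 = n) ∨
      (n ≤ i ∧ j = i + 1) ∨ (i = 0 ∧ j = n) ∨ (i = k ∧ j = n + m) by omega)
      with h | h | h | h | h | h
    · exact Or.inl (IsListing.seqEdge _ ⟨i, by omega, Or.inl (by grind)⟩)
    · exact Or.inr (Or.inl (IsListing.seqEdge _ ⟨n - j, by omega, Or.inr (by grind)⟩))
    · exact Or.inr (Or.inl (IsListing.seqEdge _ ⟨0, by omega, Or.inl (by grind)⟩))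
    · exact Or.inr (Or.inr (IsListing.seqEdge _ ⟨i - n + 1, by omega, Or.inl (by grind)⟩))
    · exact Or.inr (Or.inr (IsListing.seqEdge _ ⟨0, by omega, Or.inl (by grind)⟩))
    · exact Or.inr (Or.inr (IsListing.seqEdge _ ⟨m + 1, by omega, Or.inr (by grind)⟩))

/-- A stamp: the triangle is `y 0`, `f 0`, `f (n - 1)`, and the three paths run along `y` and along
the two arcs to `f k`. -/
theorem solid_of_cycle_path_edge_single {n m : ℕ} {f y : ℕ → V}
    (hf : G.IsIndCycle n f) (hy : G.IsIndPath m y) (hd : ∀ i < n, ∀ j ≤ m, f i ≠ y j)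
    {k : ℕ} (hk : 1 ≤ k) (hkn : k + 2 ≤ n)
    (hX : ∀ i < n, ∀ j ≤ m, (G.Adj (f i) (y j) ↔
      (j = 0 ∧ (i = 0 ∨ i + 1 = n)) ∨ (j = m ∧ i = k))) :
    f '' Set.Iio n ∪ y '' Set.Iic m ∈ G.solids := by
  have hc := isListing_cycle_path hf hy hd hX
  set s := f '' Set.Iio n ∪ y '' Set.Iic m
  set c : ℕ → V := fun i => if i < n then f i else y (i - n)
  refine mem_solids_of_stamp (a₀ := c n) (a₁ := c 0) (a₂ := c (n - 1)) (x := c k)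
    (L₀ := m + 1) (L₁ := k) (L₂ := n - 1 - k)
    (hc.isSeqPath (fun t => if t ≤ m then n + t else k) ?_ ?_ ?_)
    (hc.isSeqPath (fun t => t) ?_ ?_ ?_)
    (hc.isSeqPath (fun t => n - 1 - t) ?_ ?_ ?_)
    (congrArg c (by grind)) rfl rfl (congrArg c (by grind)) rfl (congrArg c (by grind))
    (by omega) hk (by omega) ?_ ?_ ?_ ?_ ?_ ?_ ?_ ?_
  · grind
  · grind [cyclePathRel]
  · grind
  · grind
  · grind [cyclePathRel]
  · grind
  · grind
  · grind [cyclePathRel]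
  · grind
  · rw [hc.adj _ (by omega) _ (by omega)]; grind [cyclePathRel]
  · rw [hc.adj _ (by omega) _ (by omega)]; grind [cyclePathRel]
  · rw [hc.adj _ (by omega) _ (by omega)]; grind [cyclePathRel]
  · intro i hi j hj hij
    have := hc.inj _ (by grind) _ (by grind) hij
    exact congrArg c (by grind)
  · intro i hi j hj hij
    have := hc.inj _ (by grind) _ (by grind) hij
    exact congrArg c (by grind)
  · intro i hi j hj hij
    have := hc.inj _ (by grind) _ (by grind) hij
    exact congrArg c (by grind)
  · intro v hv
    rw [hc.image] at hv
    obtain ⟨i, hi, rfl⟩ := hv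
    rw [Set.mem_Iio] at hi
    rcases (show i ≤ k ∨ (k < i ∧ i < n) ∨ n ≤ i by omega) with h | h | h
    · exact Or.inr (Or.inl ⟨i, h, rfl⟩)
    · exact Or.inr (Or.inr ⟨n - 1 - i, by omega, congrArg c (by grind)⟩)
    · exact Or.inl ⟨i - n, by omega, congrArg c (by grind)⟩
  · refine hc.forall_adj (fun u v => Or.imp SeqEdge.symm (Or.imp SeqEdge.symm (Or.imp SeqEdge.symm
      And.symm))) ?_
    intro i j hij hj h
    simp only [cyclePathRel] at h
    rcases (show (i + 1 ≤ k ∧ j = i + 1) ∨ (k ≤ i ∧ j = i + 1 ∧ j < n) ∨ (i = 0 ∧ j = n - 1) ∨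
      (n ≤ i ∧ j = i + 1) ∨ (i = 0 ∧ j = n) ∨ (i = n - 1 ∧ j = n) ∨ (i = k ∧ j = n + m) by omega)
      with h | h | ⟨rfl, rfl⟩ | h | ⟨rfl, rfl⟩ | ⟨rfl, rfl⟩ | h
    · exact Or.inr (Or.inl (IsListing.seqEdge _ ⟨i, by omega, Or.inl (by grind)⟩))
    · exact Or.inr (Or.inr (Or.inl (IsListing.seqEdge _ ⟨n - 1 - j, by omega, Or.inr (by grind)⟩)))
    · exact Or.inr (Or.inr (Or.inr ⟨Or.inr (Or.inl rfl), Or.inr (Or.inr rfl)⟩))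
    · exact Or.inl (IsListing.seqEdge _ ⟨i - n, by omega, Or.inl (by grind)⟩)
    · exact Or.inr (Or.inr (Or.inr ⟨Or.inr (Or.inl rfl), Or.inl rfl⟩))
    · exact Or.inr (Or.inr (Or.inr ⟨Or.inr (Or.inr rfl), Or.inl rfl⟩))
    · exact Or.inl (IsListing.seqEdge _ ⟨m, by omega, Or.inr (by grind)⟩)

/-- A prism with triangles `y 0`, `f 0`, `f (n - 1)` and `y m`, `f k`, `f (k + 1)`; the bounds on
`m`, `k` and `n` keep these triangles disjoint. -/
theorem solid_of_cycle_path_edge_edge {n m : ℕ} {f y : ℕ → V}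
    (hf : G.IsIndCycle n f) (hy : G.IsIndPath m y) (hd : ∀ i < n, ∀ j ≤ m, f i ≠ y j)
    {k : ℕ} (hm : 1 ≤ m) (hk : 1 ≤ k) (hkn : k + 3 ≤ n)
    (hX : ∀ i < n, ∀ j ≤ m, (G.Adj (f i) (y j) ↔
      (j = 0 ∧ (i = 0 ∨ i + 1 = n)) ∨ (j = m ∧ (i = k ∨ i = k + 1)))) :
    f '' Set.Iio n ∪ y '' Set.Iic m ∈ G.solids := by
  have hc := isListing_cycle_path hf hy hd hX
  set s := f '' Set.Iio n ∪ y '' Set.Iic m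
  set c : ℕ → V := fun i => if i < n then f i else y (i - n)
  refine mem_solids_of_prism (a₀ := c n) (a₁ := c 0) (a₂ := c (n - 1)) (b₀ := c (n + m))
    (b₁ := c k) (b₂ := c (k + 1)) (L₀ := m) (L₁ := k) (L₂ := n - 2 - k)
    (hc.isSeqPath (fun t => n + t) ?_ ?_ ?_)
    (hc.isSeqPath (fun t => t) ?_ ?_ ?_)
    (hc.isSeqPath (fun t => n - 1 - t) ?_ ?_ ?_)
    rfl rfl rfl rfl rfl (congrArg c (by omega))
    (by omega) hk (by omega) ?_ ?_ ?_ ?_ ?_ ?_ ?_ ?_ ?_ ?_ ?_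
  · grind
  · grind [cyclePathRel]
  · grind
  · grind
  · grind [cyclePathRel]
  · grind
  · grind
  · grind [cyclePathRel]
  · grind
  · rw [hc.adj _ (by omega) _ (by omega)]; grind [cyclePathRel]
  · rw [hc.adj _ (by omega) _ (by omega)]; grind [cyclePathRel]
  · rw [hc.adj _ (by omega) _ (by omega)]; grind [cyclePathRel]
  · rw [hc.adj _ (by omega) _ (by omega)]; grind [cyclePathRel]
  · rw [hc.adj _ (by omega) _ (by omega)]; grind [cyclePathRel]
  · rw [hc.adj _ (by omega) _ (by omega)]; grind [cyclePathRel]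
  · intro i hi j hj hij
    have := hc.inj _ (by grind) _ (by grind) hij
    omega
  · intro i hi j hj hij
    have := hc.inj _ (by grind) _ (by grind) hij
    omega
  · intro i hi j hj hij
    have := hc.inj _ (by grind) _ (by grind) hij
    omega
  · intro v hv
    rw [hc.image] at hv
    obtain ⟨i, hi, rfl⟩ := hv
    rw [Set.mem_Iio] at hi
    rcases (show i ≤ k ∨ (k < i ∧ i < n) ∨ n ≤ i by omega) with h | h | h
    · exact Or.inr (Or.inl ⟨i, h, rfl⟩)
    · exact Or.inr (Or.inr ⟨n - 1 - i, by omega, congrArg c (by grind)⟩)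
    · exact Or.inl ⟨i - n, by omega, congrArg c (by grind)⟩
  · refine hc.forall_adj (fun u v => Or.imp SeqEdge.symm (Or.imp SeqEdge.symm (Or.imp SeqEdge.symm
      (Or.imp And.symm And.symm)))) ?_
    intro i j hij hj h
    simp only [cyclePathRel] at h
    rcases (show (i + 1 ≤ k ∧ j = i + 1) ∨ (k + 1 ≤ i ∧ j = i + 1 ∧ j < n) ∨
      (i = 0 ∧ j = n - 1) ∨ (n ≤ i ∧ j = i + 1) ∨ (i = 0 ∧ j = n) ∨ (i = n - 1 ∧ j = n) ∨
      (i = k ∧ j = k + 1) ∨ (i = k ∧ j = n + m) ∨ (i = k + 1 ∧ j = n + m) by omega)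
      with h | h | ⟨rfl, rfl⟩ | h | ⟨rfl, rfl⟩ | ⟨rfl, rfl⟩ | ⟨rfl, rfl⟩ | ⟨rfl, rfl⟩ | ⟨rfl, rfl⟩
    · exact Or.inr (Or.inl (IsListing.seqEdge _ ⟨i, by omega, Or.inl (by grind)⟩))
    · exact Or.inr (Or.inr (Or.inl (IsListing.seqEdge _ ⟨n - 1 - j, by omega, Or.inr (by grind)⟩)))
    · exact Or.inr (Or.inr (Or.inr (Or.inl ⟨Or.inr (Or.inl rfl), Or.inr (Or.inr rfl)⟩)))
    · exact Or.inl (IsListing.seqEdge _ ⟨i - n, by omega, Or.inl (by grind)⟩)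
    · exact Or.inr (Or.inr (Or.inr (Or.inl ⟨Or.inr (Or.inl rfl), Or.inl rfl⟩)))
    · exact Or.inr (Or.inr (Or.inr (Or.inl ⟨Or.inr (Or.inr rfl), Or.inl rfl⟩)))
    · exact Or.inr (Or.inr (Or.inr (Or.inr ⟨Or.inr (Or.inl rfl), Or.inr (Or.inr rfl)⟩)))
    · exact Or.inr (Or.inr (Or.inr (Or.inr ⟨Or.inr (Or.inl rfl), Or.inl rfl⟩)))
    · exact Or.inr (Or.inr (Or.inr (Or.inr ⟨Or.inr (Or.inr rfl), Or.inl rfl⟩)))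

/-- A pyramid with apex `f 0`: replacing `f 0` by the path `y` turns `f` into another induced cycle,
of length `(n - 1) + (m + 1)`, on which `f 0` sees `f 1`, `f (n - 1)` and `y j₀`. -/
theorem solid_of_cycle_path_apex {n m : ℕ} {f y : ℕ → V}
    (hf : G.IsIndCycle n f) (hy : G.IsIndPath m y) (hd : ∀ i < n, ∀ j ≤ m, f i ≠ y j)
    [Finite V] {j₀ : ℕ} (hj₀ : j₀ ≤ m) (h₀ : G.Adj (f 0) (y j₀))
    (hX : ∀ i < n, 1 ≤ i → ∀ j ≤ m, (G.Adj (f i) (y j) ↔ (i + 1 = n ∧ j = 0) ∨ (i = 1 ∧ j = m))) :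
    f '' Set.Iio n ∪ y '' Set.Iic m ∈ G.solids := by
  have hn := hf.three_le
  have hg : G.IsIndCycle (n + m) (fun i => if i + 1 < n then f (i + 1) else y (i + 1 - n)) := by
    refine ⟨by omega, ?_, ?_⟩
    · intro i hi j hj hij
      split_ifs at hij with h1 h2 h2
      · have := hf.inj _ h1 _ h2 hij
        omega
      · exact absurd hij (hd _ h1 _ (by omega))
      · exact absurd hij.symm (hd _ h2 _ (by omega))
      · have := hy.inj _ (by omega) _ (by omega) hij
        omega
    · intro i hi j hj
      split_ifs with h1 h2 h2
      · rw [hf.adj _ h1 _ h2]; omega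
      · rw [hX _ h1 (by omega) _ (by omega)]; omega
      · rw [G.adj_comm, hX _ h2 (by omega) _ (by omega)]; omega
      · rw [hy.adj _ (by omega) _ (by omega)]; omega
  have hs : f '' Set.Iio n ∪ y '' Set.Iic m = insert (f 0)
      ((fun i => if i + 1 < n then f (i + 1) else y (i + 1 - n)) '' Set.Iio (n + m)) := by
    ext v
    constructor
    · rintro (⟨i, hi, rfl⟩ | ⟨i, hi, rfl⟩)
      · rw [Set.mem_Iio] at hi
        rcases i with _ | i
        · exact Or.inl rfl
        · exact Or.inr ⟨i, Set.mem_Iio.2 (by omega), by simp [hi]⟩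
      · rw [Set.mem_Iic] at hi
        refine Or.inr ⟨i + n - 1, Set.mem_Iio.2 (by omega), ?_⟩
        have e1 : i + n - 1 + 1 = i + n := by omega
        simp [e1]
    · rintro (rfl | ⟨i, hi, rfl⟩)
      · exact Or.inl ⟨0, Set.mem_Iio.2 (by omega), rfl⟩
      · rw [Set.mem_Iio] at hi
        dsimp only
        split_ifs with h
        · exact Or.inl ⟨_, h, rfl⟩
        · exact Or.inr ⟨_, Set.mem_Iic.2 (by omega), rfl⟩
  rw [hs]
  refine mem_solids_of_pyramid hg.mem_inducedCycles ?_ (a := f 1) (b := f (n - 1)) (c := y j₀)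
    ?_ ?_ ?_ ?_ ?_ ?_ ?_ ?_ h₀
  · rintro ⟨i, hi, h⟩
    rw [Set.mem_Iio] at hi
    dsimp only at h
    split_ifs at h with h1
    · have := hf.inj _ h1 _ (by omega) h
      omega
    · exact hd 0 (by omega) _ (by omega) h.symm
  · exact ⟨0, Set.mem_Iio.2 (by omega), by simp [show 1 < n by omega]⟩
  · refine ⟨n - 2, Set.mem_Iio.2 (by omega), ?_⟩
    exact (if_pos (by omega)).trans (congrArg f (by omega))
  · refine ⟨n - 1 + j₀, Set.mem_Iio.2 (by omega), ?_⟩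
    exact (if_neg (by omega)).trans (congrArg y (by omega))
  · intro h
    have := hf.inj _ (by omega) _ (by omega) h
    omega
  · exact hd _ (by omega) _ hj₀
  · exact hd _ (by omega) _ hj₀
  · rw [hf.adj _ (by omega) _ (by omega)]; omega
  · rw [hf.adj _ (by omega) _ (by omega)]; omega

/-! ### Minimal attachments to an induced cycle form solids. -/

/-- `Y` has neighbours at two distinct nonadjacent vertices of `D`. -/
def Spread (G : SimpleGraph V) (D Y : Set V) : Prop :=
  ∃ d₁ ∈ D, ∃ d₂ ∈ D, d₁ ≠ d₂ ∧ ¬ G.Adj d₁ d₂ ∧ (∃ y ∈ Y, G.Adj d₁ y) ∧ ∃ y ∈ Y, G.Adj d₂ y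

theorem Spread.mono {D D' Y Y' : Set V} (h : G.Spread D Y) (hD : D ⊆ D') (hY : Y ⊆ Y') :
    G.Spread D' Y' := by
  obtain ⟨d₁, h₁, d₂, h₂, hne, hadj, ⟨y₁, hy₁, e₁⟩, y₂, hy₂, e₂⟩ := h
  exact ⟨d₁, hD h₁, d₂, hD h₂, hne, hadj, ⟨y₁, hY hy₁, e₁⟩, y₂, hY hy₂, e₂⟩

theorem eq_or_adj_of_not_spread {D Y : Set V} (h : ¬ G.Spread D Y) {d e y z : V} (hd : d ∈ D)
    (he : e ∈ D) (hy : y ∈ Y) (hz : z ∈ Y) (hdy : G.Adj d y) (hez : G.Adj e z) :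
    d = e ∨ G.Adj d e := by
  by_contra hc
  rw [not_or] at hc
  exact h ⟨d, hd, e, he, hc.1, hc.2, ⟨y, hy, hdy⟩, z, hz, hez⟩

/-- The case of `solid_of_minimal` in which the first end of the path `y` sees an edge of the
cycle. -/
theorem solid_of_cycle_path_edge {n m k : ℕ} {f y : ℕ → V} (hf : G.IsIndCycle n f)
    (hy : G.IsIndPath m y) (hd : ∀ i < n, ∀ j ≤ m, f i ≠ y j) (hm : 1 ≤ m) (hk : 2 ≤ k)
    (hkn : k + 2 ≤ n) (h0 : G.Adj (f 0) (y 0)) (hn : G.Adj (f (n - 1)) (y 0))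
    (hkm : G.Adj (f k) (y m))
    (hA : ∀ i < n, ∀ i' < n, G.Adj (f i) (y 0) → G.Adj (f i') (y 0) →
      f i = f i' ∨ G.Adj (f i) (f i'))
    (hB : ∀ i < n, ∀ i' < n, G.Adj (f i) (y m) → G.Adj (f i') (y m) →
      f i = f i' ∨ G.Adj (f i) (f i'))
    (hmid : ∀ i < n, ∀ j ≤ m, G.Adj (f i) (y j) → j = 0 ∨ j = m)
    (hAB : ∀ i < n, G.Adj (f i) (y 0) → ¬ G.Adj (f i) (y m)) :
    f '' Set.Iio n ∪ y '' Set.Iic m ∈ G.solids := by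
  -- The cycle has length at least four, so no third vertex is adjacent to both `f 0` and `f (n -
  -- 1)`.
  have hA' : ∀ i < n, G.Adj (f i) (y 0) → i = 0 ∨ i + 1 = n := by
    intro i hi h
    have h1 := hA i hi 0 (by omega) h h0
    have h2 := hA i hi (n - 1) (by omega) h hn
    rw [hf.adj _ (by omega) _ (by omega)] at h1 h2
    have h3 : f i = f 0 → i = 0 := hf.inj _ (by omega) _ (by omega)
    have h4 : f i = f (n - 1) → i = n - 1 := hf.inj _ (by omega) _ (by omega)
    grind
  have hB' : ∀ i < n, ∀ i' < n, G.Adj (f i) (y m) → G.Adj (f i') (y m) →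
      i = i' ∨ i' = i + 1 ∨ i = i' + 1 ∨ (i = 0 ∧ i' + 1 = n) ∨ (i' = 0 ∧ i + 1 = n) := by
    intro i hi i' hi' h h'
    rcases hB i hi i' hi' h h' with h1 | h1
    · exact Or.inl (hf.inj _ hi _ hi' h1)
    · exact Or.inr ((hf.adj _ hi _ hi').1 h1)
  by_cases hother : ∃ i < n, i ≠ k ∧ G.Adj (f i) (y m)
  · obtain ⟨l, hl, hlk, hlm⟩ := hother
    have hl0 : l ≠ 0 := fun h => hAB 0 (by omega) h0 (h ▸ hlm)
    have hln : l ≠ n - 1 := fun h => hAB (n - 1) (by omega) hn (h ▸ hlm)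
    -- The second attachment `l` of `y m` is next to `k`; `q` is the smaller of the two indices.
    obtain ⟨q, hq1, hqn, hqk, hql⟩ : ∃ q, 1 ≤ q ∧ q + 3 ≤ n ∧ (k = q ∨ k = q + 1) ∧
        ((l = q ∧ k = q + 1) ∨ (l = q + 1 ∧ k = q)) := by
      have := hB' l hl k (by omega) hlm hkm
      rcases (show l + 1 = k ∨ l = k + 1 by omega) with h | h
      · exact ⟨l, by omega, by omega, by omega, by omega⟩
      · exact ⟨k, by omega, by omega, by omega, by omega⟩
    refine solid_of_cycle_path_edge_edge hf hy hd hm hq1 hqn fun i hi j hj => ⟨fun h => ?_, ?_⟩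
    · rcases hmid i hi j hj h with rfl | rfl
      · exact Or.inl ⟨rfl, hA' i hi h⟩
      · right
        have h1 := hB' i hi k (by omega) h hkm
        have h2 := hB' i hi l (by omega) h hlm
        omega
    · rintro (⟨rfl, rfl | h⟩ | ⟨rfl, h⟩)
      · exact h0
      · rwa [show i = n - 1 by omega]
      · rcases (show i = k ∨ i = l by omega) with rfl | rfl
        exacts [hkm, hlm]
  · refine solid_of_cycle_path_edge_single hf hy hd (by omega) hkn fun i hi j hj => ⟨fun h => ?_, ?_⟩
    · rcases hmid i hi j hj h with rfl | rfl
      · exact Or.inl ⟨rfl, hA' i hi h⟩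
      · right
        by_contra hc
        exact hother ⟨i, hi, fun h => hc ⟨rfl, h⟩, h⟩
    · rintro (⟨rfl, rfl | h⟩ | ⟨rfl, rfl⟩)
      · exact h0
      · rwa [show i = n - 1 by omega]
      · exact hkm

/-- An induced cycle can be traversed starting at a given vertex, ending at a given neighbour. -/
theorem exists_isIndCycle_start_end {s : Set V} (hs : s ∈ G.inducedCycles) {x z : V} (hx : x ∈ s)
    (hz : z ∈ s) (hxz : G.Adj x z) :
    ∃ (n : ℕ) (f : ℕ → V), G.IsIndCycle n f ∧ s = f '' Set.Iio n ∧ f 0 = x ∧ f (n - 1) = z := by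
  obtain ⟨n, f, hf, rfl, rfl⟩ := exists_isIndCycle_start hs hx
  obtain ⟨i, hi, rfl⟩ := hz
  have h3 := hf.three_le
  rw [Set.mem_Iio] at hi
  rcases (show i + 1 = n ∨ i = 1 by
    have := (hf.adj 0 (by omega) i hi).1 hxz
    omega) with h | rfl
  · exact ⟨n, f, hf, rfl, rfl, congrArg f (by omega)⟩
  · refine ⟨n, _, hf.reflect, (image_reflect f).symm, rfl, ?_⟩
    exact (if_neg (by omega)).trans (congrArg f (by omega))

/-- Minimality makes `Y` an induced path whose proper subpaths have only equal or adjacent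
attachments on `D`. If `Y` is one vertex, it gives a trihedron or is the apex of a pyramid.
Otherwise either some vertex of `D` is attached to `Y` minus its last vertex and also to `Y` minus
its first, and is the apex of a pyramid, or each end of `Y` sees exactly one vertex or one edge of
`D` and nothing else is attached, giving a trihedron, a stamp or a prism. -/
theorem solid_of_minimal [Finite V] {D Y : Set V} (hD : D ∈ G.inducedCycles)
    (hdis : Disjoint D Y) (hY : Minimal (fun Y => G.ConnSet Y ∧ G.Spread D Y) Y) :
    D ∪ Y ∈ G.solids := by
  obtain ⟨⟨hYc, d₁, hd₁, d₂, hd₂, hne, hnadj, ⟨y₁, hy₁, e₁⟩, y₂, hy₂, e₂⟩, hmin⟩ := hY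
  obtain ⟨P, hPY, hP⟩ := hYc.exists_pathSet hy₁ hy₂
  obtain rfl : P = Y := hPY.antisymm (hmin ⟨hP.connSet, d₁, hd₁, d₂, hd₂, hne, hnadj,
    ⟨y₁, hP.left_mem, e₁⟩, y₂, hP.right_mem, e₂⟩ hPY)
  obtain ⟨m, y, rfl, rfl, rfl, hy⟩ := hP.exists_isIndPath
  have hd : ∀ d ∈ D, ∀ j ≤ m, d ≠ y j := fun d hd j hj h =>
    Set.disjoint_left.1 hdis hd ⟨j, hj, h.symm⟩
  have hsub : ∀ l r, l ≤ r → r ≤ m → (l ≠ 0 ∨ r ≠ m) →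
      ¬ G.Spread D (y '' Set.Icc l r) := by
    intro l r hlr hr hne hsp
    have h1 := hmin ⟨hy.connSet_Icc hlr hr, hsp⟩ (Set.image_mono fun i hi => hi.2.trans hr)
    rcases hne with hne | hne
    · obtain ⟨i, hi, h⟩ := h1 ⟨0, Nat.zero_le m, rfl⟩
      have := hy.inj _ (hi.2.trans hr) _ (Nat.zero_le m) h
      have := hi.1
      omega
    · obtain ⟨i, hi, h⟩ := h1 ⟨m, Set.mem_Iic.2 le_rfl, rfl⟩
      have := hy.inj _ (hi.2.trans hr) _ le_rfl h
      have := hi.2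
      omega
  rcases Nat.eq_zero_or_pos m with rfl | hm
  · obtain ⟨n, f, hf, rfl, rfl⟩ := exists_isIndCycle_start hD hd₁
    obtain ⟨k, hk, rfl⟩ := hd₂
    have h3 := hf.three_le
    rw [Set.mem_Iio] at hk
    have hk0 : k ≠ 0 := fun h => hne (by rw [h])
    rw [hf.adj 0 (by omega) k hk] at hnadj
    by_cases hth : ∃ i < n, i ≠ 0 ∧ i ≠ k ∧ G.Adj (f i) (y 0)
    · obtain ⟨i, hi, hi0, hik, hiy⟩ := hth
      have : f '' Set.Iio n ∪ y '' Set.Iic 0 = insert (y 0) (f '' Set.Iio n) := by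
        rw [show Set.Iic 0 = {0} from Set.Iic_bot, Set.image_singleton, Set.union_singleton]
      rw [this]
      exact mem_solids_of_pyramid hD (fun h => hd _ h 0 le_rfl rfl) hd₁
        ⟨k, hk, rfl⟩ ⟨i, hi, rfl⟩ hne (fun h => hi0 (hf.inj _ (by omega) _ (by omega) h).symm)
        (fun h => hik (hf.inj _ (by omega) _ (by omega) h).symm) e₁.symm e₂.symm hiy.symm
    · refine solid_of_cycle_path_single_single hf hy (fun i hi => hd _ ⟨i, hi, rfl⟩)
        (k := k) (by omega) (by omega) fun i hi j hj => ?_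
      obtain rfl : j = 0 := by omega
      constructor
      · intro h
        by_contra hc
        exact hth ⟨i, hi, by omega, by omega, h⟩
      · rintro (⟨rfl, -⟩ | ⟨rfl, -⟩)
        exacts [e₁, e₂]
  have hA : ∀ d ∈ D, ∀ e ∈ D, ∀ i < m, ∀ j < m, G.Adj d (y i) → G.Adj e (y j) →
      d = e ∨ G.Adj d e := fun d hd e he i hi j hj hdi hej =>
    eq_or_adj_of_not_spread (hsub 0 (m - 1) (by omega) (by omega) (by omega)) hd he
      ⟨i, ⟨by omega, by omega⟩, rfl⟩ ⟨j, ⟨by omega, by omega⟩, rfl⟩ hdi hej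
  have hB : ∀ d ∈ D, ∀ e ∈ D, ∀ i ≤ m, 1 ≤ i → ∀ j ≤ m, 1 ≤ j → G.Adj d (y i) → G.Adj e (y j) →
      d = e ∨ G.Adj d e := fun d hd e he i hi hi' j hj hj' hdi hej =>
    eq_or_adj_of_not_spread (hsub 1 m (by omega) (by omega) (by omega)) hd he
      ⟨i, ⟨by omega, by omega⟩, rfl⟩ ⟨j, ⟨by omega, by omega⟩, rfl⟩ hdi hej
  have hd₁' : ∀ j ≤ m, G.Adj d₁ (y j) → j = 0 := by
    intro j hj h
    by_contra hj0
    rcases hB d₁ hd₁ d₂ hd₂ j hj (by omega) m le_rfl hm h e₂ with h | h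
    exacts [hne h, hnadj h]
  have hd₂' : ∀ j ≤ m, G.Adj d₂ (y j) → j = m := by
    intro j hj h
    by_contra hj0
    rcases hA d₁ hd₁ d₂ hd₂ 0 hm j (by omega) e₁ h with h | h
    exacts [hne h, hnadj h]
  -- Such a `c` is compared with `d₁` through `hA` and with `d₂` through `hB`, hence is the common
  -- neighbour of both on the cycle. The case `i = j` covers attachments at inner vertices of the
  -- path.
  by_cases hc : ∃ c ∈ D, ∃ i < m, ∃ j ≤ m, 1 ≤ j ∧ G.Adj c (y i) ∧ G.Adj c (y j)
  · obtain ⟨c, hcD, i₀, hi₀, j₀, hj₀, hj₀', hci, hcj⟩ := hc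
    have hcd₁ : G.Adj c d₁ := by
      rcases hA c hcD d₁ hd₁ i₀ hi₀ 0 hm hci e₁ with rfl | h
      · have := hd₁' j₀ hj₀ hcj
        omega
      · exact h
    have hcd₂ : G.Adj c d₂ := by
      rcases hB c hcD d₂ hd₂ j₀ hj₀ hj₀' m le_rfl hm hcj e₂ with rfl | h
      · have := hd₂' i₀ hi₀.le hci
        omega
      · exact h
    obtain ⟨n, f, hf, rfl, rfl, rfl⟩ := exists_isIndCycle_start_end hD hcD hd₁ hcd₁
    have h3 := hf.three_le
    obtain ⟨k, hk, rfl⟩ := hd₂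
    rw [Set.mem_Iio] at hk
    obtain rfl : k = 1 := by
      have h1 := (hf.adj 0 (by omega) k hk).1 hcd₂
      have h2 : k ≠ n - 1 := fun h => hne (by rw [h])
      omega
    refine solid_of_cycle_path_apex hf hy (fun i hi => hd _ ⟨i, hi, rfl⟩) hi₀.le hci
      fun i hi hi1 j hj => ⟨fun h => ?_, ?_⟩
    · have hi01 : i = 1 ∨ i + 1 = n := by
        have h0 : f 0 = f i ∨ G.Adj (f 0) (f i) := by
          by_cases hjm : j < m
          · exact hA _ hcD _ ⟨i, hi, rfl⟩ i₀ hi₀ j hjm hci h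
          · exact hB _ hcD _ ⟨i, hi, rfl⟩ j₀ hj₀ hj₀' j hj (by omega) hcj h
        rcases h0 with h0 | h0
        · have := hf.inj _ (by omega) _ hi h0
          omega
        · have := (hf.adj 0 (by omega) i hi).1 h0
          omega
      rcases hi01 with rfl | hi01
      · exact Or.inr ⟨rfl, hd₂' j hj h⟩
      · obtain rfl : i = n - 1 := by omega
        exact Or.inl ⟨hi01, hd₁' j hj h⟩
    · rintro (⟨h, rfl⟩ | ⟨rfl, rfl⟩)
      · rwa [show i = n - 1 by omega]
      · exact e₂
  have hmid : ∀ d ∈ D, ∀ j ≤ m, G.Adj d (y j) → j = 0 ∨ j = m := by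
    intro d hd j hj h
    by_contra hj0
    exact hc ⟨d, hd, j, by omega, j, hj, by omega, h, h⟩
  have hAB : ∀ d ∈ D, G.Adj d (y 0) → ¬ G.Adj d (y m) := fun d hd h h' =>
    hc ⟨d, hd, 0, hm, m, le_rfl, hm, h, h'⟩
  by_cases hother : ∃ e ∈ D, e ≠ d₁ ∧ G.Adj e (y 0)
  · obtain ⟨e, heD, hed, hey⟩ := hother
    have hde : G.Adj d₁ e := (hA d₁ hd₁ e heD 0 hm 0 hm e₁ hey).resolve_left hed.symm
    obtain ⟨n, f, hf, rfl, rfl, rfl⟩ := exists_isIndCycle_start_end hD hd₁ heD hde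
    have h3 := hf.three_le
    obtain ⟨k, hk, rfl⟩ := hd₂
    rw [Set.mem_Iio] at hk
    have hk0 : k ≠ 0 := fun h => hne (by rw [h])
    rw [hf.adj 0 (by omega) k hk] at hnadj
    exact solid_of_cycle_path_edge hf hy (fun i hi => hd _ ⟨i, hi, rfl⟩) hm (k := k) (by omega)
      (by omega) e₁ hey e₂ (fun i hi i' hi' => hA _ ⟨i, hi, rfl⟩ _ ⟨i', hi', rfl⟩ 0 hm 0 hm)
      (fun i hi i' hi' => hB _ ⟨i, hi, rfl⟩ _ ⟨i', hi', rfl⟩ m le_rfl hm m le_rfl hm)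
      (fun i hi => hmid _ ⟨i, hi, rfl⟩) (fun i hi => hAB _ ⟨i, hi, rfl⟩)
  by_cases hother' : ∃ e ∈ D, e ≠ d₂ ∧ G.Adj e (y m)
  · obtain ⟨e, heD, hed, hey⟩ := hother'
    have hde : G.Adj d₂ e :=
      (hB d₂ hd₂ e heD m le_rfl hm m le_rfl hm e₂ hey).resolve_left hed.symm
    obtain ⟨n, f, hf, rfl, rfl, rfl⟩ := exists_isIndCycle_start_end hD hd₂ heD hde
    have h3 := hf.three_le
    obtain ⟨k, hk, rfl⟩ := hd₁
    rw [Set.mem_Iio] at hk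
    have hk0 : k ≠ 0 := fun h => hne (by rw [h])
    rw [hf.adj k hk 0 (by omega)] at hnadj
    rw [← image_Iic_reverse]
    refine solid_of_cycle_path_edge hf hy.reverse (fun i hi j hj => hd _ ⟨i, hi, rfl⟩ _ (by omega))
      hm (k := k) (by omega) (by omega) e₂ hey ?_ ?_ ?_ ?_ ?_
    · simpa using e₁
    · intro i hi i' hi'
      exact hB _ ⟨i, hi, rfl⟩ _ ⟨i', hi', rfl⟩ m le_rfl hm m le_rfl hm
    · simp only [Nat.sub_self]
      exact fun i hi i' hi' => hA _ ⟨i, hi, rfl⟩ _ ⟨i', hi', rfl⟩ 0 hm 0 hm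
    · intro i hi j hj h
      have := hmid _ ⟨i, hi, rfl⟩ (m - j) (by omega) h
      omega
    · simp only [Nat.sub_self, Nat.sub_zero]
      exact fun i hi h h' => hAB _ ⟨i, hi, rfl⟩ h' h
  · obtain ⟨n, f, hf, rfl, rfl⟩ := exists_isIndCycle_start hD hd₁
    have h3 := hf.three_le
    obtain ⟨k, hk, rfl⟩ := hd₂
    rw [Set.mem_Iio] at hk
    have hk0 : k ≠ 0 := fun h => hne (by rw [h])
    rw [hf.adj 0 (by omega) k hk] at hnadj
    refine solid_of_cycle_path_single_single hf hy (fun i hi => hd _ ⟨i, hi, rfl⟩)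
      (k := k) (by omega) (by omega) fun i hi j hj => ⟨fun h => ?_, ?_⟩
    · rcases hmid _ ⟨i, hi, rfl⟩ j hj h with rfl | rfl
      · left
        by_contra hi0
        exact hother ⟨f i, ⟨i, hi, rfl⟩, fun h => hi0 ⟨hf.inj _ hi _ (by omega) h, rfl⟩, h⟩
      · right
        by_contra hi0
        exact hother' ⟨f i, ⟨i, hi, rfl⟩, fun h => hi0 ⟨hf.inj _ hi _ (by omega) h, rfl⟩, h⟩
    · rintro (⟨rfl, rfl⟩ | ⟨rfl, rfl⟩)
      exacts [e₁, e₂]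

theorem PathSet.insert_mem_inducedCycles {a b x : V} {P : Set V} (hP : G.PathSet a b P)
    (hab : a ≠ b) (hx : ∀ v ∈ P, (G.Adj x v ↔ v = a ∨ v = b)) (hxP : x ∉ P) :
    insert x P ∈ G.inducedCycles := by
  obtain ⟨n, p, rfl, rfl, rfl, hp⟩ := hP.exists_isIndPath
  have hn : n ≠ 0 := fun h => hab (by rw [h])
  have hx' : ∀ i ≤ n, (G.Adj x (p i) ↔ i = 0 ∨ i = n) := by
    intro i hi
    rw [hx _ ⟨i, hi, rfl⟩]
    exact ⟨Or.imp (hp.inj _ hi _ (by omega)) (hp.inj _ hi _ (by omega)),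
      Or.imp (congrArg p) (congrArg p)⟩
  have hxp : ∀ i ≤ n, p i ≠ x := fun i hi h => hxP ⟨i, hi, h⟩
  refine mem_inducedCycles_iff.2 ⟨n + 2, fun i => if i ≤ n then p i else x, ⟨by omega, ?_, ?_⟩, ?_⟩
  · intro i hi j hj hij
    split_ifs at hij with h1 h2 h2
    · exact hp.inj _ h1 _ h2 hij
    · exact absurd hij (hxp _ h1)
    · exact absurd hij.symm (hxp _ h2)
    · omega
  · intro i hi j hj
    split_ifs with h1 h2 h2
    · rw [hp.adj _ h1 _ h2]; omega
    · rw [G.adj_comm, hx' _ h1]; omega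
    · rw [hx' _ h2]; omega
    · simp only [SimpleGraph.irrefl, false_iff]; omega
  · ext v
    constructor
    · rintro (rfl | ⟨i, hi, rfl⟩)
      · exact ⟨n + 1, Set.mem_Iio.2 (by omega), by simp⟩
      · rw [Set.mem_Iic] at hi
        exact ⟨i, Set.mem_Iio.2 (by omega), by simp [hi]⟩
    · rintro ⟨i, hi, rfl⟩
      dsimp only
      split_ifs with h
      · exact Or.inr ⟨i, h, rfl⟩
      · exact Or.inl rfl

/-- With `PathSet.insert_mem_inducedCycles`, this lets induced cycles through `x` be counted as
induced paths between two neighbours of `x`. -/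
theorem exists_pathSet_of_mem_inducedCycles {s : Set V} (hs : s ∈ G.inducedCycles) {x : V}
    (hx : x ∈ s) : ∃ a b, a ≠ b ∧ G.PathSet a b (s \ {x}) ∧
      ∀ v ∈ s \ {x}, (G.Adj x v ↔ v = a ∨ v = b) := by
  obtain ⟨n, f, hf, rfl, rfl⟩ := exists_isIndCycle_start hs hx
  have h3 := hf.three_le
  have himg : f '' Set.Iio n \ {f 0} = (fun i => f (i + 1)) '' Set.Iic (n - 2) := by
    ext v
    constructor
    · rintro ⟨⟨i, hi, rfl⟩, hne⟩
      rw [Set.mem_Iio] at hi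
      have hi0 : i ≠ 0 := fun h => hne (by rw [h]; rfl)
      exact ⟨i - 1, Set.mem_Iic.2 (by omega), congrArg f (by omega)⟩
    · rintro ⟨i, hi, rfl⟩
      rw [Set.mem_Iic] at hi
      refine ⟨⟨i + 1, Set.mem_Iio.2 (by omega), rfl⟩, fun h => ?_⟩
      have := hf.inj _ (by omega) _ (by omega) h
      omega
  have hp : G.IsIndPath (n - 2) (fun i => f (i + 1)) := by
    refine ⟨fun i hi j hj hij => ?_, fun i hi j hj => ?_⟩
    · have := hf.inj _ (by omega) _ (by omega) hij
      omega
    · rw [hf.adj _ (by omega) _ (by omega)]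
      omega
  refine ⟨f 1, f (n - 1), fun h => ?_, ?_, ?_⟩
  · have := hf.inj _ (by omega) _ (by omega) h
    omega
  · rw [himg]
    convert hp.pathSet using 2
    omega
  · rintro v ⟨⟨i, hi, rfl⟩, hne⟩
    rw [Set.mem_Iio] at hi
    have hi0 : i ≠ 0 := fun h => hne (by rw [h]; rfl)
    rw [hf.adj _ (by omega) _ hi]
    constructor
    · intro h
      rcases (show i = 1 ∨ i = n - 1 by omega) with rfl | rfl
      exacts [Or.inl rfl, Or.inr rfl]
    · rintro (h | h) <;> have := hf.inj _ (by omega) _ (by omega) h <;> omega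

/-! ### Rerouting an induced path. -/

/-- Removing a connected part whose attachments form a clique keeps a set connected. -/
theorem ConnSet.diff_of_clique {T Z : Set V} (hT : G.ConnSet T) {a : V} (haT : a ∈ T)
    (haZ : a ∉ Z)
    (hcl : ∀ u ∈ T \ Z, ∀ v ∈ T \ Z, ∀ y ∈ Z, ∀ z ∈ Z, G.Adj u y → G.Adj v z → u = v ∨ G.Adj u v) :
    G.ConnSet (T \ Z) := by
  refine connSet_of_base ⟨haT, haZ⟩ fun U haU hU => ?_
  -- If `U` contains one attachment of `Z`, it contains all of them, being equal or adjacent to it,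
  -- so `U ∪ Z` is closed in `T`. If it contains none, `U \ Z` is already closed in `T`.
  by_cases h : ∃ d ∈ U, d ∈ T \ Z ∧ ∃ z ∈ Z, G.Adj d z
  · obtain ⟨d, hdU, hdT, z, hz, hdz⟩ := h
    have := hT.subset_of_closed (U ∪ Z) haT (Or.inl haU) (by
      intro u hu huT v hvT huv
      by_cases hvZ : v ∈ Z
      · exact Or.inr hvZ
      left
      by_cases huZ : u ∈ Z
      · rcases hcl d hdT v ⟨hvT, hvZ⟩ z hz u huZ hdz huv.symm with rfl | h
        · exact hdU
        · exact hU d hdU hdT v ⟨hvT, hvZ⟩ h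
      · exact hU u (hu.resolve_right huZ) ⟨huT, huZ⟩ v ⟨hvT, hvZ⟩ huv)
    exact fun v hv => (this hv.1).resolve_right hv.2
  · have := hT.subset_of_closed (U \ Z) haT ⟨haU, haZ⟩ (by
      intro u hu huT v hvT huv
      have hvZ : v ∉ Z := fun hvZ => h ⟨u, hu.1, ⟨huT, hu.2⟩, v, hvZ, huv⟩
      exact ⟨hU u hu.1 ⟨huT, hu.2⟩ v ⟨hvT, hvZ⟩ huv, hvZ⟩)
    exact fun v hv => (this hv.1).1

/-- If `Y` is a minimal connected set with two nonadjacent neighbours on an induced path, then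
the induced path can be rerouted through `Y`, and in exactly one way. -/
theorem exists_detour [Finite V] {n : ℕ} {p : ℕ → V} (hp : G.IsIndPath n p) {Y : Set V}
    (hpY : ∀ i ≤ n, p i ∉ Y)
    (hY : Minimal (fun Y => G.ConnSet Y ∧ G.Spread (p '' Set.Iic n) Y) Y) :
    ∃ i j, i + 2 ≤ j ∧ j ≤ n ∧
      G.PathSet (p 0) (p n) (p '' Set.Icc 0 i ∪ Y ∪ p '' Set.Icc j n) ∧
      (∃ y ∈ Y, G.Adj (p i) y) ∧ (∃ y ∈ Y, G.Adj (p j) y) ∧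
      (∀ l ≤ n, ∀ y ∈ Y, G.Adj (p l) y → i ≤ l ∧ l ≤ j) ∧
      ∀ T, G.PathSet (p 0) (p n) T → T ⊆ p '' Set.Iic n ∪ Y →
        T = p '' Set.Iic n ∨ T = p '' Set.Icc 0 i ∪ Y ∪ p '' Set.Icc j n := by
  classical
  obtain ⟨⟨hYc, hYs⟩, hmin⟩ := hY
  let N : Finset ℕ := (Finset.range (n + 1)).filter fun l => ∃ y ∈ Y, G.Adj (p l) y
  have hN : ∀ l, l ∈ N ↔ l ≤ n ∧ ∃ y ∈ Y, G.Adj (p l) y := by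
    intro l
    simp [N]
  obtain ⟨_, ⟨i₀, hi₀, rfl⟩, _, ⟨j₀, hj₀, rfl⟩, hne, hnadj, e₁, e₂⟩ := hYs
  rw [Set.mem_Iic] at hi₀ hj₀
  have hi₀N : i₀ ∈ N := (hN _).2 ⟨hi₀, e₁⟩
  have hj₀N : j₀ ∈ N := (hN _).2 ⟨hj₀, e₂⟩
  have hne' : i₀ ≠ j₀ := fun h => hne (by rw [h])
  rw [hp.adj _ hi₀ _ hj₀] at hnadj
  -- The detour leaves the path at its first attachment `i` to `Y` and returns at its last
  -- attachment `j`.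
  set i := N.min' ⟨_, hi₀N⟩
  set j := N.max' ⟨_, hi₀N⟩
  obtain ⟨hin, yi, hyi, hiyi⟩ := (hN i).1 (N.min'_mem _)
  obtain ⟨hjn, yj, hyj, hjyj⟩ := (hN j).1 (N.max'_mem _)
  have hi_le : ∀ l ∈ N, i ≤ l := fun l hl => N.min'_le l hl
  have hle_j : ∀ l ∈ N, l ≤ j := fun l hl => N.le_max' l hl
  have hij : i + 2 ≤ j := by
    have := hi_le _ hi₀N
    have := hi_le _ hj₀N
    have := hle_j _ hi₀N
    have := hle_j _ hj₀N
    omega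
  set R := p '' Set.Icc 0 i ∪ Y ∪ p '' Set.Icc j n with hR
  have hRc : G.ConnSet R := by
    refine ConnSet.union_of_adj (ConnSet.union_of_adj (hp.connSet_Icc (Nat.zero_le i) hin) hYc
      ⟨i, ⟨Nat.zero_le i, le_rfl⟩, rfl⟩ hyi hiyi) (hp.connSet_Icc hjn le_rfl)
      (Or.inr hyj) ⟨j, ⟨le_rfl, hjn⟩, rfl⟩ hjyj.symm
  have key : ∀ T, G.PathSet (p 0) (p n) T → T ⊆ p '' Set.Iic n ∪ Y → T ≠ p '' Set.Iic n →
      R ⊆ T := by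
    intro T hT hTsub hTne
    have hTP : ¬ T ⊆ p '' Set.Iic n := fun h =>
      hTne (hp.pathSet.eq_of_subset hT.left_mem hT.right_mem hT.connSet h)
    have hYT : Y ⊆ T := by
      obtain ⟨t, htT, htP⟩ := Set.not_subset.1 hTP
      have htY : t ∈ Y := (hTsub htT).resolve_left htP
      obtain ⟨Z, hZ, htZ, hZc, hZcl⟩ := exists_component G (s := T ∩ Y) ⟨htT, htY⟩
      -- If `Z` is spread, minimality of `Y` gives `Y ⊆ Z`. If not, its attachments form a clique,
      -- so removing `Z` leaves `T` connected, against the minimality of `T`.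
      by_cases hZs : G.Spread (p '' Set.Iic n) Z
      · exact (hmin ⟨hZc, hZs⟩ fun z hz => (hZ hz).2).trans fun z hz => (hZ hz).1
      · exfalso
        have hatt : ∀ u ∈ T \ Z, ∀ z ∈ Z, G.Adj u z → u ∈ p '' Set.Iic n := by
          intro u hu z hz huz
          refine (hTsub hu.1).resolve_right fun huY => hu.2 (hZcl z hz u ⟨hu.1, huY⟩ huz.symm)
        have h0 : p 0 ∉ Z := fun h => hpY 0 (Nat.zero_le n) (hZ h).2
        have hn : p n ∉ Z := fun h => hpY n le_rfl (hZ h).2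
        have hc : G.ConnSet (T \ Z) := hT.connSet.diff_of_clique hT.left_mem h0
          fun u hu v hv y hy z hz huy hvz =>
            eq_or_adj_of_not_spread hZs (hatt u hu y hy huy) (hatt v hv z hz hvz) hy hz huy hvz
        have := hT.eq_of_subset (Q := T \ Z) ⟨hT.left_mem, h0⟩ ⟨hT.right_mem, hn⟩ hc Set.sdiff_subset
        rw [← this] at htT
        exact htT.2 htZ
    rintro v ((⟨l, hl, rfl⟩ | hv) | ⟨l, hl, rfl⟩)
    -- Without `p l`, where `l ≤ i`, the vertices before `l` are cut off: `Y` has no attachment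
    -- before `i`.
    · by_contra hlT
      rw [Set.mem_Icc] at hl
      have hl0 : l ≠ 0 := fun h => hlT (h ▸ hT.left_mem)
      have := hT.connSet.subset_of_closed (p '' Set.Iio l) hT.left_mem
        ⟨0, Set.mem_Iio.2 (by omega), rfl⟩ (by
          rintro _ ⟨k, hk, rfl⟩ - v hv hkv
          rw [Set.mem_Iio] at hk
          rcases hTsub hv with ⟨k', hk', rfl⟩ | hvY
          · rw [Set.mem_Iic] at hk'
            have h1 := (hp.adj k (by omega) k' hk').1 hkv
            have h2 : k' ≠ l := fun h => hlT (h ▸ hv)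
            exact ⟨k', Set.mem_Iio.2 (by omega), rfl⟩
          · have := hi_le k ((hN k).2 ⟨by omega, v, hvY, hkv⟩)
            omega) hT.right_mem
      obtain ⟨k, hk, hkn⟩ := this
      rw [Set.mem_Iio] at hk
      have := hp.inj k (by omega) n le_rfl hkn
      omega
    · exact hYT hv
    · by_contra hlT
      rw [Set.mem_Icc] at hl
      have hl0 : l ≠ n := fun h => hlT (h ▸ hT.right_mem)
      have := hT.connSet.subset_of_closed (p '' Set.Ioc l n) hT.right_mem
        ⟨n, ⟨by omega, le_rfl⟩, rfl⟩ (by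
          rintro _ ⟨k, hk, rfl⟩ - v hv hkv
          rw [Set.mem_Ioc] at hk
          rcases hTsub hv with ⟨k', hk', rfl⟩ | hvY
          · rw [Set.mem_Iic] at hk'
            have h1 := (hp.adj k (by omega) k' hk').1 hkv
            have h2 : k' ≠ l := fun h => hlT (h ▸ hv)
            exact ⟨k', ⟨by omega, by omega⟩, rfl⟩
          · have := hle_j k ((hN k).2 ⟨by omega, v, hvY, hkv⟩)
            omega) hT.left_mem
      obtain ⟨k, hk, hkn⟩ := this
      rw [Set.mem_Ioc] at hk
      have := hp.inj k (by omega) 0 (by omega) hkn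
      omega
  have hR0 : p 0 ∈ R := Or.inl (Or.inl ⟨0, ⟨le_rfl, Nat.zero_le i⟩, rfl⟩)
  have hRn : p n ∈ R := Or.inr ⟨n, ⟨hjn, le_rfl⟩, rfl⟩
  have hRsub : R ⊆ p '' Set.Iic n ∪ Y := by
    rintro v ((⟨l, hl, rfl⟩ | hv) | ⟨l, hl, rfl⟩)
    exacts [Or.inl ⟨l, hl.2.trans hin, rfl⟩, Or.inr hv, Or.inl ⟨l, hl.2, rfl⟩]
  have hRP : G.PathSet (p 0) (p n) R := by
    obtain ⟨T, hTR, hT⟩ := hRc.exists_pathSet hR0 hRn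
    -- The gap `i + 2 ≤ j` makes `p (i + 1)` a vertex of the old path that is not in `R`. Hence
    -- `key` forces `T = R`, so `R` itself is a minimal connected set.
    have hTne : T ≠ p '' Set.Iic n := by
      intro h
      have : p (i + 1) ∈ R := hTR (h ▸ ⟨i + 1, Set.mem_Iic.2 (by omega), rfl⟩)
      rcases this with (⟨l, hl, h⟩ | h) | ⟨l, hl, h⟩
      · rw [Set.mem_Icc] at hl
        have := hp.inj _ (by omega) _ (by omega) h
        omega
      · exact hpY _ (by omega) h
      · rw [Set.mem_Icc] at hl
        have := hp.inj _ (by omega) _ (by omega) h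
        omega
    rwa [hTR.antisymm (key T hT (hTR.trans hRsub) hTne)] at hT
  refine ⟨i, j, hij, hjn, hRP, ⟨yi, hyi, hiyi⟩, ⟨yj, hyj, hjyj⟩, fun l hl y hy hly => ?_,
    fun T hT hTsub => ?_⟩
  · have := (hN l).2 ⟨hl, y, hy, hly⟩
    exact ⟨hi_le l this, hle_j l this⟩
  · by_cases hTP : T = p '' Set.Iic n
    · exact Or.inl hTP
    · exact Or.inr (hT.eq_of_subset hR0 hRn hRc (key T hT hTsub hTP)).symm

theorem Spread.of_insert {x : V} {P Y : Set V} (hx : ∀ y ∈ Y, ¬ G.Adj x y)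
    (h : G.Spread (insert x P) Y) : G.Spread P Y := by
  obtain ⟨d₁, h₁, d₂, h₂, hne, hadj, ⟨y₁, hy₁, e₁⟩, y₂, hy₂, e₂⟩ := h
  refine ⟨d₁, h₁.resolve_left ?_, d₂, h₂.resolve_left ?_, hne, hadj, ⟨y₁, hy₁, e₁⟩, y₂, hy₂, e₂⟩
  · rintro rfl
    exact hx _ hy₁ e₁
  · rintro rfl
    exact hx _ hy₂ e₂

theorem minimal_spread_insert {x : V} {P Y : Set V} (hx : ∀ y ∈ Y, ¬ G.Adj x y)
    (h : Minimal (fun Y => G.ConnSet Y ∧ G.Spread P Y) Y) :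
    Minimal (fun Y => G.ConnSet Y ∧ G.Spread (insert x P) Y) Y :=
  ⟨⟨h.1.1, h.1.2.mono (Set.subset_insert x P) le_rfl⟩, fun _ hZ hZY =>
    h.2 ⟨hZ.1, hZ.2.of_insert fun y hy => hx y (hZY hy)⟩ hZY⟩

/-! ### The graph of path swaps. -/

/-- `P` and `R` are two paths inside `W` whose union, together with `x`, is a solid, and there are
no further paths in their union. -/
def PathSwap (G : SimpleGraph V) (x a b : V) (W P R : Set V) : Prop :=
  (G.PathSet a b P ∧ P ⊆ W) ∧ (G.PathSet a b R ∧ R ⊆ W) ∧ P ≠ R ∧ insert x (P ∪ R) ∈ G.solids ∧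
    ∀ T, G.PathSet a b T → T ⊆ P ∪ R → T = P ∨ T = R

theorem PathSwap.symm {x a b : V} {W P R : Set V} (h : G.PathSwap x a b W P R) :
    G.PathSwap x a b W R P :=
  ⟨h.2.1, h.1, h.2.2.1.symm, by rw [Set.union_comm]; exact h.2.2.2.1, fun T hT hTs =>
    (h.2.2.2.2 T hT (by rwa [Set.union_comm])).symm⟩

theorem ConnSet.exists_adj_component {Y Y' : Set V} (hY : G.ConnSet Y) (hY' : Y'.Nonempty)
    (hsub : Y' ⊆ Y) {u : V} (hu : u ∈ Y \ Y') :
    ∃ Z ⊆ Y \ Y', u ∈ Z ∧ G.ConnSet Z ∧ ∃ z ∈ Z, ∃ y ∈ Y', G.Adj z y := by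
  obtain ⟨Z, hZ, huZ, hZc, hZcl⟩ := exists_component G hu
  refine ⟨Z, hZ, huZ, hZc, ?_⟩
  by_contra h
  push Not at h
  have := hY.subset_of_closed Z hu.1 huZ fun z hz _ y hy hzy =>
    hZcl z hz y ⟨hy, fun hy' => h z hz y hy' hzy⟩ hzy
  obtain ⟨y, hy⟩ := hY'
  exact (hZ (this (hsub hy))).2 hy

theorem IsIndPath.lt_of_connSet {n : ℕ} {p : ℕ → V} (hp : G.IsIndPath n p) {l : ℕ} (hl : l ≤ n)
    {C : Set V} (hC : G.ConnSet C) (hCsub : C ⊆ p '' Set.Iic n \ {p l}) (h0 : p 0 ∈ C) :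
    C ⊆ p '' Set.Iio l := by
  have hl0 : l ≠ 0 := fun h => (hCsub h0).2 (by rw [h]; rfl)
  refine hC.subset_of_closed _ h0 ⟨0, Set.mem_Iio.2 (by omega), rfl⟩ ?_
  rintro _ ⟨k, hk, rfl⟩ - v hv hkv
  rw [Set.mem_Iio] at hk
  obtain ⟨⟨k', hk', rfl⟩, hne⟩ := hCsub hv
  rw [Set.mem_Iic] at hk'
  have h1 := (hp.adj k (by omega) k' hk').1 hkv
  have h2 : k' ≠ l := fun h => hne (by rw [h]; rfl)
  exact ⟨k', Set.mem_Iio.2 (by omega), rfl⟩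

theorem IsIndPath.gt_of_connSet {n : ℕ} {p : ℕ → V} (hp : G.IsIndPath n p) {l : ℕ} (hl : l ≤ n)
    {C : Set V} (hC : G.ConnSet C) (hCsub : C ⊆ p '' Set.Iic n \ {p l}) (h0 : p n ∈ C) :
    C ⊆ p '' Set.Ioc l n := by
  have hl0 : l ≠ n := fun h => (hCsub h0).2 (by rw [h]; rfl)
  refine hC.subset_of_closed _ h0 ⟨n, ⟨by omega, le_rfl⟩, rfl⟩ ?_
  rintro _ ⟨k, hk, rfl⟩ - v hv hkv
  rw [Set.mem_Ioc] at hk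
  obtain ⟨⟨k', hk', rfl⟩, hne⟩ := hCsub hv
  rw [Set.mem_Iic] at hk'
  have h1 := (hp.adj k (by omega) k' hk').1 hkv
  have h2 : k' ≠ l := fun h => hne (by rw [h]; rfl)
  exact ⟨k', ⟨by omega, hk'⟩, rfl⟩

/-- `Y` joins the two components of the path `P` minus `z`. -/
def Straddle (G : SimpleGraph V) (a b z : V) (P Y : Set V) : Prop :=
  (∃ C ⊆ P \ {z}, a ∈ C ∧ G.ConnSet C ∧ ∃ u ∈ C, ∃ y ∈ Y, G.Adj u y) ∧
    ∃ C ⊆ P \ {z}, b ∈ C ∧ G.ConnSet C ∧ ∃ u ∈ C, ∃ y ∈ Y, G.Adj u y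

/-- Reroute `P` through a minimal spread part `Y'` of `Y`; this is one swap. If the new path still
contains `z`, a component of `Y \ Y'` straddles `z` on the new path and is smaller than `Y`, so the
process ends. -/
theorem exists_path_avoiding [Finite V] {x a b : V} {W : Set V} (hab : a ≠ b) (hxW : x ∉ W)
    (hW : ∀ v ∈ W, (G.Adj x v ↔ v = a ∨ v = b)) {z : V} (k : ℕ) :
    ∀ P Y : Set V, Y.ncard ≤ k → G.PathSet a b P → P ⊆ W → z ∈ P → G.ConnSet Y → Y ⊆ W →
      Disjoint P Y → G.Straddle a b z P Y →
      ∃ P', G.PathSet a b P' ∧ P' ⊆ P ∪ Y ∧ z ∉ P' ∧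
        Relation.ReflTransGen (G.PathSwap x a b W) P P' := by
  induction k with
  | zero =>
    intro P Y hk _ _ _ hYc
    have := hYc.1.ncard_pos
    omega
  | succ k ih =>
    rintro P Y hk hP hPW hzP hYc hYW hdis
      ⟨⟨Ca, hCaP, haCa, hCac, u, huCa, yu, hyu, huyu⟩, Cb, hCbP, hbCb, hCbc, v, hvCb, yv, hyv, hvyv⟩
    obtain ⟨n, p, rfl, rfl, rfl, hp⟩ := hP.exists_isIndPath
    obtain ⟨l, hl, rfl⟩ := hzP
    rw [Set.mem_Iic] at hl
    obtain ⟨i₀, hi₀, rfl⟩ := hp.lt_of_connSet hl hCac hCaP haCa huCa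
    obtain ⟨j₀, hj₀, rfl⟩ := hp.gt_of_connSet hl hCbc hCbP hbCb hvCb
    rw [Set.mem_Iio] at hi₀
    rw [Set.mem_Ioc] at hj₀
    have hpY : ∀ i ≤ n, p i ∉ Y := fun i hi h => Set.disjoint_left.1 hdis ⟨i, hi, rfl⟩ h
    have hxY : ∀ y ∈ Y, ¬ G.Adj x y := by
      intro y hy hxy
      rcases (hW y (hYW hy)).1 hxy with rfl | rfl
      exacts [hpY 0 (by omega) hy, hpY n le_rfl hy]
    have hYs : G.Spread (p '' Set.Iic n) Y := by
      refine ⟨p i₀, ⟨i₀, Set.mem_Iic.2 (by omega), rfl⟩, p j₀, ⟨j₀, Set.mem_Iic.2 (by omega), rfl⟩,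
        fun h => ?_, fun h => ?_, ⟨yu, hyu, huyu⟩, yv, hyv, hvyv⟩
      · have := hp.inj _ (by omega) _ (by omega) h
        omega
      · have := (hp.adj _ (by omega) _ (by omega)).1 h
        omega
    obtain ⟨Y', hY'Y, hY'⟩ := Finite.exists_le_minimal
      (p := fun Y => G.ConnSet Y ∧ G.Spread (p '' Set.Iic n) Y) ⟨hYc, hYs⟩
    have hpY' : ∀ i ≤ n, p i ∉ Y' := fun i hi h => hpY i hi (hY'Y h)
    have hxY' : ∀ y ∈ Y', ¬ G.Adj x y := fun y hy => hxY y (hY'Y hy)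
    obtain ⟨i, j, hij, hjn, hR, ⟨yi, hyi, hiyi⟩, ⟨yj, hyj, hjyj⟩, hbd, huniq⟩ :=
      exists_detour hp hpY' hY'
    set R := p '' Set.Icc 0 i ∪ Y' ∪ p '' Set.Icc j n with hRdef
    have hRsub : R ⊆ p '' Set.Iic n ∪ Y' := by
      rintro v ((⟨l, hl, rfl⟩ | hv) | ⟨l, hl, rfl⟩)
      exacts [Or.inl ⟨l, hl.2.trans (by omega), rfl⟩, Or.inr hv, Or.inl ⟨l, hl.2, rfl⟩]
    have hRW : R ⊆ W := hRsub.trans (Set.union_subset hPW (hY'Y.trans hYW))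
    have hunion : p '' Set.Iic n ∪ R = p '' Set.Iic n ∪ Y' := by
      refine Set.Subset.antisymm (Set.union_subset Set.subset_union_left hRsub)
        (Set.union_subset_union_right _ fun y hy => Or.inl (Or.inr hy))
    have hswap : G.PathSwap x (p 0) (p n) W (p '' Set.Iic n) R := by
      refine ⟨⟨hP, hPW⟩, ⟨hR, hRW⟩, fun h => ?_, ?_, fun T hT hTs => huniq T hT (hunion ▸ hTs)⟩
      · have : yi ∈ p '' Set.Iic n := h ▸ Or.inl (Or.inr hyi)
        obtain ⟨q, hq, hqy⟩ := this
        exact hpY' q hq (hqy ▸ hyi)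
      · rw [hunion, ← Set.insert_union]
        refine solid_of_minimal (hP.insert_mem_inducedCycles hab (fun v hv => hW v (hPW hv))
          fun h => hxW (hPW h)) ?_ (minimal_spread_insert hxY' hY')
        rw [Set.disjoint_left]
        rintro v (rfl | ⟨q, hq, rfl⟩) hv
        exacts [hxW (hYW (hY'Y hv)), hpY' q hq hv]
    by_cases hzR : p l ∈ R
    swap
    · exact ⟨R, hR, hRsub.trans (Set.union_subset_union_right _ hY'Y), hzR, .single hswap⟩
    have hfinish : ∀ Z ⊆ Y \ Y', G.ConnSet Z → G.Straddle (p 0) (p n) (p l) R Z →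
        ∃ P', G.PathSet (p 0) (p n) P' ∧ P' ⊆ p '' Set.Iic n ∪ Y ∧ p l ∉ P' ∧
        Relation.ReflTransGen (G.PathSwap x (p 0) (p n) W) (p '' Set.Iic n) P' := by
      intro Z hZ hZc hstr
      have hcard : Z.ncard < Y.ncard := Set.ncard_lt_ncard
        ⟨fun z hz => (hZ hz).1, fun h => (hZ (h (hY'Y hyi))).2 hyi⟩
      obtain ⟨P', hP', hP's, hzP', hrel⟩ := ih R Z (by omega) hR hRW hzR hZc
        (fun z hz => hYW (hZ hz).1) (by
          rw [Set.disjoint_left]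
          intro v hv hvZ
          rcases hRsub hv with ⟨q, hq, rfl⟩ | h
          exacts [hpY q hq (hZ hvZ).1, (hZ hvZ).2 h]) hstr
      refine ⟨P', hP', hP's.trans ?_, hzP', .head hswap hrel⟩
      exact Set.union_subset (hRsub.trans (Set.union_subset_union_right _ hY'Y))
        fun z hz => Or.inr (hZ hz).1
    have hlij : l ≤ i ∨ j ≤ l := by
      rcases hzR with (⟨q, hq, h⟩ | h) | ⟨q, hq, h⟩
      · have := hp.inj _ (hq.2.trans (by omega)) _ hl h
        have := hq.2
        omega
      · exact absurd h (hpY' l hl)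
      · have := hp.inj _ hq.2 _ hl h
        have := hq.1
        omega
    -- If `l ≤ i`, then `u = p i₀` lies before every attachment of `Y'`, so its neighbour `yu` lies
    -- in `Y \ Y'`. The component of `yu` there touches `Y'`, which now lies on the far side of `p
    -- l`. The other case is symmetric.
    rcases hlij with hli | hjl
    · have hyuY' : yu ∉ Y' := fun h => by
        have := hbd i₀ (by omega) yu h huyu
        omega
      obtain ⟨Z, hZ, hyuZ, hZc, z, hz, y, hy, hzy⟩ :=
        hYc.exists_adj_component hY'.1.1.1 hY'Y ⟨hyu, hyuY'⟩
      refine hfinish Z hZ hZc ⟨⟨p '' Set.Icc 0 (l - 1), ?_, ⟨0, ⟨le_rfl, by omega⟩, rfl⟩,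
        hp.connSet_Icc (by omega) (by omega), p i₀, ⟨i₀, ⟨by omega, by omega⟩, rfl⟩, yu, hyuZ, huyu⟩,
        Y' ∪ p '' Set.Icc j n, ?_, Or.inr ⟨n, ⟨hjn, le_rfl⟩, rfl⟩,
        hY'.1.1.union_of_adj (hp.connSet_Icc hjn le_rfl) hyj ⟨j, ⟨le_rfl, hjn⟩, rfl⟩ hjyj.symm,
        y, Or.inl hy, z, hz, hzy.symm⟩
      · rintro _ ⟨q, hq, rfl⟩
        rw [Set.mem_Icc] at hq
        refine ⟨Or.inl (Or.inl ⟨q, ⟨by omega, by omega⟩, rfl⟩), fun h => ?_⟩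
        have := hp.inj _ (by omega) _ hl h
        omega
      · rintro v (hv | ⟨q, hq, rfl⟩)
        · exact ⟨Or.inl (Or.inr hv), fun h => hpY' l hl (h ▸ hv)⟩
        · rw [Set.mem_Icc] at hq
          refine ⟨Or.inr ⟨q, hq, rfl⟩, fun h => ?_⟩
          have := hp.inj _ (by omega) _ hl h
          omega
    · have hyvY' : yv ∉ Y' := fun h => by
        have := hbd j₀ (by omega) yv h hvyv
        omega
      obtain ⟨Z, hZ, hyvZ, hZc, z, hz, y, hy, hzy⟩ :=
        hYc.exists_adj_component hY'.1.1.1 hY'Y ⟨hyv, hyvY'⟩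
      refine hfinish Z hZ hZc ⟨⟨p '' Set.Icc 0 i ∪ Y', ?_, Or.inl ⟨0, ⟨le_rfl, by omega⟩, rfl⟩,
        (hp.connSet_Icc (by omega) (by omega)).union_of_adj hY'.1.1 ⟨i, ⟨by omega, le_rfl⟩, rfl⟩
        hyi hiyi, y, Or.inr hy, z, hz, hzy.symm⟩,
        p '' Set.Icc (l + 1) n, ?_, ⟨n, ⟨by omega, le_rfl⟩, rfl⟩,
        hp.connSet_Icc (by omega) le_rfl, p j₀, ⟨j₀, ⟨by omega, by omega⟩, rfl⟩, yv, hyvZ, hvyv⟩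
      · rintro v (⟨q, hq, rfl⟩ | hv)
        · rw [Set.mem_Icc] at hq
          refine ⟨Or.inl (Or.inl ⟨q, hq, rfl⟩), fun h => ?_⟩
          have := hp.inj _ (by omega) _ hl h
          omega
        · exact ⟨Or.inl (Or.inr hv), fun h => hpY' l hl (h ▸ hv)⟩
      · rintro _ ⟨q, hq, rfl⟩
        rw [Set.mem_Icc] at hq
        refine ⟨Or.inr ⟨q, ⟨by omega, by omega⟩, rfl⟩, fun h => ?_⟩
        have := hp.inj _ (by omega) _ hl h
        omega

/-- Since `P'` avoids `z`, it has a last vertex on the part of `P` before `z`; its next return to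
`P` is after `z`. The open segment of `P'` in between is the required set. -/
theorem exists_straddle {a b z : V} {P P' : Set V} (hP : G.PathSet a b P) (hP' : G.PathSet a b P')
    (hzP : z ∈ P) (hzP' : z ∉ P') :
    ∃ Y ⊆ P' \ P, G.ConnSet Y ∧ G.Straddle a b z P Y := by
  classical
  obtain ⟨n, p, rfl, rfl, rfl, hp⟩ := hP.exists_isIndPath
  obtain ⟨m, q, hq0, hqm, rfl, hq⟩ := hP'.exists_isIndPath
  obtain ⟨l, hl, rfl⟩ := hzP
  rw [Set.mem_Iic] at hl
  have hq' : ∀ i ≤ m, q i ≠ p l := fun i hi h => hzP' ⟨i, hi, h⟩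
  have hl0 : l ≠ 0 := fun h => hq' 0 (by omega) (by rw [hq0, h])
  have hln : l ≠ n := fun h => hq' m le_rfl (by rw [hqm, h])
  set i := Nat.findGreatest (fun i => q i ∈ p '' Set.Iio l) m with hi
  have hi1 : q i ∈ p '' Set.Iio l := Nat.findGreatest_spec (P := fun i => q i ∈ p '' Set.Iio l)
    (Nat.zero_le m) ⟨0, Set.mem_Iio.2 (by omega), hq0.symm⟩
  have him : i ≤ m := Nat.findGreatest_le m
  have hi2 : ∀ k, i < k → k ≤ m → q k ∉ p '' Set.Iio l := fun k hk hkm =>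
    Nat.findGreatest_is_greatest hk hkm
  obtain ⟨i', hi', hii'⟩ := hi1
  rw [Set.mem_Iio] at hi'
  have him' : i ≠ m := by
    intro h
    rw [h, hqm] at hii'
    have := hp.inj _ (by omega) _ le_rfl hii'
    omega
  have hex : ∃ j, i < j ∧ j ≤ m ∧ q j ∈ p '' Set.Iic n :=
    ⟨m, by omega, le_rfl, n, Set.mem_Iic.2 le_rfl, hqm.symm⟩
  obtain ⟨hij, hjm, j', hj'n, hjj'⟩ := Nat.find_spec hex
  have hjmin : ∀ k < Nat.find hex, _ := fun k hk => Nat.find_min hex hk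
  set j := Nat.find hex
  rw [Set.mem_Iic] at hj'n
  have hlj' : l < j' := by
    have h1 : ¬ j' < l := fun h => hi2 j hij hjm ⟨j', h, hjj'⟩
    have h2 : j' ≠ l := fun h => hq' j hjm (by rw [← hjj', h])
    omega
  -- The segment is not empty: an edge from `q i` to `q j` would be a chord of `P` across `p l`.
  have hij' : i + 1 ≠ j := by
    intro h
    have h1 := (hq.adj i him j hjm).2 (Or.inl h.symm)
    rw [← hii', ← hjj', hp.adj _ (by omega) _ hj'n] at h1
    omega
  refine ⟨q '' Set.Icc (i + 1) (j - 1), ?_, hq.connSet_Icc (by omega) (by omega),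
    ⟨p '' Set.Icc 0 (l - 1), ?_, ⟨0, ⟨le_rfl, by omega⟩, rfl⟩,
      hp.connSet_Icc (by omega) (by omega), q i, ⟨i', ⟨by omega, by omega⟩, hii'⟩,
      q (i + 1), ⟨i + 1, ⟨by omega, by omega⟩, rfl⟩, (hq.adj _ (by omega) _ (by omega)).2 (by omega)⟩,
    p '' Set.Icc (l + 1) n, ?_, ⟨n, ⟨by omega, le_rfl⟩, rfl⟩,
      hp.connSet_Icc (by omega) (by omega), q j, ⟨j', ⟨by omega, by omega⟩, hjj'⟩,
      q (j - 1), ⟨j - 1, ⟨by omega, by omega⟩, rfl⟩, (hq.adj _ (by omega) _ (by omega)).2 (by omega)⟩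
  · rintro _ ⟨k, hk, rfl⟩
    rw [Set.mem_Icc] at hk
    exact ⟨⟨k, Set.mem_Iic.2 (by omega), rfl⟩, fun h =>
      hjmin k (by omega) ⟨by omega, by omega, h⟩⟩
  · rintro _ ⟨k, hk, rfl⟩
    rw [Set.mem_Icc] at hk
    refine ⟨⟨k, Set.mem_Iic.2 (by omega), rfl⟩, fun h => ?_⟩
    have := hp.inj _ (by omega) _ hl h
    omega
  · rintro _ ⟨k, hk, rfl⟩
    rw [Set.mem_Icc] at hk
    refine ⟨⟨k, Set.mem_Iic.2 (by omega), rfl⟩, fun h => ?_⟩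
    have := hp.inj _ (by omega) _ hl h
    omega

/-- Swap `P` to a path `Q` that avoids some `z ∈ P \ P'` and stays inside `U`; then `Q` and `P'`
both live in `U \ {z}`. Swaps are taken in the fixed set `W`, so they survive the shrinking of `U`.
-/
theorem reflTransGen_pathSwap [Finite V] {x a b : V} {W : Set V} (hab : a ≠ b) (hxW : x ∉ W)
    (hW : ∀ v ∈ W, (G.Adj x v ↔ v = a ∨ v = b)) (k : ℕ) :
    ∀ U ⊆ W, U.ncard ≤ k → ∀ P P' : Set V, G.PathSet a b P → P ⊆ U → G.PathSet a b P' → P' ⊆ U →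
      Relation.ReflTransGen (G.PathSwap x a b W) P P' := by
  induction k with
  | zero =>
    intro U _ hk P P' hP hPU
    have := (Set.ncard_pos (s := U)).2 ⟨a, hPU hP.left_mem⟩
    omega
  | succ k ih =>
    intro U hUW hk P P' hP hPU hP' hP'U
    by_cases hsub : P ⊆ P'
    · rw [hP'.eq_of_subset hP.left_mem hP.right_mem hP.connSet hsub]
    obtain ⟨z, hzP, hzP'⟩ := Set.not_subset.1 hsub
    obtain ⟨Y, hY, hYc, hstr⟩ := exists_straddle hP hP' hzP hzP'
    obtain ⟨Q, hQ, hQs, hzQ, hrel⟩ := exists_path_avoiding hab hxW hW Y.ncard P Y le_rfl hP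
      (hPU.trans hUW) hzP hYc (fun y hy => hUW (hP'U (hY hy).1))
      (Set.disjoint_left.2 fun v hv hvY => (hY hvY).2 hv) hstr
    refine hrel.trans (ih (U \ {z}) (Set.sdiff_subset.trans hUW) ?_ Q P' hQ ?_ hP' ?_)
    · rw [Set.ncard_sdiff_singleton_of_mem (hPU hzP)]
      omega
    · exact fun v hv => ⟨(hQs hv).elim (fun h => hPU h) fun h => hP'U (hY h).1,
        fun h => hzQ (h ▸ hv)⟩
    · exact fun v hv => ⟨hP'U hv, fun h => hzP' (h ▸ hv)⟩

/-- There are at least as many solids at `x` with neighbours `a` and `b` as there are induced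
`a`-`b` paths, less one. -/
theorem ncard_pathSet_le [Finite V] {x a b : V} {W : Set V} (hab : a ≠ b) (hxW : x ∉ W)
    (hW : ∀ v ∈ W, (G.Adj x v ↔ v = a ∨ v = b)) :
    {P | G.PathSet a b P ∧ P ⊆ W}.ncard ≤
      {s | s ∈ G.solids ∧ s ⊆ insert x W ∧ x ∈ s ∧ a ∈ s ∧ b ∈ s}.ncard + 1 := by
  set Ps := {P | G.PathSet a b P ∧ P ⊆ W}
  set Ss := {s | s ∈ G.solids ∧ s ⊆ insert x W ∧ x ∈ s ∧ a ∈ s ∧ b ∈ s}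
  rcases Ps.eq_empty_or_nonempty with h | hne
  · rw [h, Set.ncard_empty]
    omega
  let H : SimpleGraph Ps :=
    { Adj := fun P R => G.PathSwap x a b W P R
      symm := ⟨fun P R h => PathSwap.symm h⟩
      loopless := ⟨fun P h => h.2.2.1 rfl⟩ }
  have hconn : H.Connected := by
    have := hne.to_subtype
    refine ⟨fun P R => ?_⟩
    have hrel := reflTransGen_pathSwap hab hxW hW W.ncard W le_rfl le_rfl P R P.2.1 P.2.2 R.2.1
      R.2.2
    have key : ∀ R : Set V, Relation.ReflTransGen (G.PathSwap x a b W) P R →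
        ∀ hR : R ∈ Ps, H.Reachable P ⟨R, hR⟩ := by
      intro R hrel
      induction hrel with
      | refl => exact fun _ => Reachable.refl _
      | tail _ h ih => exact fun hR => (ih h.1).trans (Adj.reachable h)
    exact key R hrel R.2
  -- A connected graph on `N` vertices has at least `N - 1` edges, and each edge will be sent to a
  -- different solid.
  have hcard := hconn.card_vert_le_card_edgeSet_add_one
  rw [Nat.card_coe_set_eq] at hcard
  refine hcard.trans (Nat.add_le_add_right ?_ 1)
  rw [← Nat.card_coe_set_eq]
  let φ : Sym2 Ps → Set V := Sym2.lift ⟨fun P R => insert x ((P : Set V) ∪ R),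
    fun P R => congrArg (insert x) (Set.union_comm _ _)⟩
  have hφ : ∀ e ∈ H.edgeSet, φ e ∈ Ss := by
    intro e
    induction e with | _ P R => ?_
    intro h
    exact ⟨h.2.2.2.1, Set.insert_subset_insert (Set.union_subset P.2.2 R.2.2), Or.inl rfl,
      Or.inr (Or.inl P.2.1.left_mem), Or.inr (Or.inl P.2.1.right_mem)⟩
  refine Nat.card_le_card_of_injective (fun e : H.edgeSet => (⟨φ e, hφ e e.2⟩ : Ss)) ?_
  rintro ⟨e, he⟩ ⟨e', he'⟩ hee'
  induction e with | _ P R => ?_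
  induction e' with | _ P' R' => ?_
  have heq : insert x ((P : Set V) ∪ R) = insert x ((P' : Set V) ∪ R') := congrArg Subtype.val hee'
  -- The union of two swapped paths contains no third path, so the solid determines the unordered
  -- pair.
  have hsub : ∀ T : Ps, (T : Set V) ⊆ P' ∪ R' → (T : Set V) = P ∨ (T : Set V) = R := by
    intro T hT
    refine he.2.2.2.2 T T.2.1 fun v hv => ?_
    have : v ∈ insert x ((P : Set V) ∪ R) := heq ▸ Or.inr (hT hv)
    exact this.resolve_left fun h => hxW (h ▸ T.2.2 hv)
  have hne' : (P' : Set V) ≠ R' := he'.2.2.1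
  have h1 := hsub P' Set.subset_union_left
  have h2 := hsub R' Set.subset_union_right
  simp only [Sym2.eq_iff, Subtype.ext_iff]
  rcases h1 with h1 | h1 <;> rcases h2 with h2 | h2
  · exact absurd (h1.trans h2.symm) hne'
  · exact Or.inl ⟨h1.symm, h2.symm⟩
  · exact Or.inr ⟨h2.symm, h1.symm⟩
  · exact absurd (h1.trans h2.symm) hne'

/-! ### A solid for every triple of neighbours. -/

theorem isIndPath_one {a b : V} (hab : G.Adj a b) :
    G.IsIndPath 1 (fun i => if i = 0 then a else b) := by
  refine ⟨fun i hi j hj hij => ?_, fun i hi j hj => ?_⟩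
  · split_ifs at hij with h1 h2 h2
    · omega
    · exact absurd hij hab.ne
    · exact absurd hij hab.ne'
    · omega
  · split_ifs with h1 h2 h2
    · simp only [SimpleGraph.irrefl, false_iff]; omega
    · simp only [hab, true_iff]; omega
    · simp only [hab.symm, true_iff]; omega
    · simp only [SimpleGraph.irrefl, false_iff]; omega

theorem pathSet_pair {a b : V} (hab : G.Adj a b) : G.PathSet a b {a, b} := by
  have himg : (fun i => if i = 0 then a else b) '' Set.Iic 1 = {a, b} := by
    ext v
    constructor
    · rintro ⟨i, hi, rfl⟩
      dsimp only
      split_ifs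
      exacts [Or.inl rfl, Or.inr rfl]
    · rintro (rfl | rfl)
      exacts [⟨0, Set.mem_Iic.2 (by omega), rfl⟩, ⟨1, Set.mem_Iic.2 (by omega), rfl⟩]
  rw [← himg]
  exact (isIndPath_one hab).pathSet

theorem triangle_mem_inducedCycles {a b c : V} (hab : G.Adj a b) (hac : G.Adj a c)
    (hbc : G.Adj b c) : ({a, b, c} : Set V) ∈ G.inducedCycles := by
  refine (pathSet_pair hbc).insert_mem_inducedCycles hbc.ne ?_ ?_
  · rintro v (rfl | rfl)
    · simp [hab]
    · simp [hac]
  · rintro (rfl | rfl)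
    exacts [hab.ne rfl, hac.ne rfl]

/-- Take a minimal spread part `Y'` of `Y` for the cycle through `x` and `P`. If `c ∈ Y'`,
`solid_of_minimal` gives the solid. Otherwise reroute `P` through `Y'` and replace `Y` by the
component of `Y \ Y'` that contains `c`, which is smaller. -/
theorem exists_solid_of_path [Finite V] {x a b c : V} {W : Set V} (hab : ¬ G.Adj a b)
    (hxW : x ∉ W) (hcW : c ∈ W) (hne : a ≠ b) (hca : c ≠ a) (hcb : c ≠ b)
    (hW : ∀ v ∈ W, (G.Adj x v ↔ v = a ∨ v = b ∨ v = c)) (k : ℕ) :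
    ∀ P Y : Set V, Y.ncard ≤ k → G.PathSet a b P → P ⊆ W \ {c} → G.ConnSet Y → c ∈ Y → Y ⊆ W →
      Disjoint P Y → G.Spread (insert x P) Y →
      ∃ s ∈ G.solids, s ⊆ insert x W ∧ x ∈ s ∧ a ∈ s ∧ b ∈ s ∧ c ∈ s := by
  induction k with
  | zero =>
    intro P Y hk _ _ hYc
    have := hYc.1.ncard_pos
    omega
  | succ k ih =>
    intro P Y hk hP hPW hYc hcY hYW hdis hYs
    obtain ⟨Y', hY'Y, hY'⟩ := Finite.exists_le_minimal
      (p := fun Y => G.ConnSet Y ∧ G.Spread (insert x P) Y) ⟨hYc, hYs⟩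
    have hPx : ∀ v ∈ P, (G.Adj x v ↔ v = a ∨ v = b) := by
      intro v hv
      rw [hW v (hPW hv).1]
      have : v ≠ c := (hPW hv).2
      tauto
    by_cases hcY' : c ∈ Y'
    · refine ⟨insert x P ∪ Y', solid_of_minimal (hP.insert_mem_inducedCycles hne hPx
        fun h => hxW (hPW h).1) ?_ hY', ?_, Or.inl (Or.inl rfl), Or.inl (Or.inr hP.left_mem),
        Or.inl (Or.inr hP.right_mem), Or.inr hcY'⟩
      · rw [Set.disjoint_left]
        rintro v (rfl | hv) hvY
        exacts [hxW (hYW (hY'Y hvY)), Set.disjoint_left.1 hdis hv (hY'Y hvY)]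
      · rw [Set.insert_union]
        exact Set.insert_subset_insert (Set.union_subset (fun v hv => (hPW hv).1)
          (hY'Y.trans hYW))
    · have hxY' : ∀ y ∈ Y', ¬ G.Adj x y := by
        intro y hy hxy
        rcases (hW y (hYW (hY'Y hy))).1 hxy with rfl | rfl | rfl
        exacts [Set.disjoint_left.1 hdis hP.left_mem (hY'Y hy),
          Set.disjoint_left.1 hdis hP.right_mem (hY'Y hy), hcY' hy]
      have hY'P : Minimal (fun Y => G.ConnSet Y ∧ G.Spread P Y) Y' :=
        ⟨⟨hY'.1.1, hY'.1.2.of_insert hxY'⟩, fun Z hZ =>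
          hY'.2 ⟨hZ.1, hZ.2.mono (Set.subset_insert x P) le_rfl⟩⟩
      obtain ⟨Z, hZ, hcZ, hZc, z, hz, y, hy, hzy⟩ :=
        hYc.exists_adj_component hY'.1.1.1 hY'Y ⟨hcY, hcY'⟩
      obtain ⟨n, p, rfl, rfl, rfl, hp⟩ := hP.exists_isIndPath
      obtain ⟨i, j, hij, hjn, hR, -, -, -, -⟩ := exists_detour hp
        (fun i hi h => Set.disjoint_left.1 hdis ⟨i, hi, rfl⟩ (hY'Y h)) hY'P
      set R := p '' Set.Icc 0 i ∪ Y' ∪ p '' Set.Icc j n with hRdef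
      have hRsub : R ⊆ p '' Set.Iic n ∪ Y' := by
        rintro v ((⟨l, hl, rfl⟩ | hv) | ⟨l, hl, rfl⟩)
        exacts [Or.inl ⟨l, hl.2.trans (by omega), rfl⟩, Or.inr hv, Or.inl ⟨l, hl.2, rfl⟩]
      have hcard : Z.ncard < Y.ncard := Set.ncard_lt_ncard
        ⟨fun z hz => (hZ hz).1, fun h => (hZ (h (hY'Y hy))).2 hy⟩
      refine ih R Z (by omega) hR (fun v hv => ?_) hZc hcZ (fun v hv => hYW (hZ hv).1) ?_ ?_
      · rcases hRsub hv with h | h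
        exacts [hPW h, ⟨hYW (hY'Y h), fun h' => hcY' (h' ▸ h)⟩]
      · rw [Set.disjoint_left]
        intro v hv hvZ
        rcases hRsub hv with h | h
        exacts [Set.disjoint_left.1 hdis h (hZ hvZ).1, (hZ hvZ).2 h]
      -- The new set is attached to `x` by way of `c`, and to a vertex `y` of `Y'`, which now lies
      -- on the path and is not adjacent to `x`.
      · exact ⟨x, Or.inl rfl, y, Or.inr (Or.inl (Or.inr hy)),
          fun h => hxW (h ▸ hYW (hY'Y hy)), hxY' y hy,
          ⟨c, hcZ, (hW c hcW).2 (Or.inr (Or.inr rfl))⟩, z, hz, hzy.symm⟩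

/-- On its way from `c` to `b`, the set `C` must leave `Y`, and it can do so only by entering `P`.
-/
theorem exists_adj_path_of_connSet {c b : V} {W P Y C : Set V} {a : V} (hY : Y ⊆ W \ P)
    (hcY : c ∈ Y) (hYcl : ∀ y ∈ Y, ∀ v ∈ W \ P, G.Adj y v → v ∈ Y) (hC : G.ConnSet C)
    (hCW : C ⊆ W \ {a}) (hcC : c ∈ C) (hbC : b ∈ C) (hbP : b ∈ P) :
    ∃ u ∈ P, u ≠ a ∧ u ∈ W ∧ ∃ y ∈ Y, G.Adj u y := by
  by_contra h
  push Not at h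
  have := hC.subset_of_closed Y hcC hcY (by
    intro y hy _ v hv hyv
    by_cases hvP : v ∈ P
    · exact absurd hyv.symm (h v hvP (hCW hv).2 (hCW hv).1 y hy)
    · exact hYcl y hy v ⟨(hCW hv).1, hvP⟩ hyv)
  exact (hY (this hbC)).2 hbP

/-- The component of `c` off an induced path `P` from `a` to `b` has an attachment on `P` other than
`a` and one other than `b`. Either one of these is an inner vertex of `P`, nonadjacent to `x`, or
they are the nonadjacent `a` and `b`; in both cases the component is spread on the cycle. -/
theorem exists_solid_of_not_adj [Finite V] {x a b c : V} {W : Set V} (hab : ¬ G.Adj a b)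
    (hxW : x ∉ W) (hne : a ≠ b) (hca : c ≠ a) (hcb : c ≠ b)
    (hW : ∀ v ∈ W, (G.Adj x v ↔ v = a ∨ v = b ∨ v = c))
    (h₁ : ∃ C ⊆ W \ {c}, G.ConnSet C ∧ a ∈ C ∧ b ∈ C)
    (h₂ : ∃ C ⊆ W \ {b}, G.ConnSet C ∧ a ∈ C ∧ c ∈ C)
    (h₃ : ∃ C ⊆ W \ {a}, G.ConnSet C ∧ b ∈ C ∧ c ∈ C) :
    ∃ s ∈ G.solids, s ⊆ insert x W ∧ x ∈ s ∧ a ∈ s ∧ b ∈ s ∧ c ∈ s := by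
  obtain ⟨C₁, hC₁, hC₁c, haC₁, hbC₁⟩ := h₁
  obtain ⟨C₂, hC₂, hC₂c, haC₂, hcC₂⟩ := h₂
  obtain ⟨C₃, hC₃, hC₃c, hbC₃, hcC₃⟩ := h₃
  obtain ⟨P, hPC, hP⟩ := hC₁c.exists_pathSet haC₁ hbC₁
  have hcW : c ∈ W := (hC₂ hcC₂).1
  obtain ⟨Y, hY, hcY, hYc, hYcl⟩ := exists_component G (s := W \ P) (u := c)
    ⟨hcW, fun h => (hC₁ (hPC h)).2 rfl⟩
  have hcx : G.Adj x c := (hW c hcW).2 (Or.inr (Or.inr rfl))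
  refine exists_solid_of_path hab hxW hcW hne hca hcb hW Y.ncard P Y le_rfl hP (hPC.trans hC₁)
    hYc hcY (fun v hv => (hY hv).1) (Set.disjoint_left.2 fun v hv hvY => (hY hvY).2 hv) ?_
  obtain ⟨u₁, hu₁P, hu₁a, hu₁W, hu₁Y⟩ :=
    exists_adj_path_of_connSet hY hcY hYcl hC₃c hC₃ hcC₃ hbC₃ hP.right_mem
  obtain ⟨u₂, hu₂P, hu₂b, hu₂W, hu₂Y⟩ :=
    exists_adj_path_of_connSet hY hcY hYcl hC₂c hC₂ hcC₂ haC₂ hP.left_mem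
  have key : ∀ u ∈ P, u ≠ a → u ≠ b → u ∈ W → (∃ y ∈ Y, G.Adj u y) → G.Spread (insert x P) Y := by
    intro u huP hua hub huW huY
    refine ⟨x, Or.inl rfl, u, Or.inr huP, fun h => hxW (h ▸ huW), fun h => ?_, ⟨c, hcY, hcx⟩, huY⟩
    rcases (hW u huW).1 h with h | h | h
    exacts [hua h, hub h, (hC₁ (hPC huP)).2 h]
  by_cases h1 : u₁ = b
  · by_cases h2 : u₂ = a
    · subst h1 h2
      exact ⟨u₂, Or.inr hu₂P, u₁, Or.inr hu₁P, hne, hab, hu₂Y, hu₁Y⟩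
    · exact key u₂ hu₂P h2 hu₂b hu₂W hu₂Y
  · exact key u₁ hu₁P hu₁a h1 hu₁W hu₁Y

/-- Three neighbours of `x` that are pairwise joined by connected sets avoiding the third lie
together with `x` in a solid. -/
theorem exists_solid_of_triple [Finite V] {x a b c : V} {W : Set V}
    (hxW : x ∉ W) (hab : a ≠ b) (hac : a ≠ c) (hbc : b ≠ c)
    (hW : ∀ v ∈ W, (G.Adj x v ↔ v = a ∨ v = b ∨ v = c))
    (h₁ : ∃ C ⊆ W \ {c}, G.ConnSet C ∧ a ∈ C ∧ b ∈ C)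
    (h₂ : ∃ C ⊆ W \ {b}, G.ConnSet C ∧ a ∈ C ∧ c ∈ C)
    (h₃ : ∃ C ⊆ W \ {a}, G.ConnSet C ∧ b ∈ C ∧ c ∈ C) :
    ∃ s ∈ G.solids, s ⊆ insert x W ∧ x ∈ s ∧ a ∈ s ∧ b ∈ s ∧ c ∈ s := by
  by_cases e₁ : G.Adj a b
  swap
  · exact exists_solid_of_not_adj e₁ hxW hab hac.symm hbc.symm hW h₁ h₂ h₃
  by_cases e₂ : G.Adj a c
  swap
  · obtain ⟨s, hs, hsW, hx, ha, hc, hb⟩ := exists_solid_of_not_adj e₂ hxW hac hab.symm hbc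
      (fun v hv => (hW v hv).trans (by tauto)) h₂ h₁
      (by obtain ⟨C, h, h', h2, h3⟩ := h₃; exact ⟨C, h, h', h3, h2⟩)
    exact ⟨s, hs, hsW, hx, ha, hb, hc⟩
  by_cases e₃ : G.Adj b c
  swap
  · obtain ⟨s, hs, hsW, hx, hb, hc, ha⟩ := exists_solid_of_not_adj e₃ hxW hbc hab hac
      (fun v hv => (hW v hv).trans (by tauto)) h₃
      (by obtain ⟨C, h, h', h2, h3⟩ := h₁; exact ⟨C, h, h', h3, h2⟩)
      (by obtain ⟨C, h, h', h2, h3⟩ := h₂; exact ⟨C, h, h', h3, h2⟩)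
    exact ⟨s, hs, hsW, hx, ha, hb, hc⟩
  have haW : a ∈ W := by obtain ⟨C, h, h', h2, h3⟩ := h₁; exact (h h2).1
  have hbW : b ∈ W := by obtain ⟨C, h, h', h2, h3⟩ := h₁; exact (h h3).1
  have hcW : c ∈ W := by obtain ⟨C, h, h', h2, h3⟩ := h₂; exact (h h3).1
  have hsub : ({a, b, c} : Set V) ⊆ W := by
    rintro v (rfl | rfl | rfl)
    exacts [haW, hbW, hcW]
  -- If the three neighbours are pairwise adjacent, they form with `x` a complete graph on four
  -- vertices, which is a pyramid.
  refine ⟨insert x {a, b, c}, mem_solids_of_pyramid (a := a) (b := b) (c := c)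
    (triangle_mem_inducedCycles e₁ e₂ e₃)
    (fun h => hxW (hsub h)) (by simp) (by simp) (by simp) hab hac hbc
    ((hW a haW).2 (by simp)) ((hW b hbW).2 (by simp)) ((hW c hcW).2 (by simp)),
    Set.insert_subset_insert hsub, by simp, by simp, by simp, by simp⟩

/-! ### Avoidable vertices. -/

/-- `x` is avoidable in `A`: any two neighbours of `x` in `A` are joined by a connected set in `A`
whose other vertices lie outside the closed neighbourhood of `x`. -/
def Avoidable (G : SimpleGraph V) (A : Set V) (x : V) : Prop :=
  ∀ a ∈ A, ∀ b ∈ A, G.Adj x a → G.Adj x b → a ≠ b →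
    ∃ C, G.ConnSet C ∧ a ∈ C ∧ b ∈ C ∧ C ⊆ A ∧ x ∉ C ∧ ∀ v ∈ C, G.Adj x v → v = a ∨ v = b

/-- Among all vertices `v` and all components of `A` minus the closed neighbourhood of `v`, pick a
smallest component `K`, and in it a vertex `x` of least degree in `A`. Two nonadjacent neighbours of
`x` then both attach to the component `W` of `v` outside the closed neighbourhood of `x`, and are
joined through it. -/
theorem exists_avoidable [Finite V] {A : Set V} (hA : A.Nonempty) : ∃ x ∈ A, G.Avoidable A x := by
  classical
  by_cases hcl : ∀ u ∈ A, ∀ v ∈ A, u ≠ v → G.Adj u v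
  · obtain ⟨x, hx⟩ := hA
    refine ⟨x, hx, fun a ha b hb hxa hxb hab => ⟨{a, b}, (pathSet_pair (hcl a ha b hb hab)).connSet,
      by simp, by simp, ?_, ?_, by simp⟩⟩
    · rintro v (rfl | rfl)
      exacts [ha, hb]
    · rintro (rfl | rfl)
      exacts [hxa.ne rfl, hxb.ne rfl]
  push Not at hcl
  obtain ⟨v₀, hv₀, w₀, hw₀, hne₀, hnadj₀⟩ := hcl
  let IsComp : V → Set V → Prop := fun v K => v ∈ A ∧ K ⊆ {u | u ∈ A ∧ u ≠ v ∧ ¬ G.Adj v u} ∧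
    G.ConnSet K ∧ ∀ k ∈ K, ∀ u ∈ {u | u ∈ A ∧ u ≠ v ∧ ¬ G.Adj v u}, G.Adj k u → u ∈ K
  have hex : ∃ m, ∃ v K, IsComp v K ∧ K.ncard = m := by
    obtain ⟨K, hK, -, hKc, hKcl⟩ := exists_component G
      (s := {u | u ∈ A ∧ u ≠ v₀ ∧ ¬ G.Adj v₀ u}) (u := w₀) ⟨hw₀, hne₀.symm, hnadj₀⟩
    exact ⟨_, v₀, K, ⟨hv₀, hK, hKc, hKcl⟩, rfl⟩
  obtain ⟨v, K, ⟨hv, hK, hKc, hKcl⟩, hKcard⟩ := Nat.find_spec hex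
  have hKmin : ∀ v' K', IsComp v' K' → K.ncard ≤ K'.ncard := fun v' K' h => by
    rw [hKcard]
    exact Nat.find_min' hex ⟨v', K', h, rfl⟩
  obtain ⟨x, hxK, hxmin⟩ := Set.exists_min_image K (fun x => {u | u ∈ A ∧ G.Adj x u}.ncard)
    K.toFinite hKc.1
  have hx := hK hxK
  refine ⟨x, hx.1, fun a ha b hb hxa hxb hab => ?_⟩
  by_cases hadj : G.Adj a b
  · refine ⟨{a, b}, (pathSet_pair hadj).connSet, by simp, by simp, ?_, ?_, by simp⟩
    · rintro v (rfl | rfl)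
      exacts [ha, hb]
    · rintro (rfl | rfl)
      exacts [hxa.ne rfl, hxb.ne rfl]
  obtain ⟨W, hW, hvW, hWc, hWcl⟩ := exists_component G
    (s := {u | u ∈ A ∧ u ≠ x ∧ ¬ G.Adj x u}) (u := v)
    ⟨hv, fun h => hx.2.1 h.symm, fun h => hx.2.2 h.symm⟩
  have key : ∀ a b, a ∈ A → b ∈ A → G.Adj x a → G.Adj x b → a ≠ b → ¬ G.Adj a b →
      ∃ w ∈ W, G.Adj w a := by
    intro a b ha hb hxa hxb hab hadj
    by_cases hva : G.Adj v a
    · exact ⟨v, hvW, hva⟩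
    have haK : a ∈ K := hKcl x hxK a ⟨ha, fun h => hx.2.2 (h ▸ hxa.symm), hva⟩ hxa
    have hu : ∃ u ∈ A, u ≠ x ∧ ¬ G.Adj x u ∧ G.Adj a u := by
      by_contra hcon
      push Not at hcon
      -- If every neighbour of `a` were in the closed neighbourhood of `x`, then `a`, which lies in
      -- `K` and misses `b`, would have smaller degree than `x`.
      have hsub : {u | u ∈ A ∧ G.Adj a u} ⊆ insert x ({u | u ∈ A ∧ G.Adj x u} \ {a, b}) := by
        rintro u ⟨huA, hau⟩
        by_cases hux : u = x
        · exact Or.inl hux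
        right
        refine ⟨⟨huA, by_contra fun h => hcon u huA hux h hau⟩, ?_⟩
        rintro (rfl | rfl)
        exacts [hau.ne rfl, hadj hau]
      have h1 := hxmin a haK
      have h2 := Set.ncard_le_ncard hsub
      have h3 := Set.ncard_insert_le x ({u | u ∈ A ∧ G.Adj x u} \ {a, b})
      have hab' : ({a, b} : Set V) ⊆ {u | u ∈ A ∧ G.Adj x u} := by
        rintro u (rfl | rfl)
        exacts [⟨ha, hxa⟩, ⟨hb, hxb⟩]
      have h4 := Set.ncard_sdiff_add_ncard_of_subset hab'
      rw [Set.ncard_pair hab] at h4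
      omega
    obtain ⟨u, huA, hux, hxu, hau⟩ := hu
    refine ⟨u, ?_, hau.symm⟩
    -- A component outside the closed neighbourhood of `x` that misses the closed neighbourhood of
    -- `v` would lie in `K \ {x}`, against the choice of `K`.
    have hmeet : ∀ K₂ : Set V, K₂ ⊆ {u | u ∈ A ∧ u ≠ x ∧ ¬ G.Adj x u} → G.ConnSet K₂ → u ∈ K₂ →
        (∀ k ∈ K₂, ∀ w ∈ {u | u ∈ A ∧ u ≠ x ∧ ¬ G.Adj x u}, G.Adj k w → w ∈ K₂) →
        ∃ w ∈ K₂, w = v ∨ G.Adj v w := by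
      intro K₂ hK₂ hK₂c huK₂ hK₂cl
      by_contra hcon
      push Not at hcon
      have huK : u ∈ K := hKcl a haK u ⟨huA, (hcon u huK₂).1, (hcon u huK₂).2⟩ hau
      have hsub : K₂ ⊆ K := hK₂c.subset_of_closed K huK₂ huK fun y hy _ z hz hyz =>
        hKcl y hy z ⟨(hK₂ hz).1, (hcon z hz).1, (hcon z hz).2⟩ hyz
      have h1 := hKmin x K₂ ⟨hx.1, hK₂, hK₂c, hK₂cl⟩
      have h2 : K₂.ncard < K.ncard := Set.ncard_lt_ncard ⟨hsub, fun h => (hK₂ (h hxK)).2.1 rfl⟩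
      omega
    obtain ⟨K₂, hK₂, huK₂, hK₂c, hK₂cl⟩ := exists_component G
      (s := {u | u ∈ A ∧ u ≠ x ∧ ¬ G.Adj x u}) (u := u) ⟨huA, hux, hxu⟩
    obtain ⟨w, hw, hwv⟩ := hmeet K₂ hK₂ hK₂c huK₂ hK₂cl
    have hwW : w ∈ W := by
      rcases hwv with rfl | h
      exacts [hvW, hWcl v hvW w (hK₂ hw) h]
    exact hK₂c.subset_of_closed W hw hwW (fun y hy _ z hz hyz => hWcl y hy z (hK₂ hz) hyz) huK₂
  obtain ⟨wa, hwa, hwa'⟩ := key a b ha hb hxa hxb hab hadj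
  obtain ⟨wb, hwb, hwb'⟩ := key b a hb ha hxb hxa hab.symm fun h => hadj h.symm
  refine ⟨insert b (insert a W), (hWc.insert_adj hwa hwa').insert_adj (Or.inr hwb) hwb',
    by simp, by simp, Set.insert_subset hb (Set.insert_subset ha fun u hu => (hW hu).1), ?_, ?_⟩
  · rintro (rfl | rfl | h)
    exacts [hxb.ne rfl, hxa.ne rfl, (hW h).2.1 rfl]
  · rintro u (rfl | rfl | h) hxu
    exacts [Or.inr rfl, Or.inl rfl, absurd hxu (hW h).2.2]

theorem ConnSet.exists_adj_of_ne {A : Set V} (hA : G.ConnSet A) {x y : V} (hx : x ∈ A) (hy : y ∈ A)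
    (hxy : x ≠ y) : ∃ a ∈ A, G.Adj x a := by
  by_contra h
  push Not at h
  have := hA.subset_of_closed {x} hx rfl (by
    rintro u rfl _ v hv huv
    exact absurd huv (h v hv))
  exact hxy (this hy).symm

/-- Any passage through `x` can be replaced, because its neighbours are joined to each other inside
`A` without `x`. -/
theorem Avoidable.connSet_diff {A : Set V} {x : V} (hx : G.Avoidable A x) (hA : G.ConnSet A)
    (hxA : x ∈ A) {y : V} (hy : y ∈ A) (hxy : x ≠ y) : G.ConnSet (A \ {x}) := by
  obtain ⟨a, ha, hxa⟩ := hA.exists_adj_of_ne hxA hy hxy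
  refine connSet_of_base ⟨ha, hxa.ne'⟩ fun U haU hU => ?_
  have hN : ∀ b ∈ A, G.Adj x b → b ∈ U := by
    intro b hb hxb
    by_cases hab : a = b
    · exact hab ▸ haU
    obtain ⟨C, hC, haC, hbC, hCA, hxC, -⟩ := hx a ha b hb hxa hxb hab
    have hmem : ∀ u ∈ C, u ∈ A \ {x} := fun u hu => ⟨hCA hu, fun h => hxC (h ▸ hu)⟩
    exact hC.subset_of_closed U haC haU
      (fun u hu huC v hv huv => hU u hu (hmem u huC) v (hmem v hv) huv) hbC
  have := hA.subset_of_closed (insert x U) ha (Or.inr haU) (by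
    rintro u (rfl | hu) huA v hv huv
    · exact Or.inr (hN v hv huv)
    · by_cases hvx : v = x
      · exact Or.inl hvx
      · by_cases hux : u = x
        · exact Or.inr (hN v hv (hux ▸ huv))
        · exact Or.inr (hU u hu ⟨huA, hux⟩ v ⟨hv, hvx⟩ huv))
  exact fun v hv => (this hv.1).resolve_left hv.2

/-! ### Colourings, and the induction on avoidable vertices. -/

/-- `G` has a proper colouring of the vertices in `A` with the colours `0, …, k - 1`. -/
def ColorableOn (G : SimpleGraph V) (A : Set V) (k : ℕ) : Prop :=
  ∃ c : V → ℕ, (∀ v ∈ A, c v < k) ∧ ∀ u ∈ A, ∀ v ∈ A, G.Adj u v → c u ≠ c v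

theorem ColorableOn.chromaticNumber_le {k : ℕ} (h : G.ColorableOn Set.univ k) :
    G.chromaticNumber ≤ k := by
  obtain ⟨c, hc, hcol⟩ := h
  refine Colorable.chromaticNumber_le ⟨Coloring.mk (fun v => (⟨c v, hc v trivial⟩ : Fin k)) ?_⟩
  intro u v huv h
  exact hcol u trivial v trivial huv (congrArg Fin.val h)

theorem ColorableOn.succ {A : Set V} {x : V} {k : ℕ} (h : G.ColorableOn (A \ {x}) k) :
    G.ColorableOn A (k + 1) := by
  classical
  obtain ⟨c, hc, hcol⟩ := h
  refine ⟨fun v => if v = x then k else c v, fun v hv => ?_, fun u hu v hv huv => ?_⟩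
  · dsimp only
    split_ifs with h
    · omega
    · have := hc v ⟨hv, h⟩
      omega
  · dsimp only
    split_ifs with h1 h2 h2
    · exact absurd huv (by rw [h1, h2]; exact G.loopless.irrefl x)
    · exact (hc v ⟨hv, h2⟩).ne'
    · exact (hc u ⟨hu, h1⟩).ne
    · exact hcol u ⟨hu, h1⟩ v ⟨hv, h2⟩ huv

theorem ColorableOn.of_degree_lt [Finite V] {A : Set V} {x : V} {k : ℕ}
    (h : G.ColorableOn (A \ {x}) k) (hd : {u | u ∈ A ∧ G.Adj x u}.ncard < k) :
    G.ColorableOn A k := by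
  classical
  obtain ⟨c, hc, hcol⟩ := h
  obtain ⟨i, hi, hiN⟩ : ∃ i ∈ Set.Iio k, i ∉ c '' {u | u ∈ A ∧ G.Adj x u} := by
    refine Set.exists_mem_notMem_of_ncard_lt_ncard ?_
    rw [Set.ncard_Iio_nat]
    exact (Set.ncard_image_le).trans_lt hd
  refine ⟨fun v => if v = x then i else c v, fun v hv => ?_, fun u hu v hv huv => ?_⟩
  · dsimp only
    split_ifs with h
    · exact hi
    · exact hc v ⟨hv, h⟩
  · dsimp only
    split_ifs with h1 h2 h2
    · exact absurd huv (by rw [h1, h2]; exact G.loopless.irrefl x)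
    · exact fun h => hiN ⟨v, ⟨hv, h1 ▸ huv⟩, h.symm⟩
    · exact fun h => hiN ⟨u, ⟨hu, h2 ▸ huv.symm⟩, h⟩
    · exact hcol u ⟨hu, h1⟩ v ⟨hv, h2⟩ huv

theorem colorableOn_singleton (x : V) {k : ℕ} (hk : k ≠ 0) : G.ColorableOn {x} k := by
  refine ⟨fun _ => 0, fun _ _ => Nat.pos_of_ne_zero hk, ?_⟩
  rintro u rfl v rfl huv
  exact absurd huv (G.loopless.irrefl _)

/-- A set function that grows sufficiently when an avoidable vertex is added is bounded below in
terms of the chromatic number. -/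
theorem choose_le_of_avoidable [Finite V] (b : Set V → ℤ) (r : ℕ)
    (hstep : ∀ (A : Set V) (x : V), x ∈ A → G.Avoidable A x →
      1 ≤ {u | u ∈ A ∧ G.Adj x u}.ncard →
      b (A \ {x}) + (({u | u ∈ A ∧ G.Adj x u}.ncard - 1).choose r : ℕ) ≤ b A)
    (hone : ∀ x, 0 ≤ b {x}) (n : ℕ) :
    ∀ A : Set V, A.ncard ≤ n → G.ConnSet A → ∀ k, ¬ G.ColorableOn A k →
      (k.choose (r + 1) : ℤ) ≤ b A := by
  induction n with
  | zero =>
    intro A hA hAc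
    have := hAc.1.ncard_pos
    omega
  | succ n ih =>
    intro A hA hAc k hk
    obtain ⟨x, hxA, hx⟩ := G.exists_avoidable hAc.1
    by_cases hy : ∃ y ∈ A, x ≠ y
    · obtain ⟨y, hyA, hxy⟩ := hy
      have hc := hx.connSet_diff hAc hxA hyA hxy
      obtain ⟨a, ha, hxa⟩ := hAc.exists_adj_of_ne hxA hyA hxy
      have hd : 1 ≤ {u | u ∈ A ∧ G.Adj x u}.ncard := by
        rw [Nat.one_le_iff_ne_zero, ← Nat.pos_iff_ne_zero, Set.ncard_pos]
        exact ⟨a, ha, hxa⟩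
      have hcard : (A \ {x}).ncard ≤ n := by
        rw [Set.ncard_sdiff_singleton_of_mem hxA]
        omega
      have h1 := hstep A x hxA hx hd
      -- With degree below `k`, a `k`-colouring would extend to `x`, so `A \ {x}` is still not
      -- `k`-colourable.
      by_cases hdk : {u | u ∈ A ∧ G.Adj x u}.ncard < k
      · have h2 := ih _ hcard hc k fun h => hk (h.of_degree_lt hdk)
        have h3 : (0 : ℤ) ≤ (({u | u ∈ A ∧ G.Adj x u}.ncard - 1).choose r : ℕ) := by positivity
        linarith
      · rcases k with _ | k
        · have h2 := ih _ hcard hc 0 (by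
            rintro ⟨c, hc0, -⟩
            obtain ⟨v, hv⟩ := hc.1
            exact absurd (hc0 v hv) (by omega))
          have h3 : (0 : ℤ) ≤ (({u | u ∈ A ∧ G.Adj x u}.ncard - 1).choose r : ℕ) := by positivity
          linarith
        -- Here `k + 1` colours do not suffice and the degree is at least `k + 1`. One colour is
        -- lost, and Pascal's rule matches the gain `k.choose r`.
        · have h2 := ih _ hcard hc k fun h => hk h.succ
          have h3 : k.choose r ≤ ({u | u ∈ A ∧ G.Adj x u}.ncard - 1).choose r :=
            Nat.choose_le_choose r (by omega)
          rw [Nat.choose_succ_succ]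
          push_cast
          have h4 : (k.choose r : ℤ) ≤ (({u | u ∈ A ∧ G.Adj x u}.ncard - 1).choose r : ℕ) := by
            exact_mod_cast h3
          linarith
    · push Not at hy
      obtain rfl : A = {x} := Set.eq_singleton_iff_unique_mem.2 ⟨hxA, fun y hy' => (hy y hy').symm⟩
      obtain rfl : k = 0 := by
        by_contra hk0
        exact hk (colorableOn_singleton x hk0)
      simpa using hone x

/-! ### Edges, cycles and solids at an avoidable vertex. -/

/-- The edges inside `A`. -/
def edgesIn (G : SimpleGraph V) (A : Set V) : Set (Sym2 V) := {e | e ∈ G.edgeSet ∧ ∀ v ∈ e, v ∈ A}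

theorem ncard_edgesIn [Finite V] {A : Set V} {x : V} (hx : x ∈ A) :
    (G.edgesIn A).ncard = (G.edgesIn (A \ {x})).ncard + {u | u ∈ A ∧ G.Adj x u}.ncard := by
  have himg : ((fun u => s(x, u)) '' {u | u ∈ A ∧ G.Adj x u}).ncard =
      {u | u ∈ A ∧ G.Adj x u}.ncard :=
    Set.ncard_image_of_injective _ fun u v h => Sym2.congr_right.1 h
  rw [← himg, ← Set.ncard_union_eq]
  · congr 1
    ext e
    induction e with | _ u v => ?_
    simp only [edgesIn, Set.mem_ofPred_eq, Sym2.mem_iff, forall_eq_or_imp, forall_eq, mem_edgeSet,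
      Set.mem_union, Set.mem_sdiff, Set.mem_singleton_iff, Set.mem_image, Sym2.eq_iff]
    constructor
    · rintro ⟨huv, hu, hv⟩
      by_cases hux : u = x
      · subst hux
        exact Or.inr ⟨v, ⟨hv, huv⟩, by simp⟩
      · by_cases hvx : v = x
        · subst hvx
          exact Or.inr ⟨u, ⟨hu, huv.symm⟩, by simp⟩
        · exact Or.inl ⟨huv, ⟨hu, hux⟩, hv, hvx⟩
    · rintro (⟨huv, ⟨hu, -⟩, hv, -⟩ | ⟨w, ⟨hw, hxw⟩, ⟨rfl, rfl⟩ | ⟨rfl, rfl⟩⟩)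
      exacts [⟨huv, hu, hv⟩, ⟨hxw, hx, hw⟩, ⟨hxw.symm, hw, hx⟩]
  · rw [Set.disjoint_left]
    rintro e he ⟨u, hu, rfl⟩
    exact (he.2 x (by simp)).2 rfl

theorem ncard_sets_in [Finite V] (F : Set (Set V)) (A : Set V) (x : V) :
    {s | s ∈ F ∧ s ⊆ A}.ncard =
      {s | s ∈ F ∧ s ⊆ A \ {x}}.ncard + {s | s ∈ F ∧ s ⊆ A ∧ x ∈ s}.ncard := by
  rw [← Set.ncard_union_eq]
  · congr 1
    ext s
    simp only [Set.mem_ofPred_eq, Set.mem_union]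
    constructor
    · rintro ⟨h1, h2⟩
      by_cases hx : x ∈ s
      · exact Or.inr ⟨h1, h2, hx⟩
      · exact Or.inl ⟨h1, fun v hv => ⟨h2 hv, fun h => hx (h ▸ hv)⟩⟩
    · rintro (⟨h1, h2⟩ | ⟨h1, h2, -⟩)
      exacts [⟨h1, fun v hv => (h2 hv).1⟩, ⟨h1, h2⟩]
  · rw [Set.disjoint_left]
    rintro s hs hs'
    exact (hs.2 hs'.2.2).2 rfl

theorem Avoidable.exists_inducedCycle [Finite V] {A : Set V} {x : V} (hx : G.Avoidable A x)
    (hxA : x ∈ A) {a b : V} (ha : a ∈ A) (hb : b ∈ A) (hxa : G.Adj x a) (hxb : G.Adj x b)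
    (hab : a ≠ b) : ∃ s ∈ G.inducedCycles, s ⊆ A ∧ x ∈ s ∧ a ∈ s ∧ b ∈ s ∧
      ∀ v ∈ s, G.Adj x v → v = a ∨ v = b := by
  obtain ⟨C, hC, haC, hbC, hCA, hxC, hCx⟩ := hx a ha b hb hxa hxb hab
  obtain ⟨P, hPC, hP⟩ := hC.exists_pathSet haC hbC
  refine ⟨insert x P, hP.insert_mem_inducedCycles hab (fun v hv => ⟨hCx v (hPC hv), ?_⟩)
    (fun h => hxC (hPC h)), Set.insert_subset hxA (hPC.trans hCA), Or.inl rfl, Or.inr hP.left_mem,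
    Or.inr hP.right_mem, ?_⟩
  · rintro (rfl | rfl)
    exacts [hxa, hxb]
  · rintro v (rfl | hv) hxv
    exacts [absurd hxv (G.loopless.irrefl _), hCx v (hPC hv) hxv]

/-- Every pair of neighbours is the trace on the neighbourhood of `x` of some induced cycle through
`x`. -/
theorem Avoidable.choose_two_le [Finite V] {A : Set V} {x : V} (hx : G.Avoidable A x)
    (hxA : x ∈ A) : {u | u ∈ A ∧ G.Adj x u}.ncard.choose 2 ≤
      {s | s ∈ G.inducedCycles ∧ s ⊆ A ∧ x ∈ s}.ncard := by
  classical
  have := Fintype.ofFinite V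
  set N := {u | u ∈ A ∧ G.Adj x u}
  set F := {s | s ∈ G.inducedCycles ∧ s ⊆ A ∧ x ∈ s}
  rw [Set.ncard_eq_toFinset_card' N, Set.ncard_eq_toFinset_card' F, ← Finset.card_powersetCard]
  refine Finset.card_le_card_of_surjOn (fun s => N.toFinset.filter (· ∈ s)) ?_
  intro t ht
  rw [Finset.mem_coe, Finset.mem_powersetCard, Finset.card_eq_two] at ht
  obtain ⟨htN, a, b, hab, rfl⟩ := ht
  have ha : a ∈ N := by simpa using htN (by simp : a ∈ ({a, b} : Finset V))
  have hb : b ∈ N := by simpa using htN (by simp : b ∈ ({a, b} : Finset V))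
  obtain ⟨s, hs, hsA, hxs, has, hbs, hsx⟩ :=
    hx.exists_inducedCycle hxA ha.1 hb.1 ha.2 hb.2 hab
  refine ⟨s, Set.mem_toFinset.2 ⟨hs, hsA, hxs⟩, ?_⟩
  ext v
  simp only [Finset.mem_filter, Set.mem_toFinset, Finset.mem_insert, Finset.mem_singleton]
  constructor
  · rintro ⟨hv, hvs⟩
    exact hsx v hvs hv.2
  · rintro (rfl | rfl)
    exacts [⟨ha, has⟩, ⟨hb, hbs⟩]

/-- Sort by the trace `φ` on the neighbourhood of `x`. The trace of a cycle is a pair, and over each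
pair there is at most one more cycle than there are solids; over each triple there is at least one
solid. Summing over all pairs and triples gives the inequality. -/
theorem Avoidable.choose_three_add_le [Finite V] {A : Set V} {x : V} (hx : G.Avoidable A x)
    (hxA : x ∈ A) : {u | u ∈ A ∧ G.Adj x u}.ncard.choose 3 +
        {s | s ∈ G.inducedCycles ∧ s ⊆ A ∧ x ∈ s}.ncard ≤
      {s | s ∈ G.solids ∧ s ⊆ A ∧ x ∈ s}.ncard + {u | u ∈ A ∧ G.Adj x u}.ncard.choose 2 := by
  classical
  have := Fintype.ofFinite V
  set N := {u | u ∈ A ∧ G.Adj x u} with hN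
  set F := {s | s ∈ G.inducedCycles ∧ s ⊆ A ∧ x ∈ s} with hF
  set S := {s | s ∈ G.solids ∧ s ⊆ A ∧ x ∈ s} with hS
  let φ : Set V → Finset V := fun s => N.toFinset.filter (· ∈ s)
  have hφ : ∀ s v, v ∈ φ s ↔ v ∈ N ∧ v ∈ s := fun s v => by simp [φ]
  rw [Set.ncard_eq_toFinset_card' N, Set.ncard_eq_toFinset_card' F, Set.ncard_eq_toFinset_card' S,
    ← Finset.card_powersetCard, ← Finset.card_powersetCard]
  set T₂ := N.toFinset.powersetCard 2
  set T₃ := N.toFinset.powersetCard 3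
  have hpair : ∀ t ∈ T₂, ∃ a b, a ≠ b ∧ t = {a, b} ∧ a ∈ N ∧ b ∈ N := by
    intro t ht
    rw [Finset.mem_powersetCard, Finset.card_eq_two] at ht
    obtain ⟨htN, a, b, hab, rfl⟩ := ht
    exact ⟨a, b, hab, rfl, by simpa using htN (by simp : a ∈ ({a, b} : Finset V)),
      by simpa using htN (by simp : b ∈ ({a, b} : Finset V))⟩
  have hcyc : F.toFinset.card = ∑ t ∈ T₂, (F.toFinset.filter (φ · = t)).card := by
    refine Finset.card_eq_sum_card_fiberwise fun s hs => ?_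
    have hs' : s ∈ F := by simpa using hs
    obtain ⟨a, b, hab, hP, hxs⟩ := exists_pathSet_of_mem_inducedCycles hs'.1 hs'.2.2
    rw [Finset.mem_coe, Finset.mem_powersetCard]
    refine ⟨Finset.filter_subset _ _, Finset.card_eq_two.2 ⟨a, b, hab, ?_⟩⟩
    ext v
    rw [hφ, Finset.mem_insert, Finset.mem_singleton]
    constructor
    · rintro ⟨hvN, hvs⟩
      exact (hxs v ⟨hvs, hvN.2.ne'⟩).1 hvN.2
    · intro h
      have hv : v ∈ s \ {x} := by
        rcases h with rfl | rfl
        exacts [hP.left_mem, hP.right_mem]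
      exact ⟨⟨hs'.2.1 hv.1, (hxs v hv).2 h⟩, hv.1⟩
  have hfib₂ : ∀ t ∈ T₂, (F.toFinset.filter (φ · = t)).card ≤
      (S.toFinset.filter (φ · = t)).card + 1 := by
    intro t ht
    obtain ⟨a, b, hab, rfl, ha, hb⟩ := hpair t ht
    -- In this `W` the only neighbours of `x` are `a` and `b`, so a solid inside `insert x W` that
    -- contains both has trace exactly `{a, b}`.
    have hW := ncard_pathSet_le (G := G) (x := x) (a := a) (b := b)
      (W := {v | v ∈ A ∧ v ≠ x ∧ (G.Adj x v → v = a ∨ v = b)}) hab (fun h => h.2.1 rfl) (by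
        rintro v ⟨-, -, h⟩
        refine ⟨h, ?_⟩
        rintro (rfl | rfl)
        exacts [ha.2, hb.2])
    rw [Set.ncard_eq_toFinset_card', Set.ncard_eq_toFinset_card'] at hW
    refine le_trans ?_ (hW.trans (Nat.add_le_add_right (Finset.card_le_card ?_) 1))
    · refine Finset.card_le_card_of_injOn (fun s => s \ {x}) ?_ ?_
      · intro s hs
        simp only [Finset.coe_filter, Set.mem_toFinset, Set.mem_ofPred_eq] at hs
        obtain ⟨hsF, hst⟩ := hs
        obtain ⟨a', b', hab', hP, hxs⟩ := exists_pathSet_of_mem_inducedCycles hsF.1 hsF.2.2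
        simp only [Set.coe_toFinset, Set.mem_ofPred_eq]
        have hst' : ∀ v, v ∈ φ s ↔ v = a ∨ v = b := fun v => by rw [hst]; simp
        have ha' : a' = a ∨ a' = b := (hst' a').1 ((hφ s a').2
          ⟨⟨hsF.2.1 hP.left_mem.1, (hxs a' hP.left_mem).2 (Or.inl rfl)⟩, hP.left_mem.1⟩)
        have hb' : b' = a ∨ b' = b := (hst' b').1 ((hφ s b').2
          ⟨⟨hsF.2.1 hP.right_mem.1, (hxs b' hP.right_mem).2 (Or.inr rfl)⟩, hP.right_mem.1⟩)
        refine ⟨?_, fun v hv => ⟨hsF.2.1 hv.1, hv.2, fun hxv => (hst' v).1 ((hφ s v).2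
          ⟨⟨hsF.2.1 hv.1, hxv⟩, hv.1⟩)⟩⟩
        rcases ha' with rfl | rfl <;> rcases hb' with rfl | rfl
        exacts [absurd rfl hab', hP, hP.symm, absurd rfl hab']
      · intro s hs s' hs' hss'
        simp only [Finset.coe_filter, Set.mem_toFinset, Set.mem_ofPred_eq] at hs hs'
        have h1 := Set.insert_sdiff_self_of_mem hs.1.2.2
        have h2 := Set.insert_sdiff_self_of_mem hs'.1.2.2
        dsimp only at hss'
        rw [← h1, ← h2, hss']
    · intro s hs
      simp only [Set.mem_toFinset, Set.mem_ofPred_eq] at hs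
      obtain ⟨hsol, hsW, hxs, has, hbs⟩ := hs
      simp only [Finset.mem_filter, Set.mem_toFinset]
      refine ⟨⟨hsol, fun v hv => ?_, hxs⟩, ?_⟩
      · rcases hsW hv with rfl | h
        exacts [hxA, h.1]
      · ext v
        rw [hφ, Finset.mem_insert, Finset.mem_singleton]
        constructor
        · rintro ⟨hvN, hvs⟩
          exact ((hsW hvs).resolve_left hvN.2.ne').2.2 hvN.2
        · rintro (rfl | rfl)
          exacts [⟨ha, has⟩, ⟨hb, hbs⟩]
  have hfib₃ : ∀ t ∈ T₃, 1 ≤ (S.toFinset.filter (φ · = t)).card := by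
    intro t ht
    rw [Finset.mem_powersetCard, Finset.card_eq_three] at ht
    obtain ⟨htN, a, b, c, hab, hac, hbc, rfl⟩ := ht
    have ha : a ∈ N := by simpa using htN (by simp : a ∈ ({a, b, c} : Finset V))
    have hb : b ∈ N := by simpa using htN (by simp : b ∈ ({a, b, c} : Finset V))
    have hc : c ∈ N := by simpa using htN (by simp : c ∈ ({a, b, c} : Finset V))
    have hjoin : ∀ a b c, a ∈ N → b ∈ N → a ≠ b → a ≠ c → b ≠ c → c ∈ N →
        ∃ C ⊆ {v | v ∈ A ∧ v ≠ x ∧ (G.Adj x v → v = a ∨ v = b)} \ {c},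
          G.ConnSet C ∧ a ∈ C ∧ b ∈ C := by
      intro a b c ha hb hab hac hbc hc
      obtain ⟨C, hC, haC, hbC, hCA, hxC, hCx⟩ := hx a ha.1 b hb.1 ha.2 hb.2 hab
      refine ⟨C, fun v hv => ⟨⟨hCA hv, fun h => hxC (h ▸ hv), hCx v hv⟩, ?_⟩, hC, haC, hbC⟩
      rintro rfl
      rcases hCx v hv hc.2 with h | h
      exacts [hac h.symm, hbc h.symm]
    have hmono : ∀ (a b : V) (d : Fin 3 → V), (∀ v, v = a ∨ v = b → v = d 0 ∨ v = d 1 ∨ v = d 2) → ∀ c : V,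
        {v | v ∈ A ∧ v ≠ x ∧ (G.Adj x v → v = a ∨ v = b)} \ {c} ⊆
        {v | v ∈ A ∧ v ≠ x ∧ (G.Adj x v → v = d 0 ∨ v = d 1 ∨ v = d 2)} \ {c} :=
      fun a b d h c v hv => ⟨⟨hv.1.1, hv.1.2.1, fun hxv => h v (hv.1.2.2 hxv)⟩, hv.2⟩
    have h₁ := hjoin a b c ha hb hab hac hbc hc
    have h₂ := hjoin a c b ha hc hac hab hbc.symm hb
    have h₃ := hjoin b c a hb hc hbc hab.symm hac.symm ha
    obtain ⟨s, hs, hsW, hxs, has, hbs, hcs⟩ := exists_solid_of_triple (G := G) (x := x) (a := a)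
      (b := b) (c := c) (W := {v | v ∈ A ∧ v ≠ x ∧ (G.Adj x v → v = a ∨ v = b ∨ v = c)})
      (fun h => h.2.1 rfl) hab hac hbc (by
        rintro v ⟨-, -, h⟩
        refine ⟨h, ?_⟩
        rintro (rfl | rfl | rfl)
        exacts [ha.2, hb.2, hc.2])
      (h₁.imp fun C h => ⟨h.1.trans (hmono a b ![a, b, c] (by simp) c), h.2⟩)
      (h₂.imp fun C h => ⟨h.1.trans (hmono a c ![a, b, c] (by simp) b), h.2⟩)
      (h₃.imp fun C h => ⟨h.1.trans (hmono b c ![a, b, c] (by simp) a), h.2⟩)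
    refine Finset.card_pos.2 ⟨s, ?_⟩
    simp only [Finset.mem_filter, Set.mem_toFinset]
    refine ⟨⟨hs, fun v hv => ?_, hxs⟩, ?_⟩
    · rcases hsW hv with rfl | h
      exacts [hxA, h.1]
    · ext v
      rw [hφ, Finset.mem_insert, Finset.mem_insert, Finset.mem_singleton]
      constructor
      · rintro ⟨hvN, hvs⟩
        exact ((hsW hvs).resolve_left hvN.2.ne').2.2 hvN.2
      · rintro (rfl | rfl | rfl)
        exacts [⟨ha, has⟩, ⟨hb, hbs⟩, ⟨hc, hcs⟩]
  have hdisj : Disjoint T₂ T₃ := by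
    rw [Finset.disjoint_left]
    intro t h2 h3
    rw [Finset.mem_powersetCard] at h2 h3
    omega
  have hsol : ∑ t ∈ T₂ ∪ T₃, (S.toFinset.filter (φ · = t)).card ≤ S.toFinset.card :=
    (Finset.sum_card_fiberwise_eq_card_filter _ _ _).trans_le (Finset.card_filter_le _ _)
  rw [Finset.sum_union hdisj] at hsol
  have h3 : T₃.card ≤ ∑ t ∈ T₃, (S.toFinset.filter (φ · = t)).card := by
    simpa using Finset.sum_le_sum hfib₃
  have h2 := Finset.sum_le_sum hfib₂
  rw [← hcyc, Finset.sum_add_distrib, Finset.sum_const, smul_eq_mul, mul_one] at h2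
  omega

/-! ### Lower bounds for the three characteristics. -/

theorem edgesIn_singleton (x : V) : G.edgesIn {x} = ∅ := by
  rw [Set.eq_empty_iff_forall_notMem]
  intro e
  induction e with | _ u v => ?_
  rintro ⟨he, hv⟩
  have h1 : u = x := hv u (by simp)
  have h2 : v = x := hv v (by simp)
  exact ((mem_edgeSet G).1 he).ne (h1.trans h2.symm)

theorem not_subset_singleton_of_mem_inducedCycles {s : Set V} (hs : s ∈ G.inducedCycles) (x : V) :
    ¬ s ⊆ {x} := by
  obtain ⟨n, f, hf, rfl⟩ := mem_inducedCycles_iff.1 hs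
  have h3 := hf.three_le
  intro h
  have h0 : f 0 = x := h ⟨0, Set.mem_Iio.2 (by omega), rfl⟩
  have h1 : f 1 = x := h ⟨1, Set.mem_Iio.2 (by omega), rfl⟩
  have := hf.inj 0 (by omega) 1 (by omega) (h0.trans h1.symm)
  omega

theorem ncard_eq_ncard_diff_add_one [Finite V] {A : Set V} {x : V} (hx : x ∈ A) :
    (A.ncard : ℤ) = (A \ {x}).ncard + 1 := by
  exact_mod_cast (Set.ncard_sdiff_singleton_add_one hx).symm

/-- Here and in the next two bounds, the final `1` makes the characteristic vanish on a single
vertex, as the induction in `choose_le_of_avoidable` requires. -/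
theorem choose_le_beth1 [Finite V] {A : Set V} (hA : G.ConnSet A) {k : ℕ}
    (hk : ¬ G.ColorableOn A k) :
    (k.choose 2 : ℤ) ≤ (G.edgesIn A).ncard - A.ncard + 1 := by
  refine choose_le_of_avoidable (G := G) (fun A => (G.edgesIn A).ncard - A.ncard + 1) 1
    (fun A x hxA _ hd => ?_) (fun x => by simp) A.ncard A le_rfl hA k hk
  have h1 := ncard_eq_ncard_diff_add_one hxA
  have h2 := ncard_edgesIn (G := G) hxA
  rw [Nat.choose_one_right]
  zify [hd] at h2 ⊢
  linarith

theorem choose_le_beth2 [Finite V] {A : Set V} (hA : G.ConnSet A) {k : ℕ}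
    (hk : ¬ G.ColorableOn A k) :
    (k.choose 3 : ℤ) ≤
      {s | s ∈ G.inducedCycles ∧ s ⊆ A}.ncard - (G.edgesIn A).ncard + A.ncard - 1 := by
  refine choose_le_of_avoidable (G := G) (fun A =>
    {s | s ∈ G.inducedCycles ∧ s ⊆ A}.ncard - (G.edgesIn A).ncard + A.ncard - 1) 2
    (fun A x hxA hx hd => ?_) (fun x => by simp [edgesIn_singleton]) A.ncard A le_rfl hA k hk
  have h1 := ncard_eq_ncard_diff_add_one hxA
  have h2 := ncard_edgesIn (G := G) hxA
  have h3 := ncard_sets_in G.inducedCycles A x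
  have h4 := hx.choose_two_le hxA
  obtain ⟨d, hd'⟩ := Nat.exists_eq_add_of_le' hd
  rw [hd'] at h2 h4 ⊢
  -- The degree is `d + 1`, and at least `(d + 1).choose 2` cycles are lost together with `d + 1`
  -- edges and one vertex: a net loss of at least `(d + 1).choose 2 - d = d.choose 2`.
  rw [Nat.choose_succ_succ, Nat.choose_one_right] at h4
  simp only [Nat.add_sub_cancel]
  zify at h2 h3 h4
  linarith

theorem choose_le_beth3 [Finite V] {A : Set V} (hA : G.ConnSet A) {k : ℕ}
    (hk : ¬ G.ColorableOn A k) :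
    (k.choose 4 : ℤ) ≤ {s | s ∈ G.solids ∧ s ⊆ A}.ncard -
      {s | s ∈ G.inducedCycles ∧ s ⊆ A}.ncard + (G.edgesIn A).ncard - A.ncard + 1 := by
  refine choose_le_of_avoidable (G := G) (fun A => {s | s ∈ G.solids ∧ s ⊆ A}.ncard -
    {s | s ∈ G.inducedCycles ∧ s ⊆ A}.ncard + (G.edgesIn A).ncard - A.ncard + 1) 3
    (fun A x hxA hx hd => ?_) (fun x => ?_) A.ncard A le_rfl hA k hk
  · have h1 := ncard_eq_ncard_diff_add_one hxA
    have h2 := ncard_edgesIn (G := G) hxA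
    have h3 := ncard_sets_in G.inducedCycles A x
    have h4 := ncard_sets_in G.solids A x
    have h5 := hx.choose_three_add_le hxA
    obtain ⟨d, hd'⟩ := Nat.exists_eq_add_of_le' hd
    rw [hd'] at h2 h5 ⊢
    -- With degree `d + 1`, the net loss is at least `(d + 1).choose 3 - (d + 1).choose 2 + d =
    -- d.choose 3`.
    rw [Nat.choose_succ_succ, Nat.choose_succ_succ, Nat.choose_one_right] at h5
    simp only [Nat.add_sub_cancel]
    zify at h2 h3 h4 h5
    linarith
  · have h1 : {s | s ∈ G.inducedCycles ∧ s ⊆ {x}} = ∅ :=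
      Set.eq_empty_iff_forall_notMem.2 fun s hs =>
        not_subset_singleton_of_mem_inducedCycles hs.1 x hs.2
    rw [h1]
    simp [edgesIn_singleton]

/-! ### Complete graphs, and the comparison for Hadwiger number at least four. -/

theorem ncard_of_clique_of_mem_inducedCycles {s : Set V} (hs : s ∈ G.inducedCycles)
    (hcl : ∀ u ∈ s, ∀ v ∈ s, u ≠ v → G.Adj u v) : s.ncard = 3 := by
  obtain ⟨n, f, hf, rfl⟩ := mem_inducedCycles_iff.1 hs
  have h3 := hf.three_le
  have h02 : f 0 ≠ f 2 := fun h => by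
    have := hf.inj 0 (by omega) 2 (by omega) h
    omega
  have := (hf.adj 0 (by omega) 2 (by omega)).1 (hcl _ ⟨0, Set.mem_Iio.2 (by omega), rfl⟩ _
    ⟨2, Set.mem_Iio.2 (by omega), rfl⟩ h02)
  have hinj : Set.InjOn f (Set.Iio n) := fun i hi j hj hij => hf.inj i hi j hj hij
  rw [hinj.ncard_image, Set.ncard_Iio_nat]
  omega

/-- A complete pyramid is a triangle with an apex, and a complete stamp has no inner path vertices.
Trihedra and prisms are never complete: the ends of a trihedron are nonadjacent, and so are `a 0`
and `b 1` in a prism. -/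
theorem IsSolidGraph.card_eq_four_of_clique [Finite V] (hG : G.IsSolidGraph)
    (hcl : ∀ u v, u ≠ v → G.Adj u v) : Nat.card V = 4 := by
  rcases hG with ⟨w, hw, -⟩ | ⟨x, y, p, hxy, hp, -, htop⟩ | ⟨a, x, p, ha, hp, hd, htop⟩ |
    ⟨a, b, p, -, -, hab, -, hd, htop⟩
  · have h1 := ncard_of_clique_of_mem_inducedCycles (s := {w}ᶜ) hw fun u _ v _ => hcl u v
    have h2 := Set.ncard_add_ncard_compl ({w} : Set V)
    rw [h1, Set.ncard_singleton] at h2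
    exact h2.symm
  · exfalso
    have hadj : (⊤ : G.Subgraph).Adj x y := hcl x y hxy
    rw [← htop, Subgraph.iSup_adj] at hadj
    obtain ⟨i, hi⟩ := hadj
    rw [Walk.toSubgraph_adj_iff] at hi
    obtain ⟨k, hk, hkl⟩ := hi
    obtain ⟨hpath, hlen⟩ := hp i
    rw [Sym2.eq_iff] at hk
    rcases hk with ⟨h1, h2⟩ | ⟨h1, h2⟩
    · rw [hpath.getVert_eq_start_iff hkl.le] at h1
      rw [hpath.getVert_eq_end_iff (by omega)] at h2
      omega
    · rw [hpath.getVert_eq_end_iff hkl.le] at h1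
      omega
  · have hax : ∀ i, a i ≠ x := by
      intro i h
      obtain ⟨hpath, hlen⟩ := hp i
      have h1 := (hpath.getVert_eq_end_iff (i := 0) (by omega)).1 (by simpa using h)
      omega
    have hmem : ∀ v, v = x ∨ ∃ i, v = a i := by
      intro v
      by_contra hv
      push Not at hv
      have hvt : v ∈ (⊤ : G.Subgraph).verts := trivial
      rw [← htop, Subgraph.verts_sup, Subgraph.verts_iSup, Set.mem_union, Set.mem_iUnion] at hvt
      rcases hvt with ⟨i, rfl⟩ | ⟨i, hi⟩
      · exact hv.2 i rfl
      rw [Walk.mem_verts_toSubgraph] at hi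
      -- An inner vertex `v` of the path `i` cannot be adjacent to the triangle vertex `a (i + 1)`;
      -- the sum is cyclic in `Fin 3`.
      have hij : i ≠ i + 1 := by fin_cases i <;> simp
      have hadj : (⊤ : G.Subgraph).Adj v (a (i + 1)) := hcl _ _ (hv.2 (i + 1))
      rw [← htop, Subgraph.sup_adj, Subgraph.iSup_adj] at hadj
      rcases hadj with ⟨⟨j, hj⟩, -⟩ | ⟨k, hk⟩
      · exact hv.2 j hj.symm
      · have h1 := (Walk.mem_verts_toSubgraph _).1 hk.fst_mem
        have h2 := (Walk.mem_verts_toSubgraph _).1 hk.snd_mem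
        by_cases hki : k = i
        · subst hki
          exact hax (k + 1) (hd k (k + 1) hij _ h2 (Walk.start_mem_support _))
        · exact hv.1 (hd k i hki v h1 hi)
    have hinj : ∀ i j, i ≠ j → a i ≠ a j := fun i j hij => (ha i j hij).ne
    have huniv : (Set.univ : Set V) = {x, a 0, a 1, a 2} := by
      refine (Set.eq_univ_of_forall fun v => ?_).symm
      rcases hmem v with rfl | ⟨i, rfl⟩
      · simp
      · fin_cases i <;> simp
    rw [← Set.ncard_univ, huniv, Set.ncard_insert_of_notMem, Set.ncard_eq_three.2
      ⟨a 0, a 1, a 2, hinj 0 1 (by decide), hinj 0 2 (by decide), hinj 1 2 (by decide), rfl⟩]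
    rintro (h | h | h)
    exacts [hax 0 h.symm, hax 1 h.symm, hax 2 h.symm]
  · exfalso
    have hadj : (⊤ : G.Subgraph).Adj (a 0) (b 1) := hcl _ _ (hab 0 1)
    rw [← htop, Subgraph.sup_adj, Subgraph.sup_adj, Subgraph.iSup_adj] at hadj
    rcases hadj with (⟨-, ⟨j, hj⟩, -⟩ | ⟨⟨j, hj⟩, -⟩) | ⟨k, hk⟩
    · exact hab j 1 hj
    · exact hab 0 j hj.symm
    · have h1 := (Walk.mem_verts_toSubgraph _).1 hk.fst_mem
      have h2 := (Walk.mem_verts_toSubgraph _).1 hk.snd_mem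
      by_cases hk0 : k = 0
      · subst hk0
        exact hd 0 1 (by decide) _ h2 (Walk.end_mem_support _)
      · exact hd k 0 hk0 _ h1 (Walk.start_mem_support _)

theorem ncard_setOf_ncard_eq (h k : ℕ) : {s : Set (Fin h) | s.ncard = k}.ncard = h.choose k := by
  have : {s : Set (Fin h) | s.ncard = k} =
      (fun t : Finset (Fin h) => (t : Set (Fin h))) '' ↑(Finset.univ.powersetCard k :
        Finset (Finset (Fin h))) := by
    ext s
    constructor
    · intro hs
      refine ⟨s.toFinite.toFinset, ?_, by simp⟩
      rw [Finset.mem_coe, Finset.mem_powersetCard]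
      exact ⟨Finset.subset_univ _, by rw [← Set.ncard_eq_toFinset_card]; exact hs⟩
    · rintro ⟨t, ht, rfl⟩
      rw [Finset.mem_coe, Finset.mem_powersetCard] at ht
      rw [Set.mem_ofPred_eq, Set.ncard_coe_finset, ht.2]
  rw [this, Set.ncard_image_of_injective _ Finset.coe_injective, Set.ncard_coe_finset,
    Finset.card_powersetCard, Finset.card_univ, Fintype.card_fin]

theorem ncard_edgeSet_completeGraph (h : ℕ) :
    (completeGraph (Fin h)).edgeSet.ncard = h.choose 2 := by
  classical
  have := card_edgeFinset_top_eq_card_choose_two (V := Fin h)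
  rw [Fintype.card_fin] at this
  rw [← this, ← coe_edgeFinset, Set.ncard_coe_finset]

theorem ncard_inducedCycles_completeGraph (h : ℕ) :
    (completeGraph (Fin h)).inducedCycles.ncard = h.choose 3 := by
  rw [← ncard_setOf_ncard_eq]
  congr 1
  ext s
  constructor
  · exact fun hs => ncard_of_clique_of_mem_inducedCycles hs fun u _ v _ huv => huv
  · intro hs
    obtain ⟨a, b, c, hab, hac, hbc, rfl⟩ := Set.ncard_eq_three.1 hs
    exact triangle_mem_inducedCycles hab hac hbc

/-- An upper bound is enough, since solids enter `beth3` with a positive sign and the complete graph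
has to be on the smaller side. -/
theorem ncard_solids_completeGraph_le (h : ℕ) :
    (completeGraph (Fin h)).solids.ncard ≤ h.choose 4 := by
  rw [← ncard_setOf_ncard_eq]
  refine Set.ncard_le_ncard fun s hs => ?_
  have := IsSolidGraph.card_eq_four_of_clique (G := (completeGraph (Fin h)).induce s) hs
    fun u v huv h => huv (Subtype.ext h)
  rwa [Nat.card_coe_set_eq] at this

theorem choose_sub_choose (h : ℕ) (hh : 1 ≤ h) :
    (h.choose 2 : ℤ) - h + 1 = (h - 1).choose 2 ∧
    (h.choose 3 : ℤ) - h.choose 2 + h - 1 = (h - 1).choose 3 ∧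
    (h.choose 4 : ℤ) - h.choose 3 + h.choose 2 - h + 1 = (h - 1).choose 4 := by
  obtain ⟨n, rfl⟩ := Nat.exists_eq_add_of_le' hh
  simp only [Nat.choose_succ_succ, Nat.add_sub_cancel, Nat.choose_one_right]
  push_cast
  refine ⟨?_, ?_, ?_⟩ <;> ring

/-- A connected graph with one of the characteristics of a complete graph on `h ≥ 4` vertices is
`h`-colourable. -/
theorem colorableOn_of_beth_eq [Finite V] (hG : G.Connected) {h : ℕ} (hh : 4 ≤ h)
    (heq : (completeGraph (Fin h)).beth1 = G.beth1 ∨ (completeGraph (Fin h)).beth2 = G.beth2 ∨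
      (completeGraph (Fin h)).beth3 = G.beth3) : G.ColorableOn Set.univ h := by
  by_contra hcol
  have hconn : G.ConnSet Set.univ := by
    refine connSet_iff_connected.2 ?_
    exact (induceUnivIso G).connected_iff.2 hG
  have h1 := choose_le_beth1 hconn hcol
  have h2 := choose_le_beth2 hconn hcol
  have h3 := choose_le_beth3 hconn hcol
  have hE : G.edgesIn Set.univ = G.edgeSet := by simp [edgesIn]
  have hC : {s | s ∈ G.inducedCycles ∧ s ⊆ Set.univ} = G.inducedCycles := by simp
  have hS : {s | s ∈ G.solids ∧ s ⊆ Set.univ} = G.solids := by simp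
  rw [hE, Set.ncard_univ] at h1
  rw [hE, hC, Set.ncard_univ] at h2
  rw [hE, hC, hS, Set.ncard_univ] at h3
  have hs := ncard_solids_completeGraph_le h
  obtain ⟨c1, c2, c3⟩ := choose_sub_choose h (by omega)
  unfold beth1 beth2 beth3 at heq
  rw [ncard_edgeSet_completeGraph, ncard_inducedCycles_completeGraph, Nat.card_fin] at heq
  -- The difference is `(h - 1).choose r`, which is positive for all `r ≤ 3` because `h ≥ 4`.
  have hlt : ∀ r, 1 ≤ r → r ≤ 3 → (h - 1).choose (r + 1) < h.choose (r + 1) := by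
    intro r hr hr3
    obtain ⟨n, rfl⟩ := Nat.exists_eq_add_of_le' (show 1 ≤ h by omega)
    rw [Nat.add_sub_cancel, Nat.choose_succ_succ']
    have := Nat.choose_pos (show r ≤ n by omega)
    omega
  have l1 := hlt 1 le_rfl (by omega)
  have l2 := hlt 2 (by omega) (by omega)
  have l3 := hlt 3 (by omega) le_rfl
  zify at l1 l2 l3 hs
  norm_num at l1 l2 l3
  rcases heq with heq | heq | heq <;> linarith

/-! ### Hadwiger number at most three. -/

theorem le_hadwigerNumber [Finite V] {t : ℕ} (B : Fin t → Set V) (hB : ∀ i, G.ConnSet (B i))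
    (hdis : ∀ i j, i < j → Disjoint (B i) (B j))
    (hadj : ∀ i j, i < j → ∃ x ∈ B i, ∃ y ∈ B j, G.Adj x y) : t ≤ G.hadwigerNumber := by
  refine le_csSup ⟨Nat.card V, ?_⟩ ⟨B, fun i => connSet_iff_connected.1 (hB i), ?_, ?_⟩
  · rintro s ⟨B, hB, hdis, -⟩
    choose f hf using fun i => (connSet_iff_connected.2 (hB i)).1
    have hf' : Function.Injective f := by
      intro i j hij
      by_contra hne
      exact Set.disjoint_left.1 (hdis i j hne) (hf i) (hij ▸ hf j)
    simpa using Nat.card_le_card_of_injective f hf'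
  · intro i j hij
    rcases lt_or_gt_of_ne hij with h | h
    exacts [hdis i j h, (hdis j i h).symm]
  · intro i j hij
    rcases lt_or_gt_of_ne hij.ne with h | h
    · exact hadj i j h
    · obtain ⟨x, hx, y, hy, hxy⟩ := hadj j i h
      exact ⟨y, hy, x, hx, hxy.symm⟩

theorem exists_min_degree_of_not_colorableOn [Finite V] {k : ℕ} (n : ℕ) :
    ∀ A : Set V, A.ncard ≤ n → ¬ G.ColorableOn A k →
      ∃ s ⊆ A, s.Nonempty ∧ ∀ x ∈ s, k ≤ {u | u ∈ s ∧ G.Adj x u}.ncard := by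
  have hempty : G.ColorableOn ∅ k := ⟨fun _ => 0, by simp, by simp⟩
  induction n with
  | zero =>
    intro A hA hcol
    have : A = ∅ := by rwa [← Set.ncard_eq_zero, ← Nat.le_zero]
    exact absurd hempty (this ▸ hcol)
  | succ n ih =>
    intro A hA hcol
    by_cases hx : ∃ x ∈ A, {u | u ∈ A ∧ G.Adj x u}.ncard < k
    · obtain ⟨x, hxA, hx⟩ := hx
      obtain ⟨s, hs, h⟩ := ih (A \ {x}) (by rw [Set.ncard_sdiff_singleton_of_mem hxA]; omega)
        fun h => hcol (h.of_degree_lt hx)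
      exact ⟨s, hs.trans Set.sdiff_subset, h⟩
    · push Not at hx
      exact ⟨A, le_rfl, Set.nonempty_iff_ne_empty.2 fun h => hcol (h ▸ hempty), hx⟩

/-- If all degrees are at least two, an avoidable vertex lies on an induced cycle. Otherwise the
exceptional vertex has at most one neighbour; it is deleted, and that neighbour becomes the
exceptional vertex. -/
theorem exists_inducedCycle_of_degree [Finite V] (n : ℕ) :
    ∀ (s : Set V) (q : V), s.ncard ≤ n → (∃ w ∈ s, w ≠ q) →
      (∀ x ∈ s, x ≠ q → 2 ≤ {u | u ∈ s ∧ G.Adj x u}.ncard) → ∃ D ∈ G.inducedCycles, D ⊆ s := by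
  induction n with
  | zero =>
    rintro s q hs ⟨w, hw, -⟩
    have := (Set.ncard_pos (s := s)).2 ⟨w, hw⟩
    omega
  | succ n ih =>
    rintro s q hs ⟨w, hw, hwq⟩ hdeg
    by_cases hall : ∀ x ∈ s, 2 ≤ {u | u ∈ s ∧ G.Adj x u}.ncard
    · obtain ⟨x, hxs, hx⟩ := G.exists_avoidable ⟨w, hw⟩
      obtain ⟨a, ha, b, hb, hab⟩ := (Set.one_lt_ncard_iff_nontrivial).1 (hall x hxs)
      obtain ⟨D, hD, hDs, -⟩ := hx.exists_inducedCycle hxs ha.1 hb.1 ha.2 hb.2 hab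
      exact ⟨D, hD, hDs⟩
    push Not at hall
    obtain ⟨x, hxs, hx⟩ := hall
    obtain rfl : x = q := by
      by_contra h
      have := hdeg x hxs h
      omega
    obtain ⟨q', hq'⟩ : ∃ q', ∀ u ∈ s, G.Adj x u → u = q' := by
      have h1 : {u | u ∈ s ∧ G.Adj x u}.ncard ≤ 1 := by omega
      rcases (Set.ncard_le_one_iff_eq (Set.toFinite _)).1 h1 with h | ⟨q', h⟩
      · exact ⟨x, fun u hu hxu => absurd (show u ∈ {u | u ∈ s ∧ G.Adj x u} from ⟨hu, hxu⟩)
          (by rw [h]; exact Set.notMem_empty u)⟩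
      · exact ⟨q', fun u hu hxu => by
          have : u ∈ {u | u ∈ s ∧ G.Adj x u} := ⟨hu, hxu⟩
          rwa [h] at this⟩
    obtain ⟨D, hD, hDs⟩ := ih (s \ {x}) q'
      (by rw [Set.ncard_sdiff_singleton_of_mem hxs]; omega) (by
        by_cases hwq' : w = q'
        · obtain ⟨u, hu, hux⟩ := Set.exists_ne_of_one_lt_ncard (hdeg w hw hwq) x
          exact ⟨u, ⟨hu.1, hux⟩, fun h => hu.2.ne (hwq'.trans h.symm)⟩
        · exact ⟨w, ⟨hw, hwq⟩, hwq'⟩) (by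
        intro v hv hvq'
        refine (hdeg v hv.1 hv.2).trans (Set.ncard_le_ncard fun u hu => ⟨⟨hu.1, ?_⟩, hu.2⟩)
        rintro rfl
        exact hvq' (hq' v hv.1 hu.2.symm))
    exact ⟨D, hD, hDs.trans Set.sdiff_subset⟩

theorem IsIndCycle.connSet_Icc {n : ℕ} {f : ℕ → V} (hf : G.IsIndCycle n f) {l r : ℕ} (hlr : l ≤ r)
    (hr : r < n) : G.ConnSet (f '' Set.Icc l r) :=
  connSet_image_Icc f hlr fun i _ hir => (hf.adj i (by omega) (i + 1) (by omega)).2 (Or.inl rfl)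

theorem IsIndCycle.disjoint_Icc {n : ℕ} {f : ℕ → V} (hf : G.IsIndCycle n f) {l r l' r' : ℕ}
    (hr : r < l') (hr' : r' < n) : Disjoint (f '' Set.Icc l r) (f '' Set.Icc l' r') := by
  rw [Set.disjoint_left]
  rintro _ ⟨i, hi, rfl⟩ ⟨j, hj, hij⟩
  rw [Set.mem_Icc] at hi hj
  have := hf.inj j (by omega) i (by omega) hij
  omega

theorem three_le_hadwigerNumber [Finite V] {D : Set V} (hD : D ∈ G.inducedCycles) :
    3 ≤ G.hadwigerNumber := by
  obtain ⟨n, f, hf, rfl⟩ := mem_inducedCycles_iff.1 hD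
  have h3 := hf.three_le
  refine le_hadwigerNumber ![f '' Set.Icc 0 0, f '' Set.Icc 1 1, f '' Set.Icc 2 (n - 1)] ?_ ?_ ?_
  · intro i
    fin_cases i
    exacts [hf.connSet_Icc (by omega) (by omega), hf.connSet_Icc (by omega) (by omega),
      hf.connSet_Icc (by omega) (by omega)]
  · intro i j hij
    fin_cases i <;> fin_cases j <;> first | exact absurd hij (by decide) | skip
    exacts [hf.disjoint_Icc (by omega) (by omega), hf.disjoint_Icc (by omega) (by omega),
      hf.disjoint_Icc (by omega) (by omega)]
  · intro i j hij
    fin_cases i <;> fin_cases j <;> first | exact absurd hij (by decide) | skip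
    · exact ⟨f 0, ⟨0, by simp, rfl⟩, f 1, ⟨1, by simp, rfl⟩,
        (hf.adj _ (by omega) _ (by omega)).2 (by omega)⟩
    · exact ⟨f 0, ⟨0, by simp, rfl⟩, f (n - 1), ⟨n - 1, ⟨by omega, le_rfl⟩, rfl⟩,
        (hf.adj _ (by omega) _ (by omega)).2 (by omega)⟩
    · exact ⟨f 1, ⟨1, by simp, rfl⟩, f 2, ⟨2, ⟨le_rfl, by omega⟩, rfl⟩,
        (hf.adj _ (by omega) _ (by omega)).2 (by omega)⟩

/-- Cut the cycle into three arcs, each beginning at one of the three attachments; together with `Y`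
they are the branch sets. -/
theorem four_le_hadwigerNumber [Finite V] {D Y : Set V} (hD : D ∈ G.inducedCycles)
    (hY : G.ConnSet Y) (hdis : Disjoint D Y) {a b c : V} (ha : a ∈ D) (hb : b ∈ D) (hc : c ∈ D)
    (hab : a ≠ b) (hac : a ≠ c) (hbc : b ≠ c) (haY : ∃ y ∈ Y, G.Adj a y) (hbY : ∃ y ∈ Y, G.Adj b y)
    (hcY : ∃ y ∈ Y, G.Adj c y) : 4 ≤ G.hadwigerNumber := by
  obtain ⟨n, f, hf, rfl, rfl⟩ := exists_isIndCycle_start hD ha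
  have h3 := hf.three_le
  obtain ⟨k, l, hk, hkl, hln, hkY, hlY⟩ : ∃ k l, 1 ≤ k ∧ k < l ∧ l < n ∧ (∃ y ∈ Y, G.Adj (f k) y) ∧
      ∃ y ∈ Y, G.Adj (f l) y := by
    obtain ⟨k, hk, rfl⟩ := hb
    obtain ⟨l, hl, rfl⟩ := hc
    have hk0 : k ≠ 0 := fun h => hab (by rw [h])
    have hl0 : l ≠ 0 := fun h => hac (by rw [h])
    have hkl : k ≠ l := fun h => hbc (by rw [h])
    rw [Set.mem_Iio] at hk hl
    rcases lt_or_gt_of_ne hkl with h | h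
    exacts [⟨k, l, by omega, h, hl, hbY, hcY⟩, ⟨l, k, by omega, h, hk, hcY, hbY⟩]
  have hd : ∀ l r, r < n → Disjoint (f '' Set.Icc l r) Y := fun l r hr =>
    hdis.mono_left (Set.image_mono fun i hi => Set.mem_Iio.2 (hi.2.trans_lt hr))
  refine le_hadwigerNumber ![f '' Set.Icc 0 (k - 1), f '' Set.Icc k (l - 1),
    f '' Set.Icc l (n - 1), Y] ?_ ?_ ?_
  · intro i
    fin_cases i
    exacts [hf.connSet_Icc (by omega) (by omega), hf.connSet_Icc (by omega) (by omega),
      hf.connSet_Icc (by omega) (by omega), hY]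
  · intro i j hij
    fin_cases i <;> fin_cases j <;> first | exact absurd hij (by decide) | skip
    exacts [hf.disjoint_Icc (by omega) (by omega), hf.disjoint_Icc (by omega) (by omega),
      hd _ _ (by omega), hf.disjoint_Icc (by omega) (by omega), hd _ _ (by omega),
      hd _ _ (by omega)]
  · intro i j hij
    fin_cases i <;> fin_cases j <;> first | exact absurd hij (by decide) | skip
    · exact ⟨f (k - 1), ⟨k - 1, ⟨by omega, le_rfl⟩, rfl⟩, f k, ⟨k, ⟨le_rfl, by omega⟩, rfl⟩,
        (hf.adj _ (by omega) _ (by omega)).2 (by omega)⟩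
    · exact ⟨f 0, ⟨0, ⟨le_rfl, by omega⟩, rfl⟩, f (n - 1), ⟨n - 1, ⟨by omega, le_rfl⟩, rfl⟩,
        (hf.adj _ (by omega) _ (by omega)).2 (by omega)⟩
    · exact ⟨f 0, ⟨0, ⟨le_rfl, by omega⟩, rfl⟩, haY⟩
    · exact ⟨f (l - 1), ⟨l - 1, ⟨by omega, le_rfl⟩, rfl⟩, f l, ⟨l, ⟨le_rfl, by omega⟩, rfl⟩,
        (hf.adj _ (by omega) _ (by omega)).2 (by omega)⟩
    · exact ⟨f k, ⟨k, ⟨le_rfl, by omega⟩, rfl⟩, hkY⟩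
    · exact ⟨f l, ⟨l, ⟨le_rfl, by omega⟩, rfl⟩, hlY⟩

/-- A graph of minimum degree at least three has a `K⁴` minor. -/
theorem four_le_hadwigerNumber_of_degree [Finite V] {s : Set V} (hs : s.Nonempty)
    (hdeg : ∀ x ∈ s, 3 ≤ {u | u ∈ s ∧ G.Adj x u}.ncard) : 4 ≤ G.hadwigerNumber := by
  -- In a minimal such `t`, choose an induced cycle `D` and a connected `Y` off `D` with `Y` as
  -- large as possible. Three attachments of `Y` on `D` give the minor; with fewer, `Y` could be
  -- enlarged.
  obtain ⟨t, -, ⟨⟨htne, htdeg⟩, htmin⟩⟩ := Finite.exists_le_minimal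
    (p := fun s : Set V => s.Nonempty ∧ ∀ x ∈ s, 3 ≤ {u | u ∈ s ∧ G.Adj x u}.ncard) ⟨hs, hdeg⟩
  clear hs hdeg s
  have hcyc : ∃ D ∈ G.inducedCycles, D ⊆ t := by
    obtain ⟨w, hw⟩ := htne
    obtain ⟨u, hu⟩ := (Set.ncard_pos (s := {u | u ∈ t ∧ G.Adj w u})).1
      (by have := htdeg w hw; omega)
    exact exists_inducedCycle_of_degree t.ncard t w le_rfl ⟨u, hu.1, hu.2.ne'⟩ fun x hx _ => by
      have := htdeg x hx
      omega
  let Q : Set (Set V × Set V) := {z | z.1 ∈ G.inducedCycles ∧ z.1 ⊆ t ∧ G.ConnSet z.2 ∧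
    z.2 ⊆ t \ z.1}
  have hQ : Q.Nonempty := by
    obtain ⟨D, hD, hDt⟩ := hcyc
    have hne : (t \ D).Nonempty := by
      by_contra hemp
      rw [Set.not_nonempty_iff_eq_empty, Set.sdiff_eq_empty] at hemp
      obtain rfl := hDt.antisymm hemp
      obtain ⟨x, hx⟩ := htne
      obtain ⟨a, b, -, -, hab⟩ := exists_pathSet_of_mem_inducedCycles hD hx
      have h1 : {u | u ∈ D ∧ G.Adj x u} ⊆ {a, b} := fun u hu => (hab u ⟨hu.1, hu.2.ne'⟩).1 hu.2
      have h2 := (Set.ncard_le_ncard h1).trans (Set.ncard_insert_le a {b})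
      rw [Set.ncard_singleton] at h2
      have := htdeg x hx
      omega
    obtain ⟨y, hy⟩ := hne
    exact ⟨(D, {y}), hD, hDt, connSet_singleton y, by simpa using hy⟩
  obtain ⟨⟨D, Y⟩, ⟨hD, hDt, hYc, hYt⟩, hmax⟩ :=
    Set.exists_max_image Q (fun z => z.2.ncard) Q.toFinite hQ
  dsimp only at hD hDt hYc hYt hmax
  have hYcl : ∀ y ∈ Y, ∀ u ∈ t \ D, G.Adj y u → u ∈ Y := by
    intro y hy u hu hyu
    by_contra huY
    have := hmax (D, insert u Y) ⟨hD, hDt, hYc.insert_adj hy hyu, Set.insert_subset hu hYt⟩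
    rw [Set.ncard_insert_of_notMem huY] at this
    omega
  have hDY : Disjoint D Y := Set.disjoint_left.2 fun v hv hvY => (hYt hvY).2 hv
  obtain ⟨p, hpD, yp, hyp, hpy⟩ : ∃ p ∈ D, ∃ y ∈ Y, G.Adj p y := by
    by_contra hno
    push Not at hno
    obtain ⟨d, hd⟩ : D.Nonempty := by
      obtain ⟨n, f, hf, rfl⟩ := mem_inducedCycles_iff.1 hD
      exact ⟨f 0, 0, Set.mem_Iio.2 (by have := hf.three_le; omega), rfl⟩
    -- With no attachment on `D`, the set `Y` is a component of `t`, so removing it keeps all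
    -- degrees, against the minimality of `t`.
    have hsub : t ⊆ t \ Y := by
      refine htmin (y := t \ Y) ⟨⟨d, hDt hd, Set.disjoint_left.1 hDY hd⟩, fun x hx => ?_⟩
        Set.sdiff_subset
      refine (htdeg x hx.1).trans (Set.ncard_le_ncard fun u hu => ⟨⟨hu.1, fun huY => ?_⟩, hu.2⟩)
      by_cases hxD : x ∈ D
      · exact hno x hxD u huY hu.2
      · exact hx.2 (hYcl u huY x ⟨hx.1, hxD⟩ hu.2.symm)
    obtain ⟨y, hy⟩ := hYc.1
    exact (hsub (hYt hy).1).2 hy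
  by_contra hlt
  obtain ⟨q, hq⟩ : ∃ q, ∀ d ∈ D, (∃ y ∈ Y, G.Adj d y) → d = p ∨ d = q := by
    by_cases h : ∃ q ∈ D, q ≠ p ∧ ∃ y ∈ Y, G.Adj q y
    · obtain ⟨q, hqD, hqp, hqY⟩ := h
      refine ⟨q, fun d hd hdY => ?_⟩
      by_contra hne
      rw [not_or] at hne
      exact hlt (four_le_hadwigerNumber hD hYc hDY hpD hqD hd hqp.symm (Ne.symm hne.1)
        (Ne.symm hne.2) ⟨yp, hyp, hpy⟩ hqY hdY)
    · push Not at h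
      refine ⟨p, fun d hd ⟨y, hy, hdy⟩ => ?_⟩
      by_contra hne
      rw [or_self] at hne
      exact h d hd hne y hy hdy
  obtain ⟨w, hwD, hwp, hwq⟩ : ∃ w ∈ D, w ≠ p ∧ w ≠ q := by
    obtain ⟨a, b, hab, hP, -⟩ := exists_pathSet_of_mem_inducedCycles hD hpD
    by_cases haq : a = q
    · exact ⟨b, hP.right_mem.1, hP.right_mem.2, fun h => hab (haq.trans h.symm)⟩
    · exact ⟨a, hP.left_mem.1, hP.left_mem.2, haq⟩
  -- Outside `Y` only `p` and `q` have neighbours in `Y`. Hence every other remaining vertex loses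
  -- at most the neighbour `p` and keeps degree two. The cycle found there leaves room for the
  -- larger set `insert p Y`.
  obtain ⟨D', hD', hD't⟩ := exists_inducedCycle_of_degree (G := G) _ ((t \ Y) \ {p}) q le_rfl
    ⟨w, ⟨⟨hDt hwD, Set.disjoint_left.1 hDY hwD⟩, hwp⟩, hwq⟩ (by
      rintro x ⟨⟨hxt, hxY⟩, hxp⟩ hxq
      have hsub : {u | u ∈ t ∧ G.Adj x u} ⊆ insert p {u | u ∈ (t \ Y) \ {p} ∧ G.Adj x u} := by
        intro u hu
        by_cases hup : u = p
        · exact Or.inl hup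
        refine Or.inr ⟨⟨⟨hu.1, fun huY => ?_⟩, hup⟩, hu.2⟩
        by_cases hxD : x ∈ D
        · rcases hq x hxD ⟨u, huY, hu.2⟩ with h | h
          exacts [hxp h, hxq h]
        · exact hxY (hYcl u huY x ⟨hxt, hxD⟩ hu.2.symm)
      have h1 := htdeg x hxt
      have h2 := (Set.ncard_le_ncard hsub).trans (Set.ncard_insert_le _ _)
      omega)
  have hpY : p ∉ Y := Set.disjoint_left.1 hDY hpD
  have := hmax (D', insert p Y) ⟨hD', hD't.trans (Set.sdiff_subset.trans Set.sdiff_subset),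
    hYc.insert_adj hyp hpy.symm, Set.insert_subset ⟨hDt hpD, fun h => (hD't h).2 rfl⟩
      fun y hy => ⟨(hYt hy).1, fun h => (hD't h).1.2 hy⟩⟩
  rw [Set.ncard_insert_of_notMem hpY] at this
  omega

/-- Hadwiger's conjecture for graphs of Hadwiger number at most three. -/
theorem colorableOn_of_hadwigerNumber_le_three [Finite V] [Nonempty V] (hh : G.hadwigerNumber ≤ 3) :
    G.ColorableOn Set.univ G.hadwigerNumber := by
  by_contra hcol
  obtain ⟨s, -, ⟨x, hx⟩, hdeg⟩ := exists_min_degree_of_not_colorableOn _ _ le_rfl hcol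
  have hx' := hdeg x hx
  -- A nonempty set of minimum degree at least `0`, `1`, `2` or `3` yields a complete minor on one
  -- vertex more: a vertex, an edge, a cycle, or `four_le_hadwigerNumber_of_degree`.
  interval_cases hn : G.hadwigerNumber
  · have := le_hadwigerNumber (G := G) (t := 1) (fun _ => {x}) (fun _ => connSet_singleton x)
      (fun i j hij => absurd hij (by omega)) (fun i j hij => absurd hij (by omega))
    omega
  · obtain ⟨u, hu⟩ := (Set.ncard_pos (s := {u | u ∈ s ∧ G.Adj x u})).1 (by omega)
    have : 2 ≤ G.hadwigerNumber := by
      refine le_hadwigerNumber ![{x}, {u}] ?_ ?_ ?_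
      · intro i
        fin_cases i
        exacts [connSet_singleton x, connSet_singleton u]
      · intro i j hij
        fin_cases i <;> fin_cases j <;> first | exact absurd hij (by decide) | skip
        simpa using hu.2.ne
      · intro i j hij
        fin_cases i <;> fin_cases j <;> first | exact absurd hij (by decide) | skip
        exact ⟨x, rfl, u, rfl, hu.2⟩
    omega
  · obtain ⟨u, hu⟩ := (Set.ncard_pos (s := {u | u ∈ s ∧ G.Adj x u})).1 (by omega)
    obtain ⟨D, hD, -⟩ := exists_inducedCycle_of_degree (G := G) _ s x le_rfl
      ⟨u, hu.1, hu.2.ne'⟩ fun v hv _ => hdeg v hv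
    have := three_le_hadwigerNumber hD
    omega
  · have := four_le_hadwigerNumber_of_degree ⟨x, hx⟩ hdeg
    omega

end SimpleGraph

theorem theorem5p2p1 {V : Type*} [Finite V] (G : SimpleGraph V) (hG : G.Connected)
    (h : (SimpleGraph.completeGraph (Fin G.hadwigerNumber)).beth1 = G.beth1 ∨
      (SimpleGraph.completeGraph (Fin G.hadwigerNumber)).beth2 = G.beth2 ∨
      (SimpleGraph.completeGraph (Fin G.hadwigerNumber)).beth3 = G.beth3) :
    G.chromaticNumber ≤ (G.hadwigerNumber : ℕ∞) := by
  have := hG.nonempty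
  by_cases hh : 4 ≤ G.hadwigerNumber
  · exact (SimpleGraph.colorableOn_of_beth_eq hG hh h).chromaticNumber_le
  · exact (SimpleGraph.colorableOn_of_hadwigerNumber_le_three (by omega)).chromaticNumber_le
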